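/- Let $\tau$ be a partition of $N$ whose Ferrers diagram has at least two columns ($\tau_1\ge 2$), $\ell(\tau)$ its length and $h_\tau=\tau_1+\ell(\tau)-1$ its maximal hook length. A reverse standard Young tableau (RSYT) of shape $\tau$ is a bijective filling of the boxes with $1,\dots,N$ decreasing along rows and down columns; $\mathcal Y(\tau)$ is the set of these, $c(i,S)=\mathrm{col}(i,S)-\mathrm{row}(i,S)$ is the content of the entry $i$ of $S$, $S^{(i)}$ is $S$ with $i,i+1$ exchanged, and $S_0$ is the RSYT with $N,N-1,\dots,1$ entered column by column. All operators act on the right. Let $K$ be a field of characteristic $0$ and $q,t\in K$ nonzero with $t$ not a root of unity. On the space $V_\tau$ with basis $\mathcal Y(\tau)$ the Hecke algebra with generators $T_1,\dots,T_{N-1}$, $(T_i+1)(T_i-t)=0$, acts by $\tau$: with $b=c(i,S)-c(i+1,S)$, $S\tau(T_i)=tS$ if $i,i+1$ are in the same row of $S$; $S\tau(T_i)=-S$ if they are in the same column; $S\tau(T_i)=S^{(i)}+\frac{t-1}{1-t^{-b}}S$ if $b\ge2$; and $S\tau(T_i)=\frac{t(t^{b+1}-1)(t^{b-1}-1)}{(t^b-1)^2}S^{(i)}+\frac{t^b(t-1)}{t^b-1}S$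 if $b\le-2$. On $\mathcal P_\tau=K[x_1,\dots,x_N]\otimes V_\tau$ set, with $s_i$ exchanging the $i$-th and $(i+1)$-st coordinates of $x$, $$(p\otimes S)\boldsymbol T_i=(1-t)x_{i+1}\frac{p(x)-p(x.s_i)}{x_i-x_{i+1}}\otimes S+p(x.s_i)\otimes S\tau(T_i),$$ $$(p\otimes S)\boldsymbol w=p(qx_N,x_1,\dots,x_{N-1})\otimes S\tau(T_1T_2\cdots T_{N-1}),$$ $$\boldsymbol\xi_i=t^{i-N}\boldsymbol T_{i-1}^{-1}\cdots\boldsymbol T_1^{-1}\boldsymbol w\boldsymbol T_{N-1}\cdots\boldsymbol T_i,\qquad \mathcal D_N=(1-\boldsymbol\xi_N)/x_N,\qquad \mathcal D_i=\tfrac1t\boldsymbol T_i\mathcal D_{i+1}\boldsymbol T_i .$$ For a composition $\alpha\in\mathbb N_0^N$ let $\alpha^+$ be its nonincreasing rearrangement and $r_\alpha(i)=\#\{j:\alpha_j>\alpha_i\}+\#\{j\le i:\alpha_j=\alpha_i\}$. Write $\alpha\succ\beta$ if $\alpha\ne\beta$ and $\sum_{i\le j}(\alpha_i-\beta_i)\ge0$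 for all $j$, and $\alpha\vartriangleright\beta$ if $|\alpha|=|\beta|$ and either $\alpha^+\succ\beta^+$, or $\alpha^+=\beta^+$ and $\alpha\succ\beta$. For a partition $\alpha$ (that is, $\alpha=\alpha^+$) and $S\in\mathcal Y(\tau)$, the Macdonald polynomial $M_{\alpha,S}$ is the element of $\mathcal P_\tau$ over $K=\mathbb Q(q,t)$ ($q,t$ indeterminates) with $$M_{\alpha,S}\,\boldsymbol\xi_i=q^{\alpha_i}t^{c(r_\alpha(i),S)}M_{\alpha,S}\ (1\le i\le N),\qquad M_{\alpha,S}=q^at^b\,x^\alpha\otimes S+\sum_{\alpha\vartriangleright\beta}x^\beta\otimes v_\beta$$ for some $a,b\in\mathbb N_0$ and $v_\beta\in V_\tau$ (the choice of the monomial $q^at^b$ is immaterial below). Proposition. Let $m$ be the length of the last column of $\tau$ and $\alpha=(1^m,0^{N-m})$. Then $M_{\alpha,S_0}$ exists and, however the monomial $q^at^b$ is chosen, it is singular for $q=t^{-h_\tau}$: for every field $L$ of characteristic $0$ and every nonzero $t_0\in L$ that is not a root of unity, with $q_0=t_0^{-h_\tau}$, the coefficients of $M_{\alpha,S_0}$ have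 no pole at $(q,t)=(q_0,t_0)$, and the specialization of $M_{\alpha,S_0}$ at $(q_0,t_0)$ is a nonzero polynomial over $L$ annihilated by $\mathcal D_1,\dots,\mathcal D_N$ (taken with the parameters $q_0,t_0$). -/

import Mathlib

/-!
Vector-valued nonsymmetric Macdonald polynomials.

Indices are zero-based: `N = n + 1`, the variable `x_i` (`1 ≤ i ≤ N`) is `X (i - 1)` with index in
`Fin (n + 1)`, the Hecke generator `T_i` (`1 ≤ i < N`) has index `i - 1` in `Fin n`, and it involves
the two variables with indices `i.castSucc` and `i.succ`. The number `k` in a tableau is represented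
by `k - 1` in `Fin (n + 1)`. All operators act on the right in the mathematics, so that a word
`A B C` is applied as "first `A`, then `B`, then `C`".
-/

noncomputable section

namespace VVMac

open MvPolynomial

/-! ### Compositions -/

/-- The sum of the parts `|α|`. -/
def wt {n : ℕ} (α : Fin (n + 1) → ℕ) : ℕ := ∑ i, α i

/-- The nonincreasing rearrangement `α⁺`. -/
def decr {n : ℕ} (α : Fin (n + 1) → ℕ) : Fin (n + 1) → ℕ :=
  fun i => α (Tuple.sort α (Fin.rev i))

/-- Strict dominance `α ≻ β`. -/
def Dominates {n : ℕ} (α β : Fin (n + 1) → ℕ) : Prop :=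
  α ≠ β ∧ ∀ j, ∑ i ∈ Finset.Iic j, β i ≤ ∑ i ∈ Finset.Iic j, α i

/-- The order `α ▷ β` on compositions. -/
def Above {n : ℕ} (α β : Fin (n + 1) → ℕ) : Prop :=
  wt α = wt β ∧ (Dominates (decr α) (decr β) ∨ (decr α = decr β ∧ Dominates α β))

/-- The number of inversions `#{(i, j) : i < j, α_i < α_j}`. -/
def inv {n : ℕ} (α : Fin (n + 1) → ℕ) : ℕ :=
  (Finset.univ.filter fun p : Fin (n + 1) × Fin (n + 1) => p.1 < p.2 ∧ α p.1 < α p.2).card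

/-- `α.s_i`, the composition with the entries number `i` and `i + 1` exchanged. -/
def swapAt {n : ℕ} (α : Fin (n + 1) → ℕ) (i : Fin n) : Fin (n + 1) → ℕ :=
  fun j => α (Equiv.swap i.castSucc i.succ j)

/-- The rank function `r_α(i) = #{j : α_j > α_i} + #{j ≤ i : α_j = α_i}`, shifted to start at `0`
(hence `j < i` instead of `j ≤ i`). -/
def rank {n : ℕ} (α : Fin (n + 1) → ℕ) (i : Fin (n + 1)) : Fin (n + 1) :=
  ⟨(Finset.univ.filter fun j => α i < α j).card +
      (Finset.univ.filter fun j => j < i ∧ α j = α i).card, by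
    rw [← Finset.card_union_of_disjoint]
    · refine lt_of_lt_of_eq (Finset.card_lt_univ_of_notMem (x := i) ?_) (Fintype.card_fin _)
      simp
    · rw [Finset.disjoint_filter]
      rintro j - h1 ⟨-, h2⟩
      omega⟩

/-! ### Reverse standard Young tableaux -/

/-- A reverse standard Young tableau of shape `μ`: a bijective filling of the boxes with the
numbers `1, …, N` (shifted to `0, …, n`) that decreases along every row and down every column.
Boxes are pairs (row, column), both counted from `0`. -/
@[ext] structure RSYT (μ : YoungDiagram) (n : ℕ) where
  entry : {c : ℕ × ℕ // c ∈ μ.cells} ≃ Fin (n + 1)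
  row_decr : ∀ c c', c.1.1 = c'.1.1 → c.1.2 < c'.1.2 → entry c' < entry c
  col_decr : ∀ c c', c.1.2 = c'.1.2 → c.1.1 < c'.1.1 → entry c' < entry c

instance (μ : YoungDiagram) (n : ℕ) : Finite (RSYT μ n) :=
  Finite.of_injective RSYT.entry fun _ _ h => RSYT.ext h

instance (μ : YoungDiagram) (n : ℕ) : Fintype (RSYT μ n) := Fintype.ofFinite _

instance (μ : YoungDiagram) (n : ℕ) : DecidableEq (RSYT μ n) := Classical.decEq _

variable {μ : YoungDiagram} {n : ℕ}

/-- The row of the number `k`. -/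
def RSYT.row (S : RSYT μ n) (k : Fin (n + 1)) : ℕ := (S.entry.symm k).1.1

/-- The column of the number `k`. -/
def RSYT.col (S : RSYT μ n) (k : Fin (n + 1)) : ℕ := (S.entry.symm k).1.2

/-- The content `c(k, S) = col(k, S) - row(k, S)`. -/
def RSYT.content (S : RSYT μ n) (k : Fin (n + 1)) : ℤ := (S.col k : ℤ) - (S.row k : ℤ)

/-- `S'` is the filling `S^{(i)}`: `S` with the numbers `i` and `i + 1` exchanged. -/
def RSYT.IsExchange (i : Fin n) (S S' : RSYT μ n) : Prop :=
  ∀ c, S'.entry c = Equiv.swap i.castSucc i.succ (S.entry c)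

/-- The order of the boxes column by column, each column from top to bottom. -/
def colOrderEmb : ℕ × ℕ ↪ ℕ ×ₗ ℕ :=
  ⟨fun c => toLex (c.2, c.1), fun c c' h => by
    have h' := toLex.injective h
    simp only [Prod.mk.injEq] at h'
    exact Prod.ext h'.2 h'.1⟩

/-- The boxes of `μ`, listed column by column. -/
def colEquiv (h : μ.card = n + 1) : {c : ℕ × ℕ // c ∈ μ.cells} ≃ Fin (n + 1) :=
  (Equiv.ofBijective
    (fun c => (⟨colOrderEmb c.1, Finset.mem_map_of_mem _ c.2⟩ :
      {x // x ∈ μ.cells.map colOrderEmb}))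
    ⟨fun c c' hc => Subtype.ext (colOrderEmb.injective (congrArg Subtype.val hc)),
      fun x => by
        obtain ⟨c, hc, hx⟩ := Finset.mem_map.1 x.2
        exact ⟨⟨c, hc⟩, Subtype.ext hx⟩⟩).trans
    ((μ.cells.map colOrderEmb).orderIsoOfFin ((Finset.card_map _).trans h)).symm.toEquiv

theorem colEquiv_lt (h : μ.card = n + 1) (c c' : {c : ℕ × ℕ // c ∈ μ.cells})
    (hc : toLex (c.1.2, c.1.1) < toLex (c'.1.2, c'.1.1)) : colEquiv h c < colEquiv h c' :=
  ((μ.cells.map colOrderEmb).orderIsoOfFin ((Finset.card_map _).trans h)).symm.lt_iff_lt.2 hc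

/-- The tableau `S₀`: the numbers `N, N - 1, …, 1` entered column by column. -/
def columnFilled (h : μ.card = n + 1) : RSYT μ n where
  entry := (colEquiv h).trans Fin.revPerm
  row_decr c c' _ h2 := by
    simpa using colEquiv_lt h c c' (Prod.Lex.toLex_lt_toLex.2 (Or.inl h2))
  col_decr c c' h1 h2 := by
    simpa using colEquiv_lt h c c' (Prod.Lex.toLex_lt_toLex.2 (Or.inr ⟨h1, h2⟩))

/-! ### The representation of the Hecke algebra on `V_τ` -/

variable {K : Type*} [Field K]

open Classical in
/-- The matrix of `τ(T_i)`: `S τ(T_i) = ∑ S', heckeMatrix t i S S' • S'`. -/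
def heckeMatrix (t : K) (i : Fin n) : Matrix (RSYT μ n) (RSYT μ n) K := fun S S' =>
  let b : ℤ := S.content i.castSucc - S.content i.succ
  if S.row i.castSucc = S.row i.succ then
    (if S' = S then t else 0)
  else if S.col i.castSucc = S.col i.succ then
    (if S' = S then -1 else 0)
  else if 2 ≤ b then
    (if S' = S then (t - 1) / (1 - t ^ (-b)) else if S.IsExchange i S' then 1 else 0)
  else
    (if S' = S then t ^ b * (t - 1) / (t ^ b - 1)
      else if S.IsExchange i S' then
        t * (t ^ (b + 1) - 1) * (t ^ (b - 1) - 1) / (t ^ b - 1) ^ 2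
      else 0)

/-- The matrix of `τ(ω)`, `ω = T_1 T_2 ⋯ T_{N-1}`. -/
def omegaMatrix (t : K) : Matrix (RSYT μ n) (RSYT μ n) K :=
  (List.ofFn fun i : Fin n => heckeMatrix t i).prod

/-- `v` is the vector `S τ(R_α)`, where `R_α = (T_{i_1} ⋯ T_{i_k})⁻¹` for a shortest word with
`α.s_{i_1} ⋯ s_{i_k} = α⁺`; that is, `v τ(T_{i_1}) ⋯ τ(T_{i_k}) = S`. -/
def IsLeadingVector (t : K) (α : Fin (n + 1) → ℕ) (S : RSYT μ n) (v : RSYT μ n → K) : Prop :=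
  ∃ l : List (Fin n), l.length = inv α ∧ l.foldl swapAt α = decr α ∧
    l.foldl (fun u i => Matrix.vecMul u (heckeMatrix t i)) v = Pi.single S 1

/-! ### Vector-valued polynomials and the operators on them -/

/-- `P_τ = K[x_1, …, x_N] ⊗ V_τ`; the function `f` stands for `∑ S, f S ⊗ S`. -/
abbrev VPoly (K : Type*) [Field K] (μ : YoungDiagram) (n : ℕ) : Type _ :=
  RSYT μ n → MvPolynomial (Fin (n + 1)) K

/-- `p(x) ↦ p(x.s_i)`. -/
def swapVars (i : Fin n) (p : MvPolynomial (Fin (n + 1)) K) : MvPolynomial (Fin (n + 1)) K :=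
  rename (Equiv.swap i.castSucc i.succ) p

theorem exists_dividedDiff (i : Fin n) (p : MvPolynomial (Fin (n + 1)) K) :
    ∃ r, p - swapVars i p = (X i.castSucc - X i.succ) * r := by
  change (X i.castSucc - X i.succ : MvPolynomial (Fin (n + 1)) K) ∣ _
  induction p using MvPolynomial.induction_on with
  | C a => simp [swapVars]
  | add p q hp hq =>
    have : p + q - swapVars i (p + q) = (p - swapVars i p) + (q - swapVars i q) := by
      simp only [swapVars, map_add]; ring
    rw [this]; exact dvd_add hp hq
  | mul_X p k hp =>
    have : p * X k - swapVars i (p * X k) =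
        (p - swapVars i p) * X k +
          swapVars i p * (X k - X (Equiv.swap i.castSucc i.succ k)) := by
      simp only [swapVars, map_mul, rename_X]; ring
    rw [this]
    refine dvd_add (hp.mul_right _) (Dvd.dvd.mul_left ?_ _)
    by_cases h1 : k = i.castSucc
    · subst h1; simp
    · by_cases h2 : k = i.succ
      · subst h2
        rw [Equiv.swap_apply_right, ← neg_sub, neg_dvd]
      · rw [Equiv.swap_apply_of_ne_of_ne h1 h2]; simp

/-- `(p(x) - p(x.s_i)) / (x_i - x_{i+1})`. -/
def dividedDiff (i : Fin n) (p : MvPolynomial (Fin (n + 1)) K) : MvPolynomial (Fin (n + 1)) K :=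
  (exists_dividedDiff i p).choose

theorem dividedDiff_spec (i : Fin n) (p : MvPolynomial (Fin (n + 1)) K) :
    p - swapVars i p = (X i.castSucc - X i.succ) * dividedDiff i p :=
  (exists_dividedDiff i p).choose_spec

/-- The operator `𝐓_i`:
`(p ⊗ S) 𝐓_i = (1 - t) x_{i+1} (p(x) - p(x.s_i)) / (x_i - x_{i+1}) ⊗ S + p(x.s_i) ⊗ S τ(T_i)`. -/
def opT (t : K) (i : Fin n) (f : VPoly K μ n) : VPoly K μ n := fun S =>
  C (1 - t) * X i.succ * dividedDiff i (f S) +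
    ∑ S', C (heckeMatrix t i S' S) * swapVars i (f S')

/-- The inverse operator `𝐓_i⁻¹ = (1/t)(𝐓_i + 1 - t)`. -/
def opTinv (t : K) (i : Fin n) (f : VPoly K μ n) : VPoly K μ n :=
  t⁻¹ • (opT t i f + (1 - t) • f)

/-- `p(x) ↦ p(q x_N, x_1, …, x_{N-1})`. -/
def shiftVars (q : K) : MvPolynomial (Fin (n + 1)) K →ₐ[K] MvPolynomial (Fin (n + 1)) K :=
  aeval (Fin.cons (C q * X (Fin.last n)) fun k : Fin n => X k.castSucc)

/-- The operator `𝐰`: `(p ⊗ S) 𝐰 = p(q x_N, x_1, …, x_{N-1}) ⊗ S τ(ω)`. -/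
def opW (q t : K) (f : VPoly K μ n) : VPoly K μ n := fun S =>
  ∑ S', C (omegaMatrix t S' S) * shiftVars q (f S')

/-- The Cherednik operator
`ξ_i = t^{i-N} 𝐓_{i-1}⁻¹ ⋯ 𝐓_1⁻¹ 𝐰 𝐓_{N-1} ⋯ 𝐓_i`. -/
def opXi (q t : K) (i : Fin (n + 1)) (f : VPoly K μ n) : VPoly K μ n :=
  let down : List (Fin n) := (List.finRange n).reverse
  let g := (down.filter fun k => k.castSucc < i).foldl (fun h k => opTinv t k h) f
  t ^ ((i : ℤ) - (n : ℤ)) •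
    (down.filter fun k => i ≤ k.castSucc).foldl (fun h k => opT t k h) (opW q t g)

/-- The operator `𝓓_N = (1 - ξ_N) / x_N`. (The polynomial `f - f ξ_N` is divisible by `x_N`;
`divMonomial` is the exact quotient then.) -/
def opDlast (q t : K) (f : VPoly K μ n) : VPoly K μ n := fun S =>
  (f S - opXi q t (Fin.last n) f S).divMonomial (Finsupp.single (Fin.last n) 1)

/-- The Dunkl operators: `𝓓_N` as above and `𝓓_i = (1/t) 𝐓_i 𝓓_{i+1} 𝐓_i`. -/
def opD (q t : K) : Fin (n + 1) → VPoly K μ n → VPoly K μ n :=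
  Fin.reverseInduction (motive := fun _ => VPoly K μ n → VPoly K μ n) (opDlast q t)
    fun i D f => t⁻¹ • opT t i (D (opT t i f))

/-- `f` is singular: it is annihilated by all `𝓓_i`. -/
def IsSingular (q t : K) (f : VPoly K μ n) : Prop := ∀ i, opD q t i f = 0

/-! ### Macdonald polynomials -/

/-- The spectral vector `ζ_{α,S}(i) = q^{α_i} t^{c(r_α(i), S)}`. -/
def zeta (q t : K) (α : Fin (n + 1) → ℕ) (S : RSYT μ n) (i : Fin (n + 1)) : K :=
  q ^ α i * t ^ S.content (rank α i)

/-- `f` is the Macdonald polynomial `M_{α,S}`, normalized up to a monomial `q^a t^b`: it is a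
simultaneous eigenfunction of the `ξ_i` with spectral vector `ζ_{α,S}`, and
`f = q^a t^b x^α ⊗ S τ(R_α) + ∑_{α ▷ β} x^β ⊗ v_β`. -/
structure IsMacdonald (q t : K) (α : Fin (n + 1) → ℕ) (S : RSYT μ n) (f : VPoly K μ n) :
    Prop where
  eigen : ∀ i, opXi q t i f = zeta q t α S i • f
  leading : ∃ (a b : ℕ) (v : RSYT μ n → K), IsLeadingVector t α S v ∧
    ∀ S', coeff (Finsupp.equivFunOnFinite.symm α) (f S') = q ^ a * t ^ b * v S'
  lower : ∀ (β : Fin (n + 1) →₀ ℕ) (S' : RSYT μ n), coeff β (f S') ≠ 0 → ⇑β = α ∨ Above α β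

/-! ### The field `ℚ(q, t)` and specialization -/

/-- The field of rational functions `ℚ(q, t)`. -/
abbrev Qqt : Type := FractionRing (MvPolynomial (Fin 2) ℚ)

/-- The indeterminate `q`. -/
def qGen : Qqt := algebraMap (MvPolynomial (Fin 2) ℚ) Qqt (X 0)

/-- The indeterminate `t`. -/
def tGen : Qqt := algebraMap (MvPolynomial (Fin 2) ℚ) Qqt (X 1)

/-- The rational function `c ∈ ℚ(q, t)` has no pole at `(q₀, t₀)` and its value there is `c₀`. -/
def HasValueAt {L : Type*} [Field L] [CharZero L] (q₀ t₀ : L) (c : Qqt) (c₀ : L) : Prop :=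
  ∃ a b : MvPolynomial (Fin 2) ℚ, aeval ![q₀, t₀] b ≠ 0 ∧
    c = algebraMap _ Qqt a / algebraMap _ Qqt b ∧
    c₀ = aeval ![q₀, t₀] a / aeval ![q₀, t₀] b

/-- All coefficients of `f` are regular at `(q₀, t₀)`, and `f₀` is the specialization of `f`. -/
def SpecializesTo {L : Type*} [Field L] [CharZero L] (q₀ t₀ : L)
    (f : VPoly Qqt μ n) (f₀ : VPoly L μ n) : Prop :=
  ∀ S β, HasValueAt q₀ t₀ (coeff β (f S)) (coeff β (f₀ S))

/-! ### Data of the shape -/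

/-- `h_τ = τ_1 + ℓ(τ) - 1`, the maximal hook length of the nonempty diagram `μ`. -/
def maxHook (μ : YoungDiagram) : ℕ := μ.rowLen 0 + μ.colLen 0 - 1

/-- The length of the last column of the nonempty diagram `μ`. -/
def lastColLen (μ : YoungDiagram) : ℕ := μ.colLen (μ.rowLen 0 - 1)

/-- The composition `(1^m, 0^{N-m})`. -/
def onesZeros (n m : ℕ) : Fin (n + 1) → ℕ := fun i => if (i : ℕ) < m then 1 else 0

end VVMac

end

/-! The polynomial $M_{\alpha,S_0}$ is squarefree, and it is found inside an explicit
finite-dimensional module. Cut $\tau$ in front of its last column and consider the fillings that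
decrease down all columns and along the rows of each piece (`CutTableau`). Give a box its content
$t^{c}$, multiplied by $q$ in the last column. Seminormal formulas then define matrices $X_i$
satisfying the Hecke relations and diagonal matrices $J_i$ of contents with $X_iJ_{i+1}X_i=tJ_i$
(`colData`). All denominators are differences of contents of boxes with nearby entries. They are
nonzero once contents on opposite sides of the cut differ (`Generic`), and this remains true at
$q=t^{-h_\tau}$ (`generic_zpow_maxHook`).

A linear map from this module to $\mathcal P_\tau$ carries $X_i$ to $\boldsymbol T_i$ and $J_i$ to
$\boldsymbol\xi_i$ (`opT_imagePoly`, `opXi_imagePoly`). Its coefficient at $x_1\cdots x_m$ is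
`leadMatrix`, which retains the fillings with $1,\dots,m$ in the last column. The other squarefree
coefficients are forced by the Hecke action (`coeffFam`), and compatibility with $\boldsymbol w$ is
`Intertwiner.cyc_eq`. The basis vector $S_0$ is an eigenvector of all $J_i$ with the required
spectral vector, so its image `columnPoly` is a Macdonald polynomial. The construction commutes with
specialization (`specializesTo_imagePoly`), so no pole arises at $(q_0,t_0)$, and the leading
coefficient keeps the value nonzero.

Singularity: at $q=t^{-h_\tau}$ the box on top of the last column has content $t^{-\ell(\tau)}$ and
the bottom box of the first column has $t^{1-\ell(\tau)}$. The factor $tx-y$ of an off-diagonal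
coefficient vanishes for this pair, so the fillings with the smaller entry in the former box span a
submodule, which contains $S_0$ (`vecMul_mat_eq_zero`). In such a filling $N$ cannot lie in the last
column, hence it lies in the corner, where the content is $1$. So $\boldsymbol\xi_N$ is the identity
on the image of the submodule, $\mathcal D_N$ kills it, and stability under the $\boldsymbol T_i$
gives the other $\mathcal D_i$ (`isSingular_imagePoly`).

Since the claim concerns every polynomial with the defining properties, uniqueness is needed as well
(`IsMacdonald.eq_smul`). It rests on the transcendence of $q$ over $\mathbb Q(t)$: on suitable
coefficients $\boldsymbol\xi_j$ is $q$ times a matrix over $\mathbb Q(t)$, which cannot have a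
nonzero eigenvalue in $\mathbb Q(t)$. -/

noncomputable section

namespace VVMac

open MvPolynomial

/-! ### Seminormal representations of the Hecke algebra -/

section Seminormal

variable {K B ι : Type*} [Field K] {n : ℕ}

/-- The filling `R` with the numbers `i` and `i + 1` exchanged. -/
def exch (i : Fin n) (R : B ≃ Fin (n + 1)) : B ≃ Fin (n + 1) :=
  R.trans (Equiv.swap i.castSucc i.succ)

theorem exch_symm_apply (i : Fin n) (R : B ≃ Fin (n + 1)) (k : Fin (n + 1)) :
    (exch i R).symm k = R.symm (Equiv.swap i.castSucc i.succ k) := by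
  simp [exch]

@[simp] theorem exch_symm_castSucc (i : Fin n) (R : B ≃ Fin (n + 1)) :
    (exch i R).symm i.castSucc = R.symm i.succ := by
  rw [exch_symm_apply, Equiv.swap_apply_left]

@[simp] theorem exch_symm_succ (i : Fin n) (R : B ≃ Fin (n + 1)) :
    (exch i R).symm i.succ = R.symm i.castSucc := by
  rw [exch_symm_apply, Equiv.swap_apply_right]

theorem exch_symm_of_ne (i : Fin n) (R : B ≃ Fin (n + 1)) {k : Fin (n + 1)}
    (h1 : k ≠ i.castSucc) (h2 : k ≠ i.succ) : (exch i R).symm k = R.symm k := by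
  rw [exch_symm_apply, Equiv.swap_apply_of_ne_of_ne h1 h2]

@[simp] theorem exch_exch (i : Fin n) (R : B ≃ Fin (n + 1)) : exch i (exch i R) = R := by
  ext; simp [exch]

theorem exch_ne (i : Fin n) (R : B ≃ Fin (n + 1)) : exch i R ≠ R := by
  intro h
  have h1 := exch_symm_castSucc i R
  rw [h] at h1
  exact (Fin.castSucc_lt_succ (i := i)).ne (R.symm.injective h1)

theorem exch_comm {i j : Fin n} (h : (i : ℕ) + 1 < j) (R : B ≃ Fin (n + 1)) :
    exch i (exch j R) = exch j (exch i R) := by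
  apply Equiv.symm_bijective.injective
  ext k : 1
  simp only [exch_symm_apply]
  congr 1
  have : Equiv.Perm.Disjoint (Equiv.swap i.castSucc i.succ) (Equiv.swap j.castSucc j.succ) := by
    intro k
    by_cases hk : k = i.castSucc ∨ k = i.succ
    · right
      apply Equiv.swap_apply_of_ne_of_ne <;> rintro rfl <;>
        simp [Fin.ext_iff] at hk <;> omega
    · left
      rw [not_or] at hk
      exact Equiv.swap_apply_of_ne_of_ne hk.1 hk.2
  exact DFunLike.congr_fun this.commute.symm.eq k

theorem exch_braid {i j : Fin n} (h : (i : ℕ) + 1 = j) (R : B ≃ Fin (n + 1)) :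
    exch i (exch j (exch i R)) = exch j (exch i (exch j R)) := by
  have hj : j.castSucc = i.succ := by ext; simp [h]
  apply Equiv.symm_bijective.injective
  ext k : 1
  simp only [exch_symm_apply]
  congr 1
  have h1 : i.castSucc ≠ i.succ := (Fin.castSucc_lt_succ).ne
  have h2 : i.succ ≠ j.succ := by simp only [ne_eq, Fin.ext_iff, Fin.val_succ]; omega
  have h3 : i.castSucc ≠ j.succ := by
    simp only [ne_eq, Fin.ext_iff, Fin.val_succ, Fin.val_castSucc]; omega
  rw [hj]
  simp only [Equiv.swap_apply_def]
  split_ifs <;> simp_all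

/-- The diagonal coefficient of a seminormal matrix. -/
def diagCoeff (t x y : K) : K := (t - 1) * x / (x - y)

/-- The product of the two opposite off-diagonal coefficients of a seminormal matrix. -/
def offProd (t x y : K) : K := (t * x - y) * (x - t * y) / (x - y) ^ 2

/-- On a filling and its exchange a generator is a 2×2 block. Here its trace is $t-1$, and
`diagCoeff_sq` amounts to determinant $-t$, so the eigenvalues are $t$ and $-1$. -/
theorem diagCoeff_add {t x y : K} (h : x ≠ y) : diagCoeff t x y + diagCoeff t y x = t - 1 := by
  have h1 := sub_ne_zero.2 h
  have h2 := sub_ne_zero.2 h.symm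
  unfold diagCoeff
  rw [← neg_sub x y, div_neg]
  field_simp
  ring

theorem diagCoeff_sq {t x y : K} (h : x ≠ y) :
    diagCoeff t x y ^ 2 + offProd t x y = (t - 1) * diagCoeff t x y + t := by
  have h1 := sub_ne_zero.2 h
  unfold diagCoeff offProd
  field_simp
  ring

theorem diagCoeff_three {t x y z : K} (hxy : x ≠ y) (hxz : x ≠ z) (hyz : y ≠ z) :
    diagCoeff t x y * diagCoeff t y z + diagCoeff t x z * diagCoeff t y x =
      diagCoeff t y z * diagCoeff t x z := by
  have h1 := sub_ne_zero.2 hxy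
  have h2 := sub_ne_zero.2 hxz
  have h3 := sub_ne_zero.2 hyz
  unfold diagCoeff
  rw [← neg_sub x y, div_neg]
  field_simp
  ring

/-- Diagonal entry of $T_iJ_{i+1}T_i=tJ_i$ on the 2×2 block; `diagCoeff_jm'` is the off-diagonal
one. -/
theorem diagCoeff_jm {t x y : K} (h : x ≠ y) :
    diagCoeff t x y ^ 2 * y + offProd t x y * x = t * x := by
  have h1 := sub_ne_zero.2 h
  unfold diagCoeff offProd
  field_simp
  ring

theorem diagCoeff_jm' {t x y : K} (h : x ≠ y) :
    diagCoeff t x y * y + x * diagCoeff t y x = 0 := by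
  have h1 := sub_ne_zero.2 h
  unfold diagCoeff
  rw [← neg_sub x y, div_neg]
  field_simp
  ring

theorem diagCoeff_braid {t x y z : K} (hxy : x ≠ y) (hxz : x ≠ z) (hyz : y ≠ z) :
    diagCoeff t x y ^ 2 * diagCoeff t y z + offProd t x y * diagCoeff t x z =
      diagCoeff t y z ^ 2 * diagCoeff t x y + offProd t y z * diagCoeff t x z := by
  have h1 := diagCoeff_sq (t := t) hxy
  have h2 := diagCoeff_sq (t := t) hyz
  have h3 := diagCoeff_three (t := t) hxy hxz hyz
  have h4 := diagCoeff_add (t := t) hxy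
  linear_combination diagCoeff t x z * h1 - diagCoeff t x z * h2 +
    (diagCoeff t x y - diagCoeff t y z) * h3 - (diagCoeff t x y - diagCoeff t y z) * diagCoeff t x z * h4

/-- Fillings of boxes `B` indexed by `ι`, with contents and exchange coefficients that define
a seminormal representation of the Hecke algebra. -/
structure SeminormalData (K B ι : Type*) [Field K] (n : ℕ) where
  t : K
  fill : ι → (B ≃ Fin (n + 1))
  cont : B → K
  coef : B → B → K
  fill_injective : Function.Injective fill
  -- Distance two is included because the braid relation involves three consecutive entries.
  cont_ne : ∀ a (i j : Fin (n + 1)), i < j → (j : ℕ) ≤ i + 2 →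
    cont ((fill a).symm i) ≠ cont ((fill a).symm j)
  coef_mul : ∀ x y, cont x ≠ cont y → coef x y * coef y x = offProd t (cont x) (cont y)
  -- This is the coefficient with which the value at an admissible filling would enter the value at
  -- an inadmissible exchange.
  coef_zero : ∀ a i, (∀ b, fill b ≠ exch i (fill a)) →
    coef ((fill a).symm i.succ) ((fill a).symm i.castSucc) = 0

namespace SeminormalData

variable (d : SeminormalData K B ι n)

/-- The content of the box of the number `k`. -/
def contAt (R : B ≃ Fin (n + 1)) (k : Fin (n + 1)) : K := d.cont (R.symm k)

/-- The generator number `i` on functions of fillings. -/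
def lop (i : Fin n) (Z : (B ≃ Fin (n + 1)) → K) (R : B ≃ Fin (n + 1)) : K :=
  diagCoeff d.t (d.contAt R i.castSucc) (d.contAt R i.succ) * Z R +
    d.coef (R.symm i.castSucc) (R.symm i.succ) * Z (exch i R)

open Classical in
/-- The matrix of the generator number `i`. -/
def mat (i : Fin n) : Matrix ι ι K := fun a b =>
  if b = a then diagCoeff d.t (d.contAt (d.fill a) i.castSucc) (d.contAt (d.fill a) i.succ)
  else if d.fill b = exch i (d.fill a) then
    d.coef ((d.fill a).symm i.castSucc) ((d.fill a).symm i.succ)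
  else 0

open Classical in
/-- The diagonal matrix of the contents of the number `k`. -/
def jm (k : Fin (n + 1)) : Matrix ι ι K := Matrix.diagonal fun a => d.contAt (d.fill a) k

theorem matrix_ext_mulVec [Fintype ι] {A A' : Matrix ι ι K}
    (h : ∀ Z a, A.mulVec Z a = A'.mulVec Z a) : A = A' := by
  classical
  ext a b
  simpa using h (Pi.single b 1) a

theorem cont_ne_succ (a : ι) (i : Fin n) :
    d.contAt (d.fill a) i.castSucc ≠ d.contAt (d.fill a) i.succ :=
  d.cont_ne a _ _ Fin.castSucc_lt_succ (by simp)

variable [Fintype ι]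

open Classical in
/-- Extension by zero of a function on the index set to all fillings. -/
def ext (Z : ι → K) (R : B ≃ Fin (n + 1)) : K := ∑ a, if d.fill a = R then Z a else 0

@[simp] theorem ext_fill (Z : ι → K) (a : ι) : d.ext Z (d.fill a) = Z a := by
  classical
  unfold ext
  rw [Finset.sum_eq_single a]
  · simp
  · intro b _ hb
    rw [if_neg fun h => hb (d.fill_injective h)]
  · simp

theorem ext_of_forall_ne (Z : ι → K) {R : B ≃ Fin (n + 1)} (h : ∀ a, d.fill a ≠ R) :
    d.ext Z R = 0 := by
  classical
  unfold ext
  exact Finset.sum_eq_zero fun a _ => if_neg (h a)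

theorem mat_mulVec (i : Fin n) (Z : ι → K) (a : ι) :
    (d.mat i).mulVec Z a = d.lop i (d.ext Z) (d.fill a) := by
  classical
  unfold lop
  rw [ext_fill]
  simp only [Matrix.mulVec, dotProduct, mat]
  rw [← Finset.add_sum_erase _ _ (Finset.mem_univ a), if_pos rfl]
  congr 1
  rw [ext, Finset.mul_sum, ← Finset.add_sum_erase Finset.univ _ (Finset.mem_univ a)]
  rw [if_neg (exch_ne i (d.fill a)).symm, mul_zero, zero_add]
  refine Finset.sum_congr rfl fun b hb => ?_
  rw [if_neg (Finset.ne_of_mem_erase hb)]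
  split_ifs <;> simp

/-- By `coef_zero` nothing leaks out of the index set. Products of generators can therefore be
evaluated as compositions of `lop` at one filling, without asking which exchanges are admissible. -/
theorem ext_mulVec (i : Fin n) (Z : ι → K) :
    d.ext ((d.mat i).mulVec Z) = d.lop i (d.ext Z) := by
  funext R
  by_cases h : ∃ a, d.fill a = R
  · obtain ⟨a, rfl⟩ := h
    rw [ext_fill, mat_mulVec]
  · push Not at h
    rw [ext_of_forall_ne _ _ h]
    unfold lop
    rw [ext_of_forall_ne _ _ h, mul_zero, zero_add]
    by_cases h' : ∃ a, d.fill a = exch i R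
    · obtain ⟨a, ha⟩ := h'
      have hR : R = exch i (d.fill a) := by rw [ha, exch_exch]
      have := d.coef_zero a i fun b hb => h b (hb.trans hR.symm)
      rw [hR, exch_symm_castSucc, exch_symm_succ, this, zero_mul]
    · push Not at h'
      rw [ext_of_forall_ne _ _ h', mul_zero]

theorem jm_mulVec (k : Fin (n + 1)) (Z : ι → K) (a : ι) :
    (d.jm k).mulVec Z a = d.contAt (d.fill a) k * Z a := by
  classical
  simp [jm, Matrix.mulVec_diagonal]

theorem ext_jm (k : Fin (n + 1)) (Z : ι → K) (R : B ≃ Fin (n + 1)) :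
    d.ext ((d.jm k).mulVec Z) R = d.contAt R k * d.ext Z R := by
  by_cases h : ∃ a, d.fill a = R
  · obtain ⟨a, rfl⟩ := h
    rw [ext_fill, ext_fill, jm_mulVec]
  · push Not at h
    rw [ext_of_forall_ne _ _ h, ext_of_forall_ne _ _ h, mul_zero]

theorem mat_mul_self [DecidableEq ι] (i : Fin n) :
    d.mat i * d.mat i = (d.t - 1) • d.mat i + d.t • 1 := by
  apply matrix_ext_mulVec
  intro Z a
  rw [← Matrix.mulVec_mulVec, Matrix.add_mulVec, Matrix.smul_mulVec, Matrix.smul_mulVec,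
    Matrix.one_mulVec]
  simp only [Pi.add_apply, Pi.smul_apply, smul_eq_mul, mat_mulVec, ext_mulVec]
  have hne := d.cont_ne_succ a i
  have h2 := d.coef_mul _ _ hne
  have h3 := diagCoeff_sq (t := d.t) hne
  have h4 := diagCoeff_add (t := d.t) hne
  rw [← d.ext_fill Z a]
  simp only [lop, contAt, exch_symm_castSucc, exch_symm_succ, exch_exch] at *
  linear_combination d.ext Z (d.fill a) * h2 + d.ext Z (d.fill a) * h3 +
    d.coef ((d.fill a).symm i.castSucc) ((d.fill a).symm i.succ) *
      d.ext Z (exch i (d.fill a)) * h4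

theorem mat_jm_mat (i : Fin n) :
    d.mat i * d.jm i.succ * d.mat i = d.t • d.jm i.castSucc := by
  apply matrix_ext_mulVec
  intro Z a
  rw [← Matrix.mulVec_mulVec, ← Matrix.mulVec_mulVec, Matrix.smul_mulVec]
  simp only [Pi.smul_apply, smul_eq_mul, jm_mulVec]
  rw [mat_mulVec]
  simp only [lop, ext_jm, ext_mulVec]
  have hne := d.cont_ne_succ a i
  have h2 := d.coef_mul _ _ hne
  have h3 := diagCoeff_jm (t := d.t) hne
  have h4 := diagCoeff_jm' (t := d.t) hne
  rw [← d.ext_fill Z a]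
  simp only [contAt, exch_symm_castSucc, exch_symm_succ, exch_exch] at *
  linear_combination d.cont ((d.fill a).symm i.castSucc) * d.ext Z (d.fill a) * h2 +
    d.ext Z (d.fill a) * h3 +
    d.coef ((d.fill a).symm i.castSucc) ((d.fill a).symm i.succ) *
      d.ext Z (exch i (d.fill a)) * h4

theorem mat_comm {i j : Fin n} (h : (i : ℕ) + 1 < j) : d.mat i * d.mat j = d.mat j * d.mat i := by
  apply matrix_ext_mulVec
  intro Z a
  rw [← Matrix.mulVec_mulVec, ← Matrix.mulVec_mulVec]
  simp only [mat_mulVec, ext_mulVec]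
  have e1 : (i.castSucc : Fin (n + 1)) ≠ j.castSucc := by simp [Fin.ext_iff]; omega
  have e2 : (i.castSucc : Fin (n + 1)) ≠ j.succ := by simp [Fin.ext_iff]; omega
  have e3 : i.succ ≠ j.castSucc := by simp [Fin.ext_iff]; omega
  have e4 : i.succ ≠ j.succ := by simp [Fin.ext_iff]; omega
  simp only [lop, contAt, exch_symm_of_ne _ _ e1 e2, exch_symm_of_ne _ _ e3 e4,
    exch_symm_of_ne _ _ e1.symm e3.symm, exch_symm_of_ne _ _ e2.symm e4.symm, exch_comm h]
  ring

theorem mat_jm_comm {i : Fin n} {k : Fin (n + 1)} (h1 : k ≠ i.castSucc) (h2 : k ≠ i.succ) :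
    d.mat i * d.jm k = d.jm k * d.mat i := by
  apply matrix_ext_mulVec
  intro Z a
  rw [← Matrix.mulVec_mulVec, ← Matrix.mulVec_mulVec, jm_mulVec]
  simp only [mat_mulVec, lop, ext_jm, contAt, exch_symm_of_ne _ _ h1 h2]
  ring

theorem mat_braid {i j : Fin n} (h : (i : ℕ) + 1 = j) :
    d.mat i * d.mat j * d.mat i = d.mat j * d.mat i * d.mat j := by
  apply matrix_ext_mulVec
  intro Z a
  simp only [← Matrix.mulVec_mulVec]
  simp only [mat_mulVec, ext_mulVec]
  have hj : j.castSucc = i.succ := by ext; simp [h]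
  have e1 : i.castSucc ≠ j.succ := by simp [Fin.ext_iff]; omega
  have e2 : i.succ ≠ j.succ := by simp [Fin.ext_iff]; omega
  have e3 : i.castSucc ≠ i.succ := (Fin.castSucc_lt_succ).ne
  have f1 (R : B ≃ Fin (n + 1)) : (exch i R).symm j.succ = R.symm j.succ :=
    exch_symm_of_ne _ _ e1.symm e2.symm
  have f2 (R : B ≃ Fin (n + 1)) : (exch j R).symm i.castSucc = R.symm i.castSucc :=
    exch_symm_of_ne _ _ (hj ▸ e3) e1
  have f3 (R : B ≃ Fin (n + 1)) : (exch j R).symm i.succ = R.symm j.succ := by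
    rw [← hj, exch_symm_castSucc]
  have f4 (R : B ≃ Fin (n + 1)) : (exch j R).symm j.succ = R.symm i.succ := by
    rw [exch_symm_succ, hj]
  have n1 := d.cont_ne_succ a i
  have n2 : d.contAt (d.fill a) i.succ ≠ d.contAt (d.fill a) j.succ := hj ▸ d.cont_ne_succ a j
  have n3 : d.contAt (d.fill a) i.castSucc ≠ d.contAt (d.fill a) j.succ :=
    d.cont_ne a _ _ (by rw [Fin.lt_def]; simp; omega) (by simp; omega)
  have p1 := d.coef_mul _ _ n1
  have p2 := d.coef_mul _ _ n2
  have i1 := diagCoeff_three (t := d.t) n1 n3 n2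
  have i2 := diagCoeff_braid (t := d.t) n1 n3 n2
  have i3 : diagCoeff d.t (d.contAt (d.fill a) i.castSucc) (d.contAt (d.fill a) i.succ) *
      diagCoeff d.t (d.contAt (d.fill a) i.castSucc) (d.contAt (d.fill a) j.succ) =
      diagCoeff d.t (d.contAt (d.fill a) i.succ) (d.contAt (d.fill a) j.succ) *
        diagCoeff d.t (d.contAt (d.fill a) i.castSucc) (d.contAt (d.fill a) i.succ) +
      diagCoeff d.t (d.contAt (d.fill a) i.castSucc) (d.contAt (d.fill a) j.succ) *
        diagCoeff d.t (d.contAt (d.fill a) j.succ) (d.contAt (d.fill a) i.succ) := by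
    have a1 := diagCoeff_add (t := d.t) n1
    have a2 := diagCoeff_add (t := d.t) n2
    linear_combination -i1 + diagCoeff d.t (d.contAt (d.fill a) i.castSucc)
      (d.contAt (d.fill a) j.succ) * (a1 - a2)
  simp only [lop, contAt, hj, exch_symm_castSucc, exch_symm_succ, exch_exch, f1, f2, f3, f4,
    exch_braid h] at *
  set x := (d.fill a).symm i.castSucc
  set y := (d.fill a).symm i.succ
  set z := (d.fill a).symm j.succ
  set Z0 := d.ext Z (d.fill a)
  set Z1 := d.ext Z (exch i (d.fill a))
  set Z2 := d.ext Z (exch j (d.fill a))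
  -- Compare the coefficients of `Z` at the six permutations of three entries. Only the filling
  -- itself and its two simple exchanges need an identity; the other three agree by commutativity.
  linear_combination diagCoeff d.t (d.cont x) (d.cont z) * Z0 * p1 -
    diagCoeff d.t (d.cont x) (d.cont z) * Z0 * p2 + Z0 * i2 + d.coef x y * Z1 * i1 +
    d.coef y z * Z2 * i3

end SeminormalData

end Seminormal

/-! ### Cut tableaux -/

theorem zpow_inj_of_forall_ne {K : Type*} [Field K] {t : K} (ht0 : t ≠ 0)
    (ht : ∀ k : ℕ, 0 < k → t ^ k ≠ 1) {a b : ℤ} (h : t ^ a = t ^ b) : a = b := by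
  have key : ∀ {a b : ℤ}, a < b → t ^ a ≠ t ^ b := by
    intro a b hab h
    have h1 : t ^ (b - a) = 1 := by
      rw [zpow_sub₀ ht0, h, div_self (zpow_ne_zero _ ht0)]
    obtain ⟨k, hk⟩ := Int.eq_ofNat_of_zero_le (sub_nonneg.2 hab.le)
    rw [hk, zpow_natCast] at h1
    exact ht k (by omega) h1
  rcases lt_trichotomy a b with hab | hab | hab
  · exact absurd h (key hab)
  · exact hab
  · exact absurd h.symm (key hab)

/-- The boxes of `μ`. -/
abbrev Cell (μ : YoungDiagram) : Type := {c : ℕ × ℕ // c ∈ μ.cells}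

/-- The content of a box. -/
def Cell.content {μ : YoungDiagram} (c : Cell μ) : ℤ := (c.1.2 : ℤ) - (c.1.1 : ℤ)

section Cut

variable {μ : YoungDiagram} {n : ℕ} {K : Type*} [Field K]

/-- `R` decreases down every column, and along every row of each of the two parts into which
`μ` is cut in front of the column number `D`. -/
def IsCut (D : ℕ) (R : Cell μ ≃ Fin (n + 1)) : Prop :=
  (∀ c c' : Cell μ, c.1.1 = c'.1.1 → c.1.2 < c'.1.2 → (D ≤ c.1.2 ↔ D ≤ c'.1.2) → R c' < R c) ∧
    ∀ c c' : Cell μ, c.1.2 = c'.1.2 → c.1.1 < c'.1.1 → R c' < R c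

theorem Cell.mem_of_le (x : Cell μ) {r c : ℕ} (hr : r ≤ x.1.1) (hc : c ≤ x.1.2) :
    (r, c) ∈ μ.cells :=
  μ.up_left_mem hr hc x.2

/-- The two remaining corners of the rectangle spanned by `x` and `y` carry distinct entries
strictly between those of `x` and `y`. -/
theorem IsCut.add_three_le {D : ℕ} {R : Cell μ ≃ Fin (n + 1)} (hR : IsCut D R) {x y : Cell μ}
    (h1 : x.1.1 < y.1.1) (h2 : x.1.2 < y.1.2) (h : D ≤ x.1.2 ↔ D ≤ y.1.2) :
    (R y : ℕ) + 3 ≤ R x := by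
  let u : Cell μ := ⟨(x.1.1, y.1.2), y.mem_of_le h1.le le_rfl⟩
  let v : Cell μ := ⟨(y.1.1, x.1.2), y.mem_of_le le_rfl h2.le⟩
  have a1 : R u < R x := hR.1 x u rfl h2 h
  have a2 : R y < R u := hR.2 u y rfl h1
  have a3 : R v < R x := hR.2 x v rfl h1
  have a4 : R y < R v := hR.1 v y rfl h2 h
  have a5 : R u ≠ R v := fun e => by
    have := congrArg (fun c : Cell μ => c.1.1) (R.injective e)
    exact h1.ne this
  rw [ne_eq, Fin.ext_iff] at a5
  rw [Fin.lt_def] at a1 a2 a3 a4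
  omega

theorem IsCut.row_eq {D : ℕ} {R : Cell μ ≃ Fin (n + 1)} (hR : IsCut D R) {x y : Cell μ}
    (h : D ≤ x.1.2 ↔ D ≤ y.1.2) (hrow : x.1.1 = y.1.1) (hxy : (R x : ℕ) + 1 = R y) :
    x.1.2 = y.1.2 + 1 := by
  rcases lt_trichotomy x.1.2 y.1.2 with hc | hc | hc
  · have := hR.1 x y hrow hc h
    rw [Fin.lt_def] at this
    omega
  · have : x = y := Subtype.ext (Prod.ext hrow hc)
    subst this
    omega
  · by_contra hne
    let u : Cell μ := ⟨(x.1.1, y.1.2 + 1), x.mem_of_le le_rfl hc⟩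
    have a1 : R u < R y := hR.1 y u hrow.symm (Nat.lt_succ_self _) (by
      change _ ↔ D ≤ y.1.2 + 1; omega)
    have a2 : R x < R u := hR.1 u x rfl (by change y.1.2 + 1 < _; omega) (by
      change D ≤ y.1.2 + 1 ↔ _; omega)
    rw [Fin.lt_def] at a1 a2
    omega

theorem IsCut.col_eq {D : ℕ} {R : Cell μ ≃ Fin (n + 1)} (hR : IsCut D R) {x y : Cell μ}
    (hcol : x.1.2 = y.1.2) (hxy : (R x : ℕ) + 1 = R y) : x.1.1 = y.1.1 + 1 := by
  rcases lt_trichotomy x.1.1 y.1.1 with hc | hc | hc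
  · have := hR.2 x y hcol hc
    rw [Fin.lt_def] at this
    omega
  · have : x = y := Subtype.ext (Prod.ext hc hcol)
    subst this
    omega
  · by_contra hne
    let u : Cell μ := ⟨(y.1.1 + 1, x.1.2), x.mem_of_le hc le_rfl⟩
    have a1 : R u < R y := hR.2 y u hcol.symm (Nat.lt_succ_self _)
    have a2 : R x < R u := hR.2 u x rfl (by change y.1.1 + 1 < _; omega)
    rw [Fin.lt_def] at a1 a2
    omega

theorem IsCut.two_le_abs {D : ℕ} {R : Cell μ ≃ Fin (n + 1)} (hR : IsCut D R) {x y : Cell μ}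
    (h : D ≤ x.1.2 ↔ D ≤ y.1.2) (hrow : x.1.1 ≠ y.1.1) (hcol : x.1.2 ≠ y.1.2)
    (hxy : (R x : ℕ) + 1 = R y) :
    2 ≤ x.content - y.content ∨ x.content - y.content ≤ -2 := by
  unfold Cell.content
  rcases hrow.lt_or_gt with h1 | h1 <;> rcases hcol.lt_or_gt with h2 | h2
  · have := hR.add_three_le h1 h2 h; omega
  · omega
  · omega
  · have := hR.add_three_le h1 h2 h.symm; omega

/-- Boxes of equal content lie on one diagonal, so on one side of the cut their entries differ by at
least three. -/
theorem IsCut.content_ne {D : ℕ} {R : Cell μ ≃ Fin (n + 1)} (hR : IsCut D R) {x y : Cell μ}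
    (h : D ≤ x.1.2 ↔ D ≤ y.1.2) (h1 : R x < R y) (h2 : (R y : ℕ) ≤ R x + 2) :
    x.content ≠ y.content := by
  unfold Cell.content
  intro he
  rw [Fin.lt_def] at h1
  rcases lt_trichotomy x.1.1 y.1.1 with hr | hr | hr
  · have := hR.add_three_le hr (by omega) h; omega
  · have : x = y := Subtype.ext (Prod.ext hr (by omega))
    subst this
    omega
  · have := hR.add_three_le hr (by omega) h.symm; omega

/-- The contents, with those behind the cut multiplied by `q`. -/
def cutCont (q t : K) (D : ℕ) (x : Cell μ) : K := (if D ≤ x.1.2 then q else 1) * t ^ x.content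

/-- The exchange coefficients for fillings of a diagram with a cut. -/
def cutCoef (q t : K) (D : ℕ) (x y : Cell μ) : K :=
  if D ≤ x.1.2 ↔ D ≤ y.1.2 then
    if 2 ≤ x.content - y.content then 1
    else if x.content - y.content ≤ -2 then offProd t (cutCont q t D x) (cutCont q t D y)
    else 0
  -- In a matrix entry `x` holds the smaller of the two entries. Putting the whole product on this
  -- direction makes the exchange out of `CornersIncreasing` vanish at $q=t^{-h_\tau}$.
  else if D ≤ x.1.2 then offProd t (cutCont q t D x) (cutCont q t D y)
  else 1

theorem offProd_comm (t x y : K) : offProd t x y = offProd t y x := by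
  unfold offProd
  rw [← neg_sub y x, neg_sq]
  congr 1
  ring

/-- `q` and `t` are such that contents on the two sides of the cut are distinct. -/
structure Generic (μ : YoungDiagram) (D : ℕ) (q t : K) : Prop where
  q_ne : q ≠ 0
  t_ne : t ≠ 0
  t_pow : ∀ k : ℕ, 0 < k → t ^ k ≠ 1
  sep : ∀ x y : Cell μ, D ≤ x.1.2 → y.1.2 < D → q * t ^ x.content ≠ t ^ y.content

theorem Generic.cutCont_ne {D : ℕ} {q t : K} (hg : Generic μ D q t) {x y : Cell μ}
    (h : x.content ≠ y.content ∨ ¬(D ≤ x.1.2 ↔ D ≤ y.1.2)) :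
    cutCont q t D x ≠ cutCont q t D y := by
  unfold cutCont
  by_cases hx : D ≤ x.1.2 <;> by_cases hy : D ≤ y.1.2
  · simp only [hx, hy, if_true, not_true, or_false] at h ⊢
    exact fun e => h (zpow_inj_of_forall_ne hg.t_ne hg.t_pow (mul_left_cancel₀ hg.q_ne e))
  · simp only [hx, hy, if_true, if_false, one_mul]
    exact hg.sep x y hx (not_le.1 hy)
  · simp only [hx, hy, if_true, if_false, one_mul]
    exact (hg.sep y x hy (not_le.1 hx)).symm
  · simp only [hx, hy, if_false, not_true, or_false, one_mul] at h ⊢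
    exact fun e => h (zpow_inj_of_forall_ne hg.t_ne hg.t_pow e)

theorem cutCont_eq_mul {q t : K} (ht : t ≠ 0) {D : ℕ} {x y : Cell μ}
    (h : D ≤ x.1.2 ↔ D ≤ y.1.2) :
    cutCont q t D x = t ^ (x.content - y.content) * cutCont q t D y := by
  unfold cutCont
  rw [zpow_sub₀ ht]
  simp only [h]
  field_simp

/-- The zero coefficients at content difference ±1 are consistent because `offProd` contains the
factors $tx-y$ and $x-ty$. -/
theorem cutCoef_mul {D : ℕ} {q t : K} (hg : Generic μ D q t) (x y : Cell μ)
    (h : cutCont q t D x ≠ cutCont q t D y) :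
    cutCoef q t D x y * cutCoef q t D y x = offProd t (cutCont q t D x) (cutCont q t D y) := by
  unfold cutCoef
  by_cases hs : D ≤ x.1.2 ↔ D ≤ y.1.2
  · rw [if_pos hs, if_pos hs.symm]
    have e := cutCont_eq_mul (q := q) hg.t_ne hs
    have e' := cutCont_eq_mul (q := q) hg.t_ne hs.symm
    rcases lt_trichotomy (x.content - y.content) 0 with hb | hb | hb
    · by_cases hb2 : x.content - y.content ≤ -2
      · rw [if_neg (by omega), if_pos hb2, if_pos (by omega), mul_one]
      · rw [if_neg (by omega), if_neg (by omega), zero_mul]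
        have : y.content - x.content = 1 := by omega
        rw [this, zpow_one] at e'
        rw [offProd, e']
        simp
    · rw [hb, zpow_zero, one_mul] at e
      exact absurd e h
    · by_cases hb2 : 2 ≤ x.content - y.content
      · rw [if_pos hb2, if_neg (by omega), if_pos (by omega), one_mul, offProd_comm]
      · rw [if_neg (by omega), if_neg (by omega), zero_mul]
        have : x.content - y.content = 1 := by omega
        rw [this, zpow_one] at e
        rw [offProd, e]
        simp
  · have hs' : ¬(D ≤ y.1.2 ↔ D ≤ x.1.2) := fun h => hs h.symm
    rw [if_neg hs, if_neg hs']
    by_cases hx : D ≤ x.1.2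
    · rw [if_pos hx, if_neg fun hy => hs ⟨fun _ => hy, fun _ => hx⟩, mul_one]
    · have hy : D ≤ y.1.2 := by tauto
      rw [if_neg hx, if_pos hy, one_mul, offProd_comm]

/-- Exchanging consecutive entries violates the conditions only for boxes in one row or column on
one side of the cut. These are neighbours, so their contents differ by ±1. -/
theorem IsCut.cutCoef_eq_zero {D : ℕ} {q t : K} {R : Cell μ ≃ Fin (n + 1)} (hR : IsCut D R)
    {i : Fin n} (h : ¬IsCut D (exch i R)) :
    cutCoef q t D (R.symm i.succ) (R.symm i.castSucc) = 0 := by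
  have key : ∀ c c' : Cell μ, R c' < R c → ¬exch i R c' < exch i R c →
      c = R.symm i.succ ∧ c' = R.symm i.castSucc := by
    intro c c' h1 h2
    rw [Equiv.eq_symm_apply, Equiv.eq_symm_apply]
    simp only [exch, Equiv.trans_apply, Equiv.swap_apply_def] at h2
    rw [Fin.lt_def] at h1
    split_ifs at h2 <;> simp_all [Fin.ext_iff, Fin.lt_def] <;> omega
  have hxy : ((R (R.symm i.castSucc) : Fin (n + 1)) : ℕ) + 1 = R (R.symm i.succ) := by simp
  rw [IsCut, not_and_or] at h
  rcases h with h | h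
  · push Not at h
    obtain ⟨c, c', h1, h2, h3, h4⟩ := h
    obtain ⟨rfl, rfl⟩ := key c c' (hR.1 c c' h1 h2 h3) (not_lt.2 h4)
    have h5 := hR.row_eq h3.symm h1.symm hxy
    unfold cutCoef Cell.content
    rw [if_pos h3, if_neg (by omega), if_neg (by omega)]
  · push Not at h
    obtain ⟨c, c', h1, h2, h4⟩ := h
    obtain ⟨rfl, rfl⟩ := key c c' (hR.2 c c' h1 h2) (not_lt.2 h4)
    have h5 := hR.col_eq h1.symm hxy
    unfold cutCoef Cell.content
    rw [if_pos (by rw [h1]), if_neg (by omega), if_neg (by omega)]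

/-- The seminormal representation on the fillings of a diagram with a cut. -/
def cutData {ι : Type*} {D : ℕ} {q t : K} (hg : Generic μ D q t)
    (fill : ι → (Cell μ ≃ Fin (n + 1))) (hinj : Function.Injective fill)
    (hfill : ∀ R, (∃ a, fill a = R) ↔ IsCut D R) :
    SeminormalData K (Cell μ) ι n where
  t := t
  fill := fill
  cont := cutCont q t D
  coef := cutCoef q t D
  fill_injective := hinj
  cont_ne a i j hij hj := by
    have hR := (hfill _).1 ⟨a, rfl⟩
    apply hg.cutCont_ne
    by_cases hs : D ≤ ((fill a).symm i).1.2 ↔ D ≤ ((fill a).symm j).1.2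
    · exact Or.inl (hR.content_ne hs (by simpa using hij) (by simpa using hj))
    · exact Or.inr hs
  coef_mul x y h := cutCoef_mul hg x y h
  coef_zero a i h := by
    have hR := (hfill _).1 ⟨a, rfl⟩
    apply hR.cutCoef_eq_zero
    rw [← hfill]
    exact fun ⟨b, hb⟩ => h b hb

/-- Fillings of `μ` cut in front of the last column. -/
def CutTableau (μ : YoungDiagram) (n : ℕ) : Type :=
  {R : Cell μ ≃ Fin (n + 1) // IsCut (μ.rowLen 0 - 1) R}

instance : Finite (CutTableau μ n) := Subtype.finite

instance : Fintype (CutTableau μ n) := Fintype.ofFinite _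

instance : DecidableEq (CutTableau μ n) := Classical.decEq _

theorem Cell.col_lt (x : Cell μ) : x.1.2 < μ.rowLen 0 := by
  have : (0, x.1.2) ∈ μ := x.mem_of_le (Nat.zero_le _) le_rfl
  exact YoungDiagram.mem_iff_lt_rowLen.1 this

theorem Cell.row_lt (x : Cell μ) : x.1.1 < μ.colLen 0 := by
  have : (x.1.1, 0) ∈ μ := x.mem_of_le le_rfl (Nat.zero_le _)
  exact YoungDiagram.mem_iff_lt_colLen.1 this

theorem exists_rsyt_iff (R : Cell μ ≃ Fin (n + 1)) :
    (∃ S : RSYT μ n, S.entry = R) ↔ IsCut (μ.rowLen 0) R := by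
  constructor
  · rintro ⟨S, rfl⟩
    exact ⟨fun c c' h1 h2 _ => S.row_decr c c' h1 h2, S.col_decr⟩
  · intro h
    refine ⟨⟨R, fun c c' h1 h2 => h.1 c c' h1 h2 ?_, h.2⟩, rfl⟩
    simp only [not_le.2 (Cell.col_lt _)]

/-- A cut at `μ.rowLen 0` lies behind the whole diagram and separates nothing. Thus $\tau$ itself is
a case of the same construction, with $q=1$. -/
theorem generic_whole {t : K} (ht0 : t ≠ 0) (ht : ∀ k : ℕ, 0 < k → t ^ k ≠ 1) :
    Generic μ (μ.rowLen 0) (1 : K) t :=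
  ⟨one_ne_zero, ht0, ht, fun x _ hx _ => absurd x.col_lt (not_lt.2 hx)⟩

/-- The seminormal representation on the tableaux of shape `μ`. -/
def tauData {t : K} (ht0 : t ≠ 0) (ht : ∀ k : ℕ, 0 < k → t ^ k ≠ 1) :
    SeminormalData K (Cell μ) (RSYT μ n) n :=
  cutData (generic_whole ht0 ht) RSYT.entry (fun _ _ h => RSYT.ext h) exists_rsyt_iff

/-- The seminormal representation on the fillings of `μ` cut in front of the last column. -/
def colData {q t : K} (hg : Generic μ (μ.rowLen 0 - 1) q t) :
    SeminormalData K (Cell μ) (CutTableau μ n) n :=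
  cutData hg Subtype.val Subtype.val_injective fun R =>
    ⟨fun ⟨a, ha⟩ => ha ▸ a.2, fun h => ⟨⟨R, h⟩, rfl⟩⟩

theorem cutCont_whole (t : K) (x : Cell μ) : cutCont 1 t (μ.rowLen 0) x = t ^ x.content := by
  simp [cutCont]

theorem isExchange_iff (i : Fin n) (S S' : RSYT μ n) :
    S.IsExchange i S' ↔ S'.entry = exch i S.entry := by
  rw [Equiv.ext_iff]
  rfl

theorem diagCoeff_zpow {t : K} (ht0 : t ≠ 0) (a b : ℤ) :
    diagCoeff t (t ^ a) (t ^ b) = t ^ (a - b) * (t - 1) / (t ^ (a - b) - 1) := by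
  have h : t ^ a = t ^ (a - b) * t ^ b := by rw [← zpow_add₀ ht0, sub_add_cancel]
  have hb := zpow_ne_zero b ht0
  rw [diagCoeff, h, ← sub_one_mul, ← mul_assoc, mul_div_mul_right _ _ hb, mul_comm]

theorem offProd_zpow {t : K} (ht0 : t ≠ 0) (a b : ℤ) :
    offProd t (t ^ a) (t ^ b) =
      t * (t ^ (a - b + 1) - 1) * (t ^ (a - b - 1) - 1) / (t ^ (a - b) - 1) ^ 2 := by
  have h : t ^ a = t ^ (a - b) * t ^ b := by rw [← zpow_add₀ ht0, sub_add_cancel]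
  have hb := zpow_ne_zero b ht0
  rw [zpow_add₀ ht0, zpow_sub_one₀ ht0, zpow_one, offProd, h, ← sub_one_mul, mul_pow,
    ← mul_div_mul_right (t * _ * _) _ (pow_ne_zero 2 hb)]
  congr 1
  field_simp

-- Through this $\tau$ inherits the Hecke relations. Equal row and equal column are the cases $b=1$
-- and $b=-1$, where the diagonal formula gives $t$ and $-1$ and the exchange coefficient is zero.
open Classical in
theorem heckeMatrix_eq {t : K} (ht0 : t ≠ 0) (ht : ∀ k : ℕ, 0 < k → t ^ k ≠ 1) (i : Fin n) :
    (heckeMatrix t i : Matrix (RSYT μ n) (RSYT μ n) K) = (tauData ht0 ht).mat i := by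
  ext S S'
  have ht1 : t - 1 ≠ 0 := sub_ne_zero.2 (by simpa using ht 1 one_pos)
  have hcut := (exists_rsyt_iff S.entry).1 ⟨S, rfl⟩
  have hxy : ((S.entry (S.entry.symm i.castSucc) : Fin (n + 1)) : ℕ) + 1 =
    S.entry (S.entry.symm i.succ) := by simp
  have hside : μ.rowLen 0 ≤ (S.entry.symm i.castSucc).1.2 ↔
      μ.rowLen 0 ≤ (S.entry.symm i.succ).1.2 := by
    simp only [not_le.2 (Cell.col_lt _)]
  have hdiag : diagCoeff t (cutCont 1 t (μ.rowLen 0) (S.entry.symm i.castSucc))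
      (cutCont 1 t (μ.rowLen 0) (S.entry.symm i.succ)) =
      t ^ (S.content i.castSucc - S.content i.succ) * (t - 1) /
        (t ^ (S.content i.castSucc - S.content i.succ) - 1) := by
    rw [cutCont_whole, cutCont_whole, diagCoeff_zpow ht0]
    rfl
  have hcoef : cutCoef 1 t (μ.rowLen 0) (S.entry.symm i.castSucc) (S.entry.symm i.succ) =
      if 2 ≤ S.content i.castSucc - S.content i.succ then 1
      else if S.content i.castSucc - S.content i.succ ≤ -2 then
        t * (t ^ (S.content i.castSucc - S.content i.succ + 1) - 1) *
          (t ^ (S.content i.castSucc - S.content i.succ - 1) - 1) /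
          (t ^ (S.content i.castSucc - S.content i.succ) - 1) ^ 2
      else 0 := by
    rw [cutCoef, if_pos hside, cutCont_whole, cutCont_whole, offProd_zpow ht0]
    rfl
  have hmat : (tauData ht0 ht).mat i S S' =
      if S' = S then diagCoeff t (cutCont 1 t (μ.rowLen 0) (S.entry.symm i.castSucc))
        (cutCont 1 t (μ.rowLen 0) (S.entry.symm i.succ))
      else if S.IsExchange i S' then
        cutCoef 1 t (μ.rowLen 0) (S.entry.symm i.castSucc) (S.entry.symm i.succ)
      else 0 := by
    simp only [isExchange_iff, SeminormalData.mat]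
    congr
  rw [hmat, hdiag, hcoef]
  simp only [heckeMatrix]
  by_cases hr : S.row i.castSucc = S.row i.succ
  · have h1 := hcut.row_eq hside hr hxy
    have hb : S.content i.castSucc - S.content i.succ = 1 := by
      unfold RSYT.content RSYT.row RSYT.col at *
      omega
    rw [if_pos hr, hb, if_neg (show ¬(2 : ℤ) ≤ 1 by decide),
      if_neg (show ¬(1 : ℤ) ≤ -2 by decide), ite_self, zpow_one,
      mul_div_cancel_right₀ _ ht1]
  · rw [if_neg hr]
    by_cases hc : S.col i.castSucc = S.col i.succ
    · have h1 := hcut.col_eq hc hxy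
      have hb : S.content i.castSucc - S.content i.succ = -1 := by
        unfold RSYT.content RSYT.row RSYT.col at *
        omega
      rw [if_pos hc, hb, if_neg (show ¬(2 : ℤ) ≤ -1 by decide),
        if_neg (show ¬(-1 : ℤ) ≤ -2 by decide), ite_self]
      congr 1
      have h2 : t ^ (-1 : ℤ) - 1 ≠ 0 := by
        rw [zpow_neg_one, sub_ne_zero]
        intro h
        exact ht1 (sub_eq_zero.2 (inv_eq_one.1 h))
      rw [eq_div_iff h2, zpow_neg_one]
      field_simp
      ring
    · rw [if_neg hc]
      have h1 := hcut.two_le_abs hside hr hc hxy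
      have hb : 2 ≤ S.content i.castSucc - S.content i.succ ∨
        S.content i.castSucc - S.content i.succ ≤ -2 := h1
      by_cases hb2 : 2 ≤ S.content i.castSucc - S.content i.succ
      · rw [if_pos hb2, if_pos hb2]
        congr 1
        rw [zpow_neg]
        have h3 := zpow_ne_zero (S.content i.castSucc - S.content i.succ) ht0
        have h4 : t ^ (S.content i.castSucc - S.content i.succ) - 1 ≠ 0 := by
          rw [sub_ne_zero]
          intro h
          have := zpow_inj_of_forall_ne ht0 ht (h.trans (zpow_zero t).symm)
          omega
        rw [← mul_div_mul_left _ (1 - _) h3, mul_one_sub (t ^ _),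
          mul_inv_cancel₀ h3]
      · rw [if_neg hb2, if_neg hb2, if_pos (hb.resolve_left hb2)]

end Cut

/-! ### Patterns: subsets of the set of indices, as Boolean functions -/

section Pattern

variable {n : ℕ}

theorem mem_iff_lt_card_of_lower {N : ℕ} (s : Finset (Fin N))
    (hs : ∀ a b, a < b → b ∈ s → a ∈ s) (j : Fin N) : j ∈ s ↔ (j : ℕ) < s.card := by
  constructor
  · intro hj
    have h : Finset.Iic j ⊆ s := fun a ha => by
      rcases (Finset.mem_Iic.1 ha).lt_or_eq with h | rfl
      · exact hs a j h hj
      · exact hj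
    have := Finset.card_le_card h
    rw [Fin.card_Iic] at this
    omega
  · intro hj
    by_contra hn
    have h : s ⊆ Finset.Iio j := fun a ha => by
      rw [Finset.mem_Iio]
      by_contra hle
      rcases (not_lt.1 hle).lt_or_eq with h | rfl
      · exact hn (hs j a h ha)
      · exact hn ha
    have := Finset.card_le_card h
    rw [Fin.card_Iio] at this
    omega

/-- Subsets of the set of indices of the variables. -/
abbrev Pattern (n : ℕ) : Type := Fin (n + 1) → Bool

namespace Pattern

/-- The pattern with the entries number `i` and `i + 1` exchanged. -/
def swap (i : Fin n) (E : Pattern n) : Pattern n := fun j => E (Equiv.swap i.castSucc i.succ j)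

/-- The pattern has `0, 1` at the places `i, i + 1`. -/
def Ascent (i : Fin n) (E : Pattern n) : Prop := E i.castSucc = false ∧ E i.succ = true

instance (i : Fin n) (E : Pattern n) : Decidable (E.Ascent i) :=
  inferInstanceAs (Decidable (_ ∧ _))

/-- The number of elements. -/
def weight (E : Pattern n) : ℕ := (Finset.univ.filter fun j => E j = true).card

/-- The sum of the elements. -/
def pos (E : Pattern n) : ℕ := ∑ j, if E j then (j : ℕ) else 0

/-- The first `k` indices. -/
def top (n k : ℕ) : Pattern n := fun j => decide ((j : ℕ) < k)

/-- Rotation by one step to the right. -/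
def cyc (E : Pattern n) : Pattern n := Fin.cons (E (Fin.last n)) fun j : Fin n => E j.castSucc

@[simp] theorem swap_castSucc (i : Fin n) (E : Pattern n) : swap i E i.castSucc = E i.succ := by
  simp [swap]

@[simp] theorem swap_succ (i : Fin n) (E : Pattern n) : swap i E i.succ = E i.castSucc := by
  simp [swap]

theorem swap_of_ne {i : Fin n} {E : Pattern n} {j : Fin (n + 1)} (h1 : j ≠ i.castSucc)
    (h2 : j ≠ i.succ) : swap i E j = E j := by
  simp [swap, Equiv.swap_apply_of_ne_of_ne h1 h2]

@[simp] theorem swap_swap (i : Fin n) (E : Pattern n) : swap i (swap i E) = E := by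
  funext j; simp [swap]

theorem swap_comm {i j : Fin n} (h : (i : ℕ) + 1 < j) (E : Pattern n) :
    swap i (swap j E) = swap j (swap i E) := by
  have e1 : (i.castSucc : Fin (n + 1)) ≠ j.castSucc := by simp [Fin.ext_iff]; omega
  have e2 : (i.castSucc : Fin (n + 1)) ≠ j.succ := by simp [Fin.ext_iff]; omega
  have e3 : i.succ ≠ j.castSucc := by simp [Fin.ext_iff]; omega
  have e4 : i.succ ≠ j.succ := by simp [Fin.ext_iff]; omega
  funext k
  simp only [swap, Equiv.swap_apply_def]
  split_ifs <;> simp_all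

theorem weight_swap (i : Fin n) (E : Pattern n) : (swap i E).weight = E.weight := by
  unfold weight
  refine Finset.card_bijective (Equiv.swap i.castSucc i.succ) (Equiv.bijective _) fun j => ?_
  rw [Finset.mem_filter, Finset.mem_filter]
  simp [swap]

theorem weight_cyc (E : Pattern n) : (cyc E).weight = E.weight := by
  simp only [weight, Finset.card_filter]
  rw [Fin.sum_univ_succ, Fin.sum_univ_castSucc]
  simp [cyc, add_comm]

theorem pos_swap_lt {i : Fin n} {E : Pattern n} (h : Ascent i E) : (swap i E).pos < E.pos := by
  have hne : (i.castSucc : Fin (n + 1)) ≠ i.succ := (Fin.castSucc_lt_succ).ne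
  have e : ∀ F : Pattern n, F.pos = (if F i.castSucc then (i : ℕ) else 0) +
      ((if F i.succ then (i : ℕ) + 1 else 0) +
      ∑ j ∈ (Finset.univ.erase i.castSucc).erase i.succ, if F j then (j : ℕ) else 0) := by
    intro F
    rw [pos, ← Finset.add_sum_erase _ _ (Finset.mem_univ i.castSucc),
      ← Finset.add_sum_erase (Finset.univ.erase i.castSucc) _
        (Finset.mem_erase.2 ⟨hne.symm, Finset.mem_univ i.succ⟩)]
    simp
  rw [e, e E, swap_castSucc, swap_succ, h.1, h.2]
  have : ∑ j ∈ (Finset.univ.erase i.castSucc).erase i.succ, (if swap i E j then (j : ℕ) else 0) =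
      ∑ j ∈ (Finset.univ.erase i.castSucc).erase i.succ, if E j then (j : ℕ) else 0 := by
    refine Finset.sum_congr rfl fun j hj => ?_
    simp only [Finset.mem_erase, Finset.mem_univ, and_true] at hj
    rw [swap_of_ne hj.2 hj.1]
  rw [this]
  simp

theorem antitone_of_not_ascent {E : Pattern n} (h : ∀ i, ¬Ascent i E) : Antitone E := by
  rw [Fin.antitone_iff_succ_le]
  intro i
  have := h i
  unfold Ascent at this
  cases h1 : E i.castSucc <;> cases h2 : E i.succ <;> simp_all

theorem eq_top_of_antitone {E : Pattern n} (h : Antitone E) : E = top n E.weight := by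
  funext j
  have := mem_iff_lt_card_of_lower (Finset.univ.filter fun j => E j = true) (fun a b hab hb => by
    simp only [Finset.mem_filter, Finset.mem_univ, true_and] at hb ⊢
    have := h hab.le
    rw [hb] at this
    exact Bool.eq_true_of_true_le this) j
  simp only [Finset.mem_filter, Finset.mem_univ, true_and] at this
  rw [top, Bool.eq_iff_iff, this, decide_eq_true_iff]
  rfl

theorem weight_top {k : ℕ} (hk : k ≤ n + 1) : (top n k).weight = k := by
  simp only [weight, top, decide_eq_true_eq]
  rcases Nat.eq_zero_or_pos k with rfl | h0
  · simp
  · rcases hk.lt_or_eq with h | rfl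
    · have : (Finset.univ.filter fun j : Fin (n + 1) => (j : ℕ) < k) = Finset.Iio ⟨k, h⟩ := by
        ext; simp [Fin.lt_def]
      rw [this, Fin.card_Iio]
    · rw [Finset.filter_true_of_mem fun j _ => j.2, Finset.card_univ, Fintype.card_fin]

theorem antitone_top (k : ℕ) : Antitone (top n k) := by
  intro a b hab
  rw [Fin.le_def] at hab
  unfold top
  by_cases h : (b : ℕ) < k
  · simp [h, hab.trans_lt h]
  · simp [h]

end Pattern

end Pattern

/-! ### Tail products -/

/-- The product of the `T i`, `k ≤ i`, in increasing order. -/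
def tailProd {M : Type*} [Monoid M] {n : ℕ} (T : Fin n → M) (k : ℕ) : M :=
  ((List.ofFn T).drop k).prod

theorem tailProd_eq_mul {M : Type*} [Monoid M] {n : ℕ} (T : Fin n → M) (i : Fin n) :
    tailProd T i = T i * tailProd T (i + 1) := by
  rw [tailProd, List.drop_eq_getElem_cons (by simp), List.prod_cons, List.getElem_ofFn]
  rfl

theorem tailProd_of_le {M : Type*} [Monoid M] {n : ℕ} (T : Fin n → M) {k : ℕ} (hk : n ≤ k) :
    tailProd T k = 1 := by
  rw [tailProd, List.drop_eq_nil_of_le (by simpa), List.prod_nil]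

theorem tailProd_zero {M : Type*} [Monoid M] {n : ℕ} (T : Fin n → M) :
    tailProd T 0 = (List.ofFn T).prod := rfl

/-! ### Consequences of the Hecke relations, and the commutation with $T_1\cdots T_{N-1}$. -/

section Hecke

variable {K ι κ : Type*} [Field K] [Fintype ι] [DecidableEq ι] [Fintype κ] [DecidableEq κ] {n : ℕ}

theorem tailProd_intertwine (X : Fin n → Matrix ι ι K) (Y : Fin n → Matrix κ κ K)
    (e : Matrix ι κ K) (k : Fin (n + 1)) (h : ∀ i : Fin n, k ≤ i.castSucc → X i * e = e * Y i) :
    tailProd X k * e = e * tailProd Y k := by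
  induction k using Fin.reverseInduction with
  | last => simp [tailProd_of_le]
  | cast i ih =>
    have ih := ih fun j hj => h j (Fin.castSucc_lt_succ.le.trans hj)
    rw [Fin.val_succ] at ih
    rw [Fin.val_castSucc, tailProd_eq_mul, tailProd_eq_mul, Matrix.mul_assoc, ih,
      ← Matrix.mul_assoc, h i le_rfl, Matrix.mul_assoc]

/-- The relations of the Hecke algebra. -/
structure IsHecke (t : K) (T : Fin n → Matrix ι ι K) : Prop where
  t_ne : t ≠ 0
  sq : ∀ i, T i * T i = (t - 1) • T i + t • 1
  comm : ∀ i j : Fin n, (i : ℕ) + 1 < j → T i * T j = T j * T i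
  braid : ∀ i j : Fin n, (i : ℕ) + 1 = j → T i * T j * T i = T j * T i * T j

/-- The inverses of Hecke generators. -/
def heckeInv (t : K) (T : Fin n → Matrix ι ι K) (i : Fin n) : Matrix ι ι K :=
  t⁻¹ • (T i + (1 - t) • 1)

namespace IsHecke

variable {t : K} {T : Fin n → Matrix ι ι K} (hT : IsHecke t T)
include hT

theorem mul_inv (i : Fin n) : T i * heckeInv t T i = 1 := by
  have := hT.t_ne
  rw [heckeInv, Matrix.mul_smul, mul_add, hT.sq, Matrix.mul_smul, mul_one]
  rw [add_assoc, add_comm (t • _), ← add_assoc, ← add_smul]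
  simp [this]

theorem inv_mul (i : Fin n) : heckeInv t T i * T i = 1 := mul_eq_one_comm.1 (hT.mul_inv i)

theorem comm' {i j : Fin n} (h : (i : ℕ) + 1 < j ∨ (j : ℕ) + 1 < i) : T i * T j = T j * T i :=
  h.elim (hT.comm i j) fun h => (hT.comm j i h).symm

theorem braid' {i j : Fin n} (h : (i : ℕ) + 1 = j ∨ (j : ℕ) + 1 = i) :
    T i * T j * T i = T j * T i * T j :=
  h.elim (hT.braid i j) fun h => (hT.braid j i h).symm

theorem inv_comm {i j : Fin n} (h : (i : ℕ) + 1 < j ∨ (j : ℕ) + 1 < i) :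
    heckeInv t T i * T j = T j * heckeInv t T i := by
  rw [heckeInv, Matrix.smul_mul, Matrix.mul_smul, add_mul, mul_add, hT.comm' h]
  simp

theorem inv_inv_comm {i j : Fin n} (h : (i : ℕ) + 1 < j ∨ (j : ℕ) + 1 < i) :
    heckeInv t T i * heckeInv t T j = heckeInv t T j * heckeInv t T i := by
  conv_lhs => rw [heckeInv.eq_def t T j]
  conv_rhs => rw [heckeInv.eq_def t T j]
  rw [Matrix.mul_smul, Matrix.smul_mul, mul_add, add_mul, hT.inv_comm h]
  simp

theorem braid_inv {i j : Fin n} (h : (i : ℕ) + 1 = j ∨ (j : ℕ) + 1 = i) :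
    T j * (heckeInv t T i * heckeInv t T j) = heckeInv t T i * heckeInv t T j * T i := by
  have h1 := hT.braid' h
  have h2 : heckeInv t T i * heckeInv t T j * (T j * T i) = 1 := by
    rw [mul_assoc, ← mul_assoc _ (T j), hT.inv_mul, one_mul, hT.inv_mul]
  have h3 : T j * T i * (heckeInv t T i * heckeInv t T j) = 1 := mul_eq_one_comm.1 h2
  calc T j * (heckeInv t T i * heckeInv t T j)
      = heckeInv t T i * heckeInv t T j * (T j * T i * T j) *
          (heckeInv t T i * heckeInv t T j) := by
        rw [← mul_assoc (heckeInv t T i * heckeInv t T j) (T j * T i) (T j), h2, one_mul]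
    _ = heckeInv t T i * heckeInv t T j * T i *
          (T j * T i * (heckeInv t T i * heckeInv t T j)) := by
        rw [← h1]; simp only [mul_assoc]
    _ = _ := by rw [h3, mul_one]

/-- For `k = 0`: conjugation by $\omega=T_1\cdots T_{N-1}$ shifts the index of a generator by one,
matching the rotation of the variables. -/
theorem mul_tailProd {i j : Fin n} (h : (i : ℕ) + 1 = j) (k : Fin (n + 1)) (hk : k ≤ i.castSucc) :
    T j * tailProd T k = tailProd T k * T i := by
  induction k using Fin.reverseInduction with
  | last => exact absurd (hk.trans_lt (Fin.castSucc_lt_last i)) (lt_irrefl _)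
  | cast l ih =>
    rw [Fin.val_castSucc, tailProd_eq_mul]
    rcases (Fin.le_def.1 hk).lt_or_eq with hl | hl
    · have := ih (by rw [Fin.le_def]; simpa using hl)
      rw [Fin.val_succ] at this
      rw [mul_assoc, ← this, ← mul_assoc, ← mul_assoc, hT.comm l j (by simp at hl; omega)]
    · have : l = i := by ext; simpa using hl
      subst this
      have e := tailProd_intertwine T T (T l) j.succ fun a ha => by
        rw [Fin.le_def] at ha
        simp only [Fin.val_succ, Fin.val_castSucc] at ha
        exact (hT.comm l a (by omega)).symm
      rw [Fin.val_succ] at e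
      rw [h, tailProd_eq_mul T j, mul_assoc, mul_assoc, e, ← mul_assoc, ← mul_assoc,
        ← hT.braid l j h]
      simp only [mul_assoc]

theorem tailProd_mul_inv {i j : Fin n} (h : (i : ℕ) + 1 = j) :
    tailProd T 0 * heckeInv t T i = heckeInv t T j * tailProd T 0 := by
  have e := hT.mul_tailProd h 0 (Fin.zero_le _)
  rw [Fin.val_zero] at e
  calc tailProd T 0 * heckeInv t T i
      = heckeInv t T j * (T j * tailProd T 0) * heckeInv t T i := by
        rw [← mul_assoc, hT.inv_mul, one_mul]
    _ = _ := by rw [e, mul_assoc, mul_assoc, hT.mul_inv, mul_one]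

end IsHecke

theorem SeminormalData.isHecke {B : Type*} (d : SeminormalData K B ι n) (ht : d.t ≠ 0) :
    IsHecke d.t d.mat :=
  ⟨ht, d.mat_mul_self, fun _ _ h => d.mat_comm h, fun _ _ h => d.mat_braid h⟩

/-! ### The family of coefficients -/

open Classical in
/-- The coefficients of the squarefree monomials, built from the coefficient `e` of the monomial
with the pattern `top n m`. -/
def coeffFam (t : K) (X : Fin n → Matrix ι ι K) (Y : Fin n → Matrix κ κ K) (m : ℕ)
    (e : Matrix ι κ K) (E : Pattern n) : Matrix ι κ K :=
  -- Compatibility with $\boldsymbol T_i$ forces this recursion. The choice of the ascent is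
  -- immaterial by `coeffFam_ascent`.
  if h : ∃ i, E.Ascent i then
    X h.choose * coeffFam t X Y m e (E.swap h.choose) * heckeInv t Y h.choose
  else if E = Pattern.top n m then e else 0
termination_by E.pos
decreasing_by exact Pattern.pos_swap_lt h.choose_spec

/-- Data that determine an intertwining map into squarefree polynomials. -/
structure Intertwiner (q t : K) (X : Fin n → Matrix ι ι K) (Y : Fin n → Matrix κ κ K)
    (DX : Fin (n + 1) → Matrix ι ι K) (DY : Fin (n + 1) → Matrix κ κ K) (k : Fin n)
    (e : Matrix ι κ K) : Prop where
  heckeX : IsHecke t X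
  heckeY : IsHecke t Y
  jmX : ∀ i, X i * DX i.succ * X i = t • DX i.castSucc
  jmY : ∀ i, Y i * DY i.succ * Y i = t • DY i.castSucc
  commX : ∀ i : Fin n, i.succ ≠ Fin.last n → X i * DX (Fin.last n) = DX (Fin.last n) * X i
  lastY : DY (Fin.last n) = 1
  -- These are the $i$ whose exchange fixes the pattern `top n (k + 1)`.
  comm : ∀ i, i ≠ k → X i * e = e * Y i
  last_e : DX (Fin.last n) * e = e
  -- The only condition that involves $q$; index `k` is the last element of the top pattern.
  jm_e : DX k.castSucc * e = q • (e * DY k.castSucc)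

/-! ### Compatibility of the coefficient family with the generators and with rotation. -/

namespace Intertwiner

variable {q t : K} {X : Fin n → Matrix ι ι K} {Y : Fin n → Matrix κ κ K}
  {DX : Fin (n + 1) → Matrix ι ι K} {DY : Fin (n + 1) → Matrix κ κ K} {k : Fin n}
  {e : Matrix ι κ K} (d : Intertwiner q t X Y DX DY k e)

omit [DecidableEq ι] in
theorem coeffFam_of_not_ascent {m : ℕ} {E : Pattern n} (h : ∀ i, ¬E.Ascent i) :
    coeffFam t X Y m e E = open Classical in if E = Pattern.top n m then e else 0 := by
  rw [coeffFam, dif_neg (not_exists.2 h)]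

theorem not_ascent_top (m : ℕ) (i : Fin n) : ¬(Pattern.top n m).Ascent i := fun h => by
  have := Pattern.antitone_top m (Fin.castSucc_lt_succ (i := i)).le
  rw [h.1, h.2] at this
  exact absurd this (by decide)

omit [DecidableEq ι] in
theorem coeffFam_top (m : ℕ) : coeffFam t X Y m e (Pattern.top n m) = e := by
  rw [coeffFam_of_not_ascent (not_ascent_top m), if_pos rfl]

omit [DecidableEq ι] in
theorem coeffFam_eq_zero {m : ℕ} (hm : m ≤ n + 1) (E : Pattern n) (h : E.weight ≠ m) :
    coeffFam t X Y m e E = 0 := by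
  induction hp : E.pos using Nat.strong_induction_on generalizing E with
  | _ p ih =>
    rw [coeffFam]
    split_ifs with h1 h2
    · rw [ih _ (hp ▸ Pattern.pos_swap_lt h1.choose_spec) _ (by rwa [Pattern.weight_swap]) rfl]
      simp
    · exact absurd (h2 ▸ Pattern.weight_top hm) h
    · rfl

include d

/-- Two different ascents are never adjacent, since the shared place would have to be both in and
out of the pattern. Hence the two steps commute, and induction on `pos` applies. -/
theorem coeffFam_ascent {m : ℕ} (E : Pattern n) {i : Fin n} (h : E.Ascent i) :
    coeffFam t X Y m e E = X i * coeffFam t X Y m e (E.swap i) * heckeInv t Y i := by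
  induction hp : E.pos using Nat.strong_induction_on generalizing E i with
  | _ p ih =>
    have hex : ∃ i, E.Ascent i := ⟨i, h⟩
    obtain ⟨j, hj, hE⟩ : ∃ j, E.Ascent j ∧ coeffFam t X Y m e E =
        X j * coeffFam t X Y m e (E.swap j) * heckeInv t Y j :=
      ⟨hex.choose, hex.choose_spec, by rw [coeffFam, dif_pos hex]⟩
    by_cases hij : i = j
    · rw [hij]; exact hE
    have hfar : (i : ℕ) + 1 < j ∨ (j : ℕ) + 1 < i := by
      by_contra hn
      push Not at hn
      have hne : (i : ℕ) ≠ j := fun h => hij (Fin.ext h)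
      rcases Nat.lt_or_gt_of_ne hne with hl | hl
      · have : i.succ = j.castSucc := by ext; simp; omega
        have h1 := h.2
        rw [this, hj.1] at h1
        exact absurd h1 (by decide)
      · have : j.succ = i.castSucc := by ext; simp; omega
        have h1 := hj.2
        rw [this, h.1] at h1
        exact absurd h1 (by decide)
    have e1 : (i.castSucc : Fin (n + 1)) ≠ j.castSucc := by simp [Fin.ext_iff]; omega
    have e2 : (i.castSucc : Fin (n + 1)) ≠ j.succ := by simp [Fin.ext_iff]; omega
    have e3 : i.succ ≠ j.castSucc := by simp [Fin.ext_iff]; omega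
    have e4 : i.succ ≠ j.succ := by simp [Fin.ext_iff]; omega
    have a1 : (E.swap j).Ascent i :=
      ⟨by rw [Pattern.swap_of_ne e1 e2, h.1], by rw [Pattern.swap_of_ne e3 e4, h.2]⟩
    have a2 : (E.swap i).Ascent j :=
      ⟨by rw [Pattern.swap_of_ne e1.symm e3.symm, hj.1],
        by rw [Pattern.swap_of_ne e2.symm e4.symm, hj.2]⟩
    have hs : (E.swap j).swap i = (E.swap i).swap j :=
      hfar.elim (fun h => Pattern.swap_comm h E) fun h => (Pattern.swap_comm h E).symm
    rw [hE, ih _ (hp ▸ Pattern.pos_swap_lt hj) _ a1 rfl, ih _ (hp ▸ Pattern.pos_swap_lt h) _ a2 rfl,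
      hs]
    simp only [Matrix.mul_assoc]
    rw [d.heckeY.inv_inv_comm hfar]
    simp only [← Matrix.mul_assoc]
    rw [d.heckeX.comm' hfar]

/-- Induction along an ascent `j`. If it is far from `i`, everything commutes. If it is adjacent,
two successive sorting steps turn the relation for `i` into the one for `j`, by the braid relation.
-/
theorem coeffFam_eq (E : Pattern n) {i : Fin n} (h : E i.castSucc = E i.succ) :
    X i * coeffFam t X Y (k + 1) e E = coeffFam t X Y (k + 1) e E * Y i := by
  induction hp : E.pos using Nat.strong_induction_on generalizing E i with
  | _ p ih =>
    by_cases hex : ∃ j, E.Ascent j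
    · obtain ⟨j, hj⟩ := hex
      have hij : (i : ℕ) ≠ j := by
        intro he
        obtain rfl : i = j := Fin.ext he
        rw [hj.1, hj.2] at h
        exact absurd h (by decide)
      by_cases hfar : (i : ℕ) + 1 < j ∨ (j : ℕ) + 1 < i
      · have e1 : (i.castSucc : Fin (n + 1)) ≠ j.castSucc := by simp [Fin.ext_iff]; omega
        have e2 : (i.castSucc : Fin (n + 1)) ≠ j.succ := by simp [Fin.ext_iff]; omega
        have e3 : i.succ ≠ j.castSucc := by simp [Fin.ext_iff]; omega
        have e4 : i.succ ≠ j.succ := by simp [Fin.ext_iff]; omega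
        rw [d.coeffFam_ascent E hj, Matrix.mul_assoc _ (heckeInv t Y j) (Y i),
          d.heckeY.inv_comm hfar.symm, ← Matrix.mul_assoc _ (Y i), Matrix.mul_assoc (X j) _ (Y i),
          ← ih _ (hp ▸ Pattern.pos_swap_lt hj) (E.swap j)
            (by rw [Pattern.swap_of_ne e1 e2, Pattern.swap_of_ne e3 e4, h]) rfl]
        simp only [← Matrix.mul_assoc]
        rw [d.heckeX.comm' hfar]
      · have hadj : (i : ℕ) + 1 = j ∨ (j : ℕ) + 1 = i := by omega
        have a1 : (E.swap j).Ascent i ∧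
            ((E.swap j).swap i) j.castSucc = ((E.swap j).swap i) j.succ := by
          rcases hadj with ha | ha
          · have hc : j.castSucc = i.succ := by ext; simp; omega
            have e1 : (i.castSucc : Fin (n + 1)) ≠ j.castSucc := by simp [Fin.ext_iff]; omega
            have e2 : (i.castSucc : Fin (n + 1)) ≠ j.succ := by simp [Fin.ext_iff]; omega
            have e4 : i.succ ≠ j.succ := by simp [Fin.ext_iff]; omega
            have h1 := hj.1
            rw [hc, ← h] at h1
            refine ⟨⟨by rw [Pattern.swap_of_ne e1 e2, h1],
              by rw [← hc, Pattern.swap_castSucc, hj.2]⟩, ?_⟩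
            rw [hc, Pattern.swap_succ, Pattern.swap_of_ne e1 e2, Pattern.swap_of_ne e2.symm e4.symm,
              Pattern.swap_succ, hj.1, h1]
          · have hc : i.castSucc = j.succ := by ext; simp; omega
            have e1 : (j.castSucc : Fin (n + 1)) ≠ i.castSucc := by simp [Fin.ext_iff]; omega
            have e2 : (j.castSucc : Fin (n + 1)) ≠ i.succ := by simp [Fin.ext_iff]; omega
            have e4 : i.succ ≠ j.succ := by simp [Fin.ext_iff]; omega
            have e5 : i.succ ≠ j.castSucc := e2.symm
            have h1 := hj.2
            rw [← hc, h] at h1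
            refine ⟨⟨by rw [hc, Pattern.swap_succ, hj.1],
              by rw [Pattern.swap_of_ne e5 e4, h1]⟩, ?_⟩
            rw [← hc, Pattern.swap_castSucc, Pattern.swap_of_ne e1 e2, Pattern.swap_castSucc,
              Pattern.swap_of_ne e5 e4, hj.2, h1]
        have hlt := Pattern.pos_swap_lt hj
        have hlt2 := Pattern.pos_swap_lt a1.1
        have h3 := ih _ (hp ▸ hlt2.trans hlt) _ a1.2 rfl
        rw [d.coeffFam_ascent E hj, d.coeffFam_ascent _ a1.1]
        set F := coeffFam t X Y (k + 1) e ((E.swap j).swap i)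
        calc X i * (X j * (X i * F * heckeInv t Y i) * heckeInv t Y j)
            = (X i * X j * X i) * F * (heckeInv t Y i * heckeInv t Y j) := by
              simp only [Matrix.mul_assoc]
          _ = X j * X i * (X j * F) * (heckeInv t Y i * heckeInv t Y j) := by
              rw [d.heckeX.braid' hadj]; simp only [Matrix.mul_assoc]
          _ = X j * X i * F * (Y j * (heckeInv t Y i * heckeInv t Y j)) := by
              rw [h3]; simp only [Matrix.mul_assoc]
          _ = _ := by
              rw [d.heckeY.braid_inv hadj]; simp only [Matrix.mul_assoc]
    · push Not at hex
      rw [coeffFam_of_not_ascent hex]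
      split_ifs with hE
      · refine d.comm i fun hik => ?_
        subst hik
        rw [hE] at h
        simp [Pattern.top] at h
      · simp

/-- The pattern `i ≤ k + 1`, `i ≠ j`. -/
theorem hole_chain (j : Fin (n + 1)) (hj : j ≤ k.succ) :
    coeffFam t X Y (k + 1) e (fun i => decide (i ≤ k.succ ∧ i ≠ j)) * tailProd Y j =
      tailProd X j * e := by
  induction j using Fin.reverseInduction with
  | last =>
    have hk : k.succ = Fin.last n := le_antisymm (Fin.le_last _) hj
    have : (fun i => decide (i ≤ k.succ ∧ i ≠ Fin.last n)) = Pattern.top n (k + 1) := by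
      funext i
      rw [Pattern.top, decide_eq_decide, ← hk, ← lt_iff_le_and_ne, Fin.lt_def, Fin.val_succ]
    rw [this, coeffFam_top]
    simp [tailProd_of_le]
  | cast j ih =>
    rcases hj.lt_or_eq with hlt | heq
    · have hle : j.succ ≤ k.succ := by
        rw [Fin.lt_def] at hlt; rw [Fin.le_def]; simp at hlt ⊢; omega
      have ih := ih hle
      have hlt' : (j.castSucc : Fin (n + 1)) < j.succ := Fin.castSucc_lt_succ
      have hasc : Pattern.Ascent j fun i => decide (i ≤ k.succ ∧ i ≠ j.castSucc) :=
        ⟨by simp, decide_eq_true ⟨hle, hlt'.ne'⟩⟩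
      have hsw : Pattern.swap j (fun i => decide (i ≤ k.succ ∧ i ≠ j.castSucc)) =
          fun i => decide (i ≤ k.succ ∧ i ≠ j.succ) := by
        funext i
        by_cases h1 : i = j.castSucc
        · subst h1
          simp only [Pattern.swap_castSucc, decide_eq_decide]
          simp only [hle, hlt.le, true_and]
          exact ⟨fun _ => hlt'.ne, fun _ => hlt'.ne'⟩
        · by_cases h2 : i = j.succ
          · subst h2; simp
          · rw [Pattern.swap_of_ne h1 h2]; simp [h1, h2]
      rw [d.coeffFam_ascent _ hasc, hsw, Fin.val_castSucc, tailProd_eq_mul, tailProd_eq_mul,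
        Matrix.mul_assoc, ← Matrix.mul_assoc (heckeInv t Y j), d.heckeY.inv_mul, Matrix.one_mul,
        Matrix.mul_assoc]
      rw [Fin.val_succ] at ih
      rw [ih, Matrix.mul_assoc]
    · have : (fun i => decide (i ≤ k.succ ∧ i ≠ j.castSucc)) = Pattern.top n (k + 1) := by
        funext i
        rw [Pattern.top, decide_eq_decide, heq, ← lt_iff_le_and_ne, Fin.lt_def, Fin.val_succ]
      rw [this, coeffFam_top, tailProd_intertwine X Y e _ fun i hi => d.comm i ?_]
      rintro rfl
      rw [heq] at hi
      exact absurd hi (not_le.2 Fin.castSucc_lt_succ)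

/-- The rotated top pattern is $\{0,\dots,k+1\}$ without $0$, so moving the hole from $k+1$ to $0$
by `hole_chain` produces the tail products. -/
theorem cyc_top :
    tailProd X 0 * DX (Fin.last n) * coeffFam t X Y (k + 1) e (Pattern.top n (k + 1)) =
      coeffFam t X Y (k + 1) e (Pattern.top n (k + 1)).cyc * tailProd Y 0 := by
  have h := d.hole_chain 0 (Fin.zero_le _)
  rw [Fin.val_zero] at h
  have hc : (Pattern.top n (k + 1)).cyc = fun i => decide (i ≤ k.succ ∧ i ≠ 0) := by
    funext i
    refine Fin.cases ?_ (fun i => ?_) i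
    · simp [Pattern.cyc, Pattern.top]
    · simp only [Pattern.cyc, Pattern.top, Fin.cons_succ, decide_eq_decide, Fin.le_def,
        Fin.val_succ, Fin.val_castSucc]
      simp [Fin.ext_iff]
  rw [hc, h, coeffFam_top, Matrix.mul_assoc, d.last_e]

/-- Each step lowers the isolated element by one and uses $X_jJ_{j+1}X_j=tJ_j$. At `j = k.castSucc`
the pattern becomes the top one and `jm_e` can be applied. -/
theorem jm_chain (j : Fin (n + 1)) (hj : k.castSucc ≤ j) :
    tailProd X j * DX (Fin.last n) *
        coeffFam t X Y (k + 1) e (fun i => decide (i < k.castSucc ∨ i = Fin.last n)) =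
      t ^ (n - j : ℕ) • (DX j * coeffFam t X Y (k + 1) e (fun i => decide (i < k.castSucc ∨ i = j)) *
        tailProd (heckeInv t Y) j) := by
  induction j using Fin.reverseInduction with
  | last => simp [tailProd_of_le]
  | cast j ih =>
    have ih := ih (hj.trans Fin.castSucc_lt_succ.le)
    have hlt' : (j.castSucc : Fin (n + 1)) < j.succ := Fin.castSucc_lt_succ
    have hasc : Pattern.Ascent j fun i => decide (i < k.castSucc ∨ i = j.succ) :=
      ⟨by simpa using ⟨hj, hlt'.ne⟩, by simp⟩
    have hsw : Pattern.swap j (fun i => decide (i < k.castSucc ∨ i = j.succ)) =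
        fun i => decide (i < k.castSucc ∨ i = j.castSucc) := by
      funext i
      by_cases h1 : i = j.castSucc
      · subst h1; simp
      · by_cases h2 : i = j.succ
        · subst h2
          simp only [Pattern.swap_succ, decide_eq_decide]
          simp only [hlt'.ne, hlt'.ne', or_false, (hj.trans hlt'.le).not_gt, hj.not_gt]
        · rw [Pattern.swap_of_ne h1 h2]; simp [h1, h2]
    rw [Fin.val_succ, d.coeffFam_ascent _ hasc, hsw] at ih
    rw [Fin.val_castSucc, tailProd_eq_mul, tailProd_eq_mul, Matrix.mul_assoc, Matrix.mul_assoc,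
      ← Matrix.mul_assoc (tailProd X _), ih]
    have hpow : t ^ (n - j : ℕ) = t ^ (n - (j + 1) : ℕ) * t := by
      rw [← pow_succ]; congr 1; omega
    rw [hpow, mul_smul, Matrix.mul_smul]
    congr 1
    have := d.jmX j
    rw [← Matrix.smul_mul, ← Matrix.smul_mul, ← this]
    simp only [Matrix.mul_assoc]

-- Unrolled, $J_j=t^{j-n}Y_j\cdots Y_{n-1}Y_{n-1}\cdots Y_j$; the inverses cancel the right half.
omit d in
theorem jm_tail (hY : IsHecke t Y) (jmY : ∀ i, Y i * DY i.succ * Y i = t • DY i.castSucc)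
    (lastY : DY (Fin.last n) = 1) (j : Fin (n + 1)) :
    t ^ (n - j : ℕ) • (DY j * tailProd (heckeInv t Y) j) = tailProd Y j := by
  induction j using Fin.reverseInduction with
  | last => simp [tailProd_of_le, lastY]
  | cast j ih =>
    have hpow : t ^ (n - j : ℕ) = t ^ (n - (j + 1) : ℕ) * t := by
      rw [← pow_succ]; congr 1; omega
    rw [Fin.val_succ] at ih
    rw [Fin.val_castSucc, tailProd_eq_mul, tailProd_eq_mul, ← ih, hpow, mul_smul, Matrix.mul_smul]
    congr 1
    rw [← Matrix.smul_mul, ← jmY, Matrix.mul_assoc, ← Matrix.mul_assoc (Y j) (heckeInv t Y j),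
      hY.mul_inv, Matrix.one_mul, Matrix.mul_assoc]

theorem cyc_last_aux (j : Fin (n + 1)) (hj : j ≤ k.castSucc) :
    tailProd X j * DX (Fin.last n) *
        coeffFam t X Y (k + 1) e (fun i => decide (i < k.castSucc ∨ i = Fin.last n)) =
      q • (e * tailProd Y j) := by
  induction j using Fin.reverseInduction with
  | last => exact absurd (hj.trans_lt (Fin.castSucc_lt_last k)) (lt_irrefl _)
  | cast j ih =>
    rcases hj.lt_or_eq with hlt | heq
    · have hlt : j < k := by simpa using hlt
      have ih := ih (by rw [Fin.le_def]; simpa using hlt)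
      rw [Fin.val_succ] at ih
      rw [Fin.val_castSucc, tailProd_eq_mul, tailProd_eq_mul, Matrix.mul_assoc, Matrix.mul_assoc,
        ← Matrix.mul_assoc (tailProd X _), ih, Matrix.mul_smul, ← Matrix.mul_assoc,
        d.comm j hlt.ne, Matrix.mul_assoc]
    · obtain rfl : j = k := by simpa using heq
      have htop : (fun i => decide (i < j.castSucc ∨ i = j.castSucc)) = Pattern.top n (j + 1) := by
        funext i
        rw [Pattern.top, decide_eq_decide, ← le_iff_lt_or_eq, Fin.le_def, Fin.val_castSucc,
          Nat.lt_succ_iff]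
      rw [d.jm_chain j.castSucc le_rfl, htop, coeffFam_top, d.jm_e,
        ← jm_tail d.heckeY d.jmY d.lastY j.castSucc]
      rw [Matrix.smul_mul, Matrix.mul_smul, smul_comm, Matrix.mul_assoc]

theorem cyc_last :
    tailProd X 0 * DX (Fin.last n) *
        coeffFam t X Y (k + 1) e (fun i => decide (i < k.castSucc ∨ i = Fin.last n)) =
      q • (coeffFam t X Y (k + 1) e
        (Pattern.cyc fun i => decide (i < k.castSucc ∨ i = Fin.last n)) * tailProd Y 0) := by
  have h := d.cyc_last_aux 0 (Fin.zero_le _)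
  rw [Fin.val_zero] at h
  have hc : (Pattern.cyc fun i => decide (i < k.castSucc ∨ i = Fin.last n)) =
      Pattern.top n (k + 1) := by
    funext i
    refine Fin.cases ?_ (fun i => ?_) i
    · simp [Pattern.cyc, Pattern.top]
    · simp [Pattern.cyc, Pattern.top]
  rw [hc, coeffFam_top, h]

/-- Rotation turns an ascent at `i` into one at `i + 1`, as $\omega$ does with the generators.
Removing ascents that do not touch the last place leaves only the top pattern (`cyc_top`) and the
pattern of the first `k` places with the last one (`cyc_last`). -/
theorem cyc_eq (E : Pattern n) :
    tailProd X 0 * DX (Fin.last n) * coeffFam t X Y (k + 1) e E =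
      (if E (Fin.last n) then q else 1) • (coeffFam t X Y (k + 1) e E.cyc * tailProd Y 0) := by
  induction hp : E.pos using Nat.strong_induction_on generalizing E with
  | _ p ih =>
  by_cases hw : E.weight = k + 1
  swap
  · have hm : (k : ℕ) + 1 ≤ n + 1 := by omega
    rw [coeffFam_eq_zero hm E hw, coeffFam_eq_zero hm _ (by rwa [Pattern.weight_cyc])]
    simp
  by_cases hex : ∃ i : Fin n, i.succ ≠ Fin.last n ∧ E.Ascent i
  · obtain ⟨i, hil, hi⟩ := hex
    have hin : (i : ℕ) + 1 < n := by
      simp only [ne_eq, Fin.ext_iff, Fin.val_succ, Fin.val_last] at hil; omega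
    let j : Fin n := ⟨i + 1, hin⟩
    have hjc : j.castSucc = i.succ := by ext; simp [j]
    have hjs : (⟨i + 1, hin⟩ : Fin n).castSucc = i.succ := hjc
    have hcs : ∀ F : Pattern n, F.cyc j.castSucc = F i.castSucc := fun F => by
      rw [hjc]; simp [Pattern.cyc]
    have hcs' : ∀ F : Pattern n, F.cyc j.succ = F i.succ := fun F => by
      simp [Pattern.cyc, hjc]
    have hasc : E.cyc.Ascent j := ⟨by rw [hcs, hi.1], by rw [hcs', hi.2]⟩
    have hne1 : Fin.last n ≠ i.castSucc := (Fin.castSucc_lt_last i).ne'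
    have hsw : E.cyc.swap j = (E.swap i).cyc := by
      funext l
      by_cases h1 : l = j.castSucc
      · subst h1; rw [Pattern.swap_castSucc, hcs', hcs, Pattern.swap_castSucc]
      · by_cases h2 : l = j.succ
        · subst h2; rw [Pattern.swap_succ, hcs', hcs, Pattern.swap_succ]
        · rw [Pattern.swap_of_ne h1 h2]
          revert h1 h2
          refine Fin.cases (fun _ _ => ?_) (fun l h1 h2 => ?_) l
          · simp [Pattern.cyc, Pattern.swap_of_ne hne1 hil.symm]
          · simp only [Pattern.cyc, Fin.cons_succ]
            rw [Pattern.swap_of_ne]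
            · intro h; apply h1; rw [hjc]; simpa using h
            · intro h; apply h2; rw [← hjc] at h; simpa using h
    have hlast : E.swap i (Fin.last n) = E (Fin.last n) := Pattern.swap_of_ne hne1 hil.symm
    have h1 := ih _ (hp ▸ Pattern.pos_swap_lt hi) (E.swap i) rfl
    have h2 := d.heckeX.mul_tailProd (i := i) (j := j) rfl 0 (Fin.zero_le _)
    rw [Fin.val_zero] at h2
    rw [d.coeffFam_ascent E hi, d.coeffFam_ascent _ hasc, hsw]
    rw [hlast] at h1
    set F := coeffFam t X Y (k + 1) e (E.swap i)
    calc tailProd X 0 * DX (Fin.last n) * (X i * F * heckeInv t Y i)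
        = tailProd X 0 * (DX (Fin.last n) * X i) * F * heckeInv t Y i := by
          simp only [Matrix.mul_assoc]
      _ = tailProd X 0 * X i * DX (Fin.last n) * F * heckeInv t Y i := by
          rw [← d.commX i hil]; simp only [Matrix.mul_assoc]
      _ = X j * (tailProd X 0 * DX (Fin.last n) * F) * heckeInv t Y i := by
          rw [← h2]; simp only [Matrix.mul_assoc]
      _ = _ := by
          rw [h1, Matrix.mul_smul, Matrix.smul_mul]
          congr 1
          rw [Matrix.mul_assoc, Matrix.mul_assoc,
            d.heckeY.tailProd_mul_inv (i := i) (j := j) rfl]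
          simp only [Matrix.mul_assoc]
  · push Not at hex
    by_cases hl : E (Fin.last n) = true
    · let E' : Pattern n := fun i => decide (i ≠ Fin.last n) && E i
      have hE' : ∀ i, ¬E'.Ascent i := by
        rintro i ⟨h1, h2⟩
        have h3 : i.succ ≠ Fin.last n ∧ E i.succ = true := by simpa [E'] using h2
        refine hex i h3.1 ⟨?_, h3.2⟩
        simpa [E', (Fin.castSucc_lt_last i).ne] using h1
      have htop := Pattern.eq_top_of_antitone (Pattern.antitone_of_not_ascent hE')
      have hwt : E'.weight = k := by
        have : E.weight = E'.weight + 1 := by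
          simp only [Pattern.weight, Finset.card_filter]
          rw [Fin.sum_univ_castSucc, Fin.sum_univ_castSucc]
          simp [E', hl, (Fin.castSucc_lt_last _).ne]
        omega
      have hEE : E = fun i => decide (i < k.castSucc ∨ i = Fin.last n) := by
        funext i
        by_cases hi : i = Fin.last n
        · simp [hi, hl]
        · have := congrFun htop i
          rw [hwt] at this
          simpa [E', Pattern.top, hi, Fin.lt_def] using this
      rw [if_pos hl, hEE]
      exact d.cyc_last
    · have hE' : ∀ i, ¬E.Ascent i := by
        rintro i hi
        by_cases h : i.succ = Fin.last n
        · exact hl (h ▸ hi.2)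
        · exact hex i h hi
      have htop := Pattern.eq_top_of_antitone (Pattern.antitone_of_not_ascent hE')
      rw [if_neg hl, one_smul, htop, hw]
      exact d.cyc_top

end Intertwiner

end Hecke

/-! ### The intertwiner for the last column -/

section LastColumn

variable {μ : YoungDiagram} {n : ℕ} {K : Type*} [Field K]

/-- The last column is filled with the numbers `0, …, m - 1`. -/
def LastColFirst (R : Cell μ ≃ Fin (n + 1)) : Prop :=
  ∀ c, (R c : ℕ) < lastColLen μ ↔ μ.rowLen 0 - 1 ≤ c.1.2

theorem LastColFirst.exch_iff {k i : Fin n} (hk : (k : ℕ) + 1 = lastColLen μ) (hik : i ≠ k)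
    (R : Cell μ ≃ Fin (n + 1)) : LastColFirst (exch i R) ↔ LastColFirst R := by
  refine forall_congr' fun c => ?_
  have : ((exch i R c : Fin (n + 1)) : ℕ) < lastColLen μ ↔ (R c : ℕ) < lastColLen μ := by
    have hne : (i : ℕ) ≠ k := fun h => hik (Fin.ext h)
    simp only [exch, Equiv.trans_apply, Equiv.swap_apply_def]
    split_ifs with h1 h2
    · rw [h1, Fin.val_succ, Fin.val_castSucc]; omega
    · rw [h2, Fin.val_succ, Fin.val_castSucc]; omega
    · rfl
  rw [this]

theorem LastColFirst.side_iff {k i : Fin n} (hk : (k : ℕ) + 1 = lastColLen μ) (hik : i ≠ k)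
    {R : Cell μ ≃ Fin (n + 1)} (hR : LastColFirst R) :
    μ.rowLen 0 - 1 ≤ (R.symm i.castSucc).1.2 ↔ μ.rowLen 0 - 1 ≤ (R.symm i.succ).1.2 := by
  have hne : (i : ℕ) ≠ k := fun h => hik (Fin.ext h)
  rw [← hR, ← hR, Equiv.apply_symm_apply, Equiv.apply_symm_apply, Fin.val_succ, Fin.val_castSucc]
  omega

/-- Homogeneity of degree zero: a common factor $q$ of two contents on the same side of the cut is
invisible to the seminormal coefficients. -/
theorem diagCoeff_mul_left {c : K} (hc : c ≠ 0) (t x y : K) :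
    diagCoeff t (c * x) (c * y) = diagCoeff t x y := by
  unfold diagCoeff
  rw [← mul_sub, mul_left_comm, mul_div_mul_left _ _ hc]

theorem offProd_mul_left {c : K} (hc : c ≠ 0) (t x y : K) :
    offProd t (c * x) (c * y) = offProd t x y := by
  unfold offProd
  rw [← mul_sub, mul_pow, ← mul_div_mul_left _ ((x - y) ^ 2) (pow_ne_zero 2 hc)]
  congr 1
  ring

theorem exists_cutCont_eq {D : ℕ} {q t : K} (hq : q ≠ 0) {x y : Cell μ}
    (h : D ≤ x.1.2 ↔ D ≤ y.1.2) :
    ∃ c : K, c ≠ 0 ∧ cutCont q t D x = c * t ^ x.content ∧ cutCont q t D y = c * t ^ y.content := by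
  refine ⟨if D ≤ x.1.2 then q else 1, ?_, rfl, ?_⟩
  · split_ifs
    exacts [hq, one_ne_zero]
  · simp only [cutCont, h]

theorem diagCoeff_cutCont {q t : K} (hq : q ≠ 0) {D : ℕ} {x y : Cell μ}
    (h : D ≤ x.1.2 ↔ D ≤ y.1.2) :
    diagCoeff t (cutCont q t D x) (cutCont q t D y) =
      diagCoeff t (cutCont 1 t (μ.rowLen 0) x) (cutCont 1 t (μ.rowLen 0) y) := by
  obtain ⟨c, hc, h1, h2⟩ := exists_cutCont_eq (t := t) hq h
  rw [h1, h2, diagCoeff_mul_left hc, cutCont_whole, cutCont_whole]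

theorem cutCoef_eq {q t : K} (hq : q ≠ 0) {D : ℕ} {x y : Cell μ}
    (h : D ≤ x.1.2 ↔ D ≤ y.1.2) :
    cutCoef q t D x y = cutCoef 1 t (μ.rowLen 0) x y := by
  obtain ⟨c, hc, h1, h2⟩ := exists_cutCont_eq (t := t) hq h
  have h' : μ.rowLen 0 ≤ x.1.2 ↔ μ.rowLen 0 ≤ y.1.2 := by simp only [not_le.2 (Cell.col_lt _)]
  rw [cutCoef, cutCoef, if_pos h, if_pos h', h1, h2, offProd_mul_left hc, cutCont_whole,
    cutCont_whole]

theorem isCut_of_rsyt (S : RSYT μ n) (D : ℕ) : IsCut D S.entry :=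
  ⟨fun c c' h1 h2 _ => S.row_decr c c' h1 h2, S.col_decr⟩

theorem IsCut.symm_last {D : ℕ} {R : Cell μ ≃ Fin (n + 1)} (hR : IsCut D R)
    (h : (R.symm (Fin.last n)).1.2 < D) : (R.symm (Fin.last n)).1 = (0, 0) := by
  set x := R.symm (Fin.last n) with hx
  have hmax : ∀ y : Cell μ, ¬R x < R y := fun y => by
    rw [hx, Equiv.apply_symm_apply]
    exact not_lt.2 (Fin.le_last _)
  refine Prod.ext ?_ ?_
  · by_contra hne
    exact hmax _ (hR.2 ⟨(0, x.1.2), x.mem_of_le (Nat.zero_le _) le_rfl⟩ x rfl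
      (Nat.pos_of_ne_zero hne))
  · by_contra hne
    exact hmax _ (hR.1 ⟨(x.1.1, 0), x.mem_of_le le_rfl (Nat.zero_le _)⟩ x rfl
      (Nat.pos_of_ne_zero hne) (by change D ≤ 0 ↔ _; omega))

theorem IsCut.cutCont_last {D : ℕ} {R : Cell μ ≃ Fin (n + 1)} (hR : IsCut D R)
    (h : (R.symm (Fin.last n)).1.2 < D) (q t : K) :
    cutCont q t D (R.symm (Fin.last n)) = 1 := by
  have := hR.symm_last h
  rw [cutCont, if_neg (not_le.2 h), one_mul, Cell.content, this]
  simp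

open Classical in
/-- The identification of the cut tableaux whose last column is filled with the numbers
`0, …, m - 1` with tableaux. -/
def leadMatrix (K : Type*) [Field K] (μ : YoungDiagram) (n : ℕ) :
    Matrix (CutTableau μ n) (RSYT μ n) K :=
  fun R S => if S.entry = R.1 ∧ LastColFirst R.1 then 1 else 0

section Intertwine

variable {q t : K} (hg : Generic μ (μ.rowLen 0 - 1) q t)

-- Extended by zero to all fillings, `leadMatrix` is just restriction to `LastColFirst`, so it can
-- be compared with `lop` pointwise.
open Classical in
theorem ext_leadMatrix (w : RSYT μ n → K) (R : Cell μ ≃ Fin (n + 1)) :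
    (colData hg).ext ((leadMatrix K μ n).mulVec w) R =
      if LastColFirst R then (tauData hg.t_ne hg.t_pow).ext w R else 0 := by
  by_cases hR : ∃ a, (colData hg).fill a = R
  · obtain ⟨a, rfl⟩ := hR
    rw [SeminormalData.ext_fill]
    simp only [Matrix.mulVec, dotProduct, leadMatrix, SeminormalData.ext]
    split_ifs with h
    · refine Finset.sum_congr rfl fun S _ => ?_
      have h' : LastColFirst a.1 := h
      simp only [h', and_true, ite_mul, one_mul, zero_mul]
      congr
    · have h' : ¬LastColFirst a.1 := h
      simp [h']
  · push Not at hR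
    rw [SeminormalData.ext_of_forall_ne _ _ hR]
    split_ifs with h
    · rw [SeminormalData.ext_of_forall_ne]
      intro S hS
      exact hR ⟨S.entry, isCut_of_rsyt S _⟩ hS
    · rfl

/-- For `i ≠ k` the entries `i, i + 1` lie on the same side of the cut, where both modules have the
same coefficients, and their exchange preserves `LastColFirst`. -/
theorem mat_mul_leadMatrix {k i : Fin n}
    (hk : (k : ℕ) + 1 = lastColLen μ) (hik : i ≠ k) :
    (colData hg).mat i * leadMatrix K μ n =
      leadMatrix K μ n * (heckeMatrix t i : Matrix (RSYT μ n) (RSYT μ n) K) := by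
  classical
  rw [heckeMatrix_eq hg.t_ne hg.t_pow]
  have key : ∀ (w : RSYT μ n → K) (a : CutTableau μ n),
      ((colData hg).mat i * leadMatrix K μ n).mulVec w a =
        (leadMatrix K μ n * ((tauData hg.t_ne hg.t_pow).mat i :
          Matrix (RSYT μ n) (RSYT μ n) K)).mulVec w a := by
    intro w a
    rw [← Matrix.mulVec_mulVec, ← Matrix.mulVec_mulVec, SeminormalData.mat_mulVec,
      ← SeminormalData.ext_fill (colData hg) ((leadMatrix K μ n).mulVec _) a,
      ext_leadMatrix hg, SeminormalData.ext_mulVec]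
    simp only [SeminormalData.lop, ext_leadMatrix hg,
      LastColFirst.exch_iff hk hik]
    split_ifs with h
    · have hs := LastColFirst.side_iff hk hik h
      congr 2
      · exact diagCoeff_cutCont hg.q_ne hs
      · exact cutCoef_eq hg.q_ne hs
    · simp
  ext a S
  simpa using key (Pi.single S 1) a

theorem intertwiner {k : Fin n} (hk : (k : ℕ) + 1 = lastColLen μ) :
    Intertwiner q t (colData hg).mat (heckeMatrix t) (colData hg).jm
      (tauData hg.t_ne hg.t_pow).jm k (leadMatrix K μ n) where
  heckeX := (colData hg).isHecke hg.t_ne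
  heckeY := by
    have : (heckeMatrix t : Fin n → Matrix (RSYT μ n) (RSYT μ n) K) =
      (tauData hg.t_ne hg.t_pow).mat := funext (heckeMatrix_eq hg.t_ne hg.t_pow)
    rw [this]
    exact (tauData hg.t_ne hg.t_pow).isHecke hg.t_ne
  jmX := (colData hg).mat_jm_mat
  jmY i := by
    rw [heckeMatrix_eq hg.t_ne hg.t_pow]
    exact (tauData hg.t_ne hg.t_pow).mat_jm_mat i
  commX i hi := (colData hg).mat_jm_comm (Fin.castSucc_lt_last i).ne' hi.symm
  lastY := by
    ext S S'
    rw [SeminormalData.jm, Matrix.diagonal_apply, Matrix.one_apply]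
    congr 1
    exact (isCut_of_rsyt S _).cutCont_last (Cell.col_lt _) 1 t
  comm i hi := mat_mul_leadMatrix hg hk hi
  last_e := by
    classical
    ext R S
    rw [SeminormalData.jm, Matrix.diagonal_mul]
    unfold leadMatrix
    split_ifs with h
    · rw [mul_one]
      refine IsCut.cutCont_last (D := μ.rowLen 0 - 1) R.2 ?_ q t
      rw [← not_le, ← h.2, Equiv.apply_symm_apply, Fin.val_last]
      omega
    · rw [mul_zero]
  jm_e := by
    classical
    ext R S
    rw [SeminormalData.jm, Matrix.diagonal_mul, Matrix.smul_apply, SeminormalData.jm,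
      Matrix.mul_diagonal, smul_eq_mul]
    unfold leadMatrix
    split_ifs with h
    · rw [mul_one, one_mul]
      have h1 : μ.rowLen 0 - 1 ≤ (R.1.symm k.castSucc).1.2 := by
        rw [← h.2, Equiv.apply_symm_apply, Fin.val_castSucc]
        omega
      change cutCont q t (μ.rowLen 0 - 1) (R.1.symm k.castSucc) =
        q * cutCont 1 t (μ.rowLen 0) (S.entry.symm k.castSucc)
      rw [cutCont_whole, h.1, cutCont, if_pos h1]
    · simp

end Intertwine

end LastColumn

/-! ### Squarefree polynomials -/

section Squarefree

variable {μ : YoungDiagram} {n : ℕ} {K : Type*} [Field K]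

/-- The squarefree monomial with the variables in `E`. -/
def sqMono (K : Type*) [Field K] (E : Pattern n) : MvPolynomial (Fin (n + 1)) K :=
  ∏ j, if E j then X j else 1

/-- The vector-valued polynomial with the coefficients `v`. -/
def sqPoly (v : Pattern n → RSYT μ n → K) : VPoly K μ n := fun S => ∑ E, C (v E S) * sqMono K E

theorem swapVars_sqMono (i : Fin n) (E : Pattern n) :
    swapVars i (sqMono K E) = sqMono K (E.swap i) := by
  unfold swapVars sqMono
  rw [map_prod]
  refine Fintype.prod_equiv (Equiv.swap i.castSucc i.succ) _ _ fun j => ?_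
  simp only [Pattern.swap, Equiv.swap_apply_self]
  split_ifs <;> simp

theorem X_sub_X_ne_zero (i : Fin n) :
    (X i.castSucc - X i.succ : MvPolynomial (Fin (n + 1)) K) ≠ 0 := by
  rw [sub_ne_zero]
  exact fun h => (Fin.castSucc_lt_succ (i := i)).ne (X_injective h)

theorem dividedDiff_eq {i : Fin n} {p r : MvPolynomial (Fin (n + 1)) K}
    (h : p - swapVars i p = (X i.castSucc - X i.succ) * r) : dividedDiff i p = r := by
  rw [dividedDiff_spec] at h
  exact mul_left_cancel₀ (X_sub_X_ne_zero i) h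

theorem dividedDiff_sum_C_mul {β : Type*} (s : Finset β) (i : Fin n) (c : β → K)
    (p : β → MvPolynomial (Fin (n + 1)) K) :
    dividedDiff i (∑ b ∈ s, C (c b) * p b) = ∑ b ∈ s, C (c b) * dividedDiff i (p b) := by
  apply dividedDiff_eq
  have : swapVars i (∑ b ∈ s, C (c b) * p b) = ∑ b ∈ s, C (c b) * swapVars i (p b) := by
    simp [swapVars]
  rw [this, ← Finset.sum_sub_distrib, Finset.mul_sum]
  refine Finset.sum_congr rfl fun b _ => ?_
  rw [← mul_sub, dividedDiff_spec]
  ring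

/-- The reason why squarefree polynomials are stable under $\boldsymbol T_i$: $x_ir\mapsto x_{i+1}r$
and $x_{i+1}r\mapsto-x_{i+1}r$, while monomials symmetric in the two variables go to zero. -/
theorem X_mul_dividedDiff_sqMono (i : Fin n) (E : Pattern n) :
    X i.succ * dividedDiff i (sqMono K E) =
      (if (E.swap i).Ascent i then sqMono K (E.swap i) else 0) -
        (if E.Ascent i then sqMono K E else 0) := by
  have hne : (i.castSucc : Fin (n + 1)) ≠ i.succ := (Fin.castSucc_lt_succ).ne
  let r : MvPolynomial (Fin (n + 1)) K :=
    ∏ j ∈ (Finset.univ.erase i.castSucc).erase i.succ, if E j then X j else 1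
  have e : ∀ F : Pattern n, (∀ j, j ≠ i.castSucc → j ≠ i.succ → F j = E j) →
      sqMono K F = (if F i.castSucc then X i.castSucc else 1) *
        ((if F i.succ then X i.succ else 1) * r) := by
    intro F hF
    rw [sqMono, ← Finset.mul_prod_erase _ _ (Finset.mem_univ i.castSucc),
      ← Finset.mul_prod_erase (Finset.univ.erase i.castSucc) _
        (Finset.mem_erase.2 ⟨hne.symm, Finset.mem_univ i.succ⟩)]
    congr 2
    refine Finset.prod_congr rfl fun j hj => ?_
    simp only [Finset.mem_erase, Finset.mem_univ, and_true] at hj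
    rw [hF j hj.2 hj.1]
  have e1 := e E fun _ _ _ => rfl
  have e2 := e (E.swap i) fun j h1 h2 => Pattern.swap_of_ne h1 h2
  rw [Pattern.swap_castSucc, Pattern.swap_succ] at e2
  have hd : ∀ s, sqMono K E - sqMono K (E.swap i) = (X i.castSucc - X i.succ) * s →
      dividedDiff i (sqMono K E) = s := fun s hs =>
    dividedDiff_eq (by rw [swapVars_sqMono, hs])
  have a1 : (E.swap i).Ascent i ↔ E i.succ = false ∧ E i.castSucc = true := by
    rw [Pattern.Ascent, Pattern.swap_castSucc, Pattern.swap_succ]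
  have a2 : E.Ascent i ↔ E i.castSucc = false ∧ E i.succ = true := Iff.rfl
  simp only [a1, a2]
  rw [e1, e2] at hd ⊢
  cases h1 : E i.castSucc <;> cases h2 : E i.succ <;>
    simp only [h1, h2, if_true, if_false, Bool.false_eq_true, reduceCtorEq, and_self, and_true,
      and_false, one_mul, sub_self, sub_zero, zero_sub] at hd ⊢
  · rw [hd 0 (by ring)]; ring
  · rw [hd (-r) (by ring)]; ring
  · rw [hd r (by ring)]
  · rw [hd 0 (by ring)]; ring

/-- The generator `𝐓_i` on the coefficients of a squarefree polynomial. -/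
def coeffT (t : K) (i : Fin n) (v : Pattern n → RSYT μ n → K) (E : Pattern n) : RSYT μ n → K :=
  Matrix.vecMul (v (E.swap i)) (heckeMatrix t i) +
    if E.Ascent i then (1 - t) • (v (E.swap i) - v E) else 0

theorem sum_swap {M : Type*} [AddCommMonoid M] (i : Fin n) (f : Pattern n → M) :
    ∑ E : Pattern n, f (E.swap i) = ∑ E, f E :=
  Fintype.sum_bijective (Pattern.swap i)
    (Function.Involutive.bijective (Pattern.swap_swap i)) _ _ fun _ => rfl

theorem opT_sqPoly (t : K) (i : Fin n) (v : Pattern n → RSYT μ n → K) :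
    opT t i (sqPoly v) = sqPoly (coeffT t i v) := by
  classical
  funext S
  unfold opT sqPoly
  have h1 : ∑ S', C (heckeMatrix t i S' S) * swapVars i (∑ E, C (v E S') * sqMono K E) =
      ∑ E : Pattern n, C (Matrix.vecMul (v (E.swap i)) (heckeMatrix t i) S) * sqMono K E := by
    have : ∀ S', swapVars i (∑ E, C (v E S') * sqMono K E) =
        ∑ E : Pattern n, C (v (E.swap i) S') * sqMono K E := by
      intro S'
      rw [← sum_swap i fun E : Pattern n => C (v (E.swap i) S') * sqMono K E]
      simp only [Pattern.swap_swap, ← swapVars_sqMono]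
      simp [swapVars]
    simp only [this, Finset.mul_sum]
    rw [Finset.sum_comm]
    refine Finset.sum_congr rfl fun E _ => ?_
    simp only [Matrix.vecMul, dotProduct, map_sum, map_mul, Finset.sum_mul]
    exact Finset.sum_congr rfl fun S' _ => by ring
  have h2 : C (1 - t) * X i.succ * dividedDiff i (∑ E, C (v E S) * sqMono K E) =
      ∑ E : Pattern n, C ((if E.Ascent i then (1 - t) • (v (E.swap i) - v E) else 0) S) *
        sqMono K E := by
    rw [dividedDiff_sum_C_mul, Finset.mul_sum]
    have : ∀ E : Pattern n, C (1 - t) * X i.succ * (C (v E S) * dividedDiff i (sqMono K E)) =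
        C (1 - t) * C (v E S) * (if (E.swap i).Ascent i then sqMono K (E.swap i) else 0) -
        C (1 - t) * C (v E S) * (if E.Ascent i then sqMono K E else 0) := by
      intro E
      rw [← mul_sub, ← X_mul_dividedDiff_sqMono]
      ring
    simp only [this]
    rw [Finset.sum_sub_distrib, ← sum_swap i, ← Finset.sum_sub_distrib]
    refine Finset.sum_congr rfl fun E _ => ?_
    rw [Pattern.swap_swap]
    split_ifs
    · simp only [Pi.smul_apply, Pi.sub_apply, smul_eq_mul, map_mul, map_sub]
      ring
    · simp
  rw [h1, h2, ← Finset.sum_add_distrib]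
  refine Finset.sum_congr rfl fun E _ => ?_
  rw [← add_mul, ← C_add, coeffT, Pi.add_apply, add_comm (Matrix.vecMul _ _ S)]

theorem cyc_injective : Function.Injective (Pattern.cyc (n := n)) := by
  intro E F h
  have h0 := congrFun h 0
  simp only [Pattern.cyc, Fin.cons_zero] at h0
  funext j
  refine Fin.lastCases h0 (fun j => ?_) j
  have := congrFun h j.succ
  simpa [Pattern.cyc] using this

theorem shiftVars_sqMono_cyc (q : K) (E : Pattern n) :
    shiftVars q (sqMono K E.cyc) = C (if E (Fin.last n) then q else 1) * sqMono K E := by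
  unfold sqMono shiftVars
  rw [map_prod, Fin.prod_univ_succ, Fin.prod_univ_castSucc]
  have h1 : ∀ j : Fin n, (aeval (R := K) (Fin.cons (C q * X (Fin.last n)) fun k : Fin n =>
      (X k.castSucc : MvPolynomial (Fin (n + 1)) K) : Fin (n + 1) → _)) (if E.cyc j.succ then X j.succ else 1) =
      if E j.castSucc then X j.castSucc else (1 : MvPolynomial (Fin (n + 1)) K) := by
    intro j
    simp only [Pattern.cyc, Fin.cons_succ]
    split_ifs <;> simp
  simp only [h1]
  simp only [Pattern.cyc, Fin.cons_zero]
  split_ifs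
  · simp; ring
  · simp

/-- The operator `𝐰` on the coefficients of a squarefree polynomial. -/
def coeffW (q t : K) (v : Pattern n → RSYT μ n → K) (E : Pattern n) : RSYT μ n → K :=
  (if E (Fin.last n) then q else 1) • Matrix.vecMul (v E.cyc) (omegaMatrix t)

theorem opW_sqPoly (q t : K) (v : Pattern n → RSYT μ n → K) :
    opW q t (sqPoly v) = sqPoly (coeffW q t v) := by
  funext S
  unfold opW sqPoly
  have h1 : ∀ S', shiftVars q (∑ E, C (v E S') * sqMono K E) =
      ∑ E : Pattern n, C ((if E (Fin.last n) then q else 1) * v E.cyc S') * sqMono K E := by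
    intro S'
    rw [← Fintype.sum_bijective Pattern.cyc
      (Finite.injective_iff_bijective.1 cyc_injective)
      (fun E => C (v E.cyc S') * sqMono K E.cyc) _ fun _ => rfl, map_sum]
    refine Finset.sum_congr rfl fun E _ => ?_
    rw [map_mul, shiftVars_sqMono_cyc, map_mul, ← algebraMap_eq, AlgHom.commutes]
    ring
  simp only [h1, Finset.mul_sum]
  rw [Finset.sum_comm]
  refine Finset.sum_congr rfl fun E _ => ?_
  simp only [coeffW, Pi.smul_apply, smul_eq_mul, Matrix.vecMul, dotProduct, map_sum, map_mul,
    Finset.sum_mul, Finset.mul_sum]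
  exact Finset.sum_congr rfl fun S' _ => by ring

theorem sqPoly_add (v w : Pattern n → RSYT μ n → K) : sqPoly (v + w) = sqPoly v + sqPoly w := by
  funext S
  simp only [sqPoly, Pi.add_apply, map_add, add_mul, Finset.sum_add_distrib]

theorem sqPoly_smul (c : K) (v : Pattern n → RSYT μ n → K) :
    sqPoly (c • v) = c • sqPoly v := by
  funext S
  simp only [sqPoly, Pi.smul_apply, smul_eq_mul, map_mul, mul_assoc, Finset.smul_sum,
    MvPolynomial.smul_eq_C_mul]

/-- The exponent of the squarefree monomial with the variables in `E`. -/
def sqExp (E : Pattern n) : Fin (n + 1) →₀ ℕ :=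
  Finsupp.equivFunOnFinite.symm fun j => if E j then 1 else 0

theorem sqExp_injective : Function.Injective (sqExp (n := n)) := by
  intro E F h
  have := Finsupp.equivFunOnFinite.symm.injective h
  funext j
  have hj := congrFun this j
  cases h1 : E j <;> cases h2 : F j <;> simp_all

theorem sqMono_eq (E : Pattern n) : sqMono K E = monomial (sqExp E) 1 := by
  rw [monomial_eq, sqMono, Finsupp.prod_fintype _ _ (by simp), C_1, one_mul]
  refine Finset.prod_congr rfl fun j _ => ?_
  simp only [sqExp, Finsupp.equivFunOnFinite_symm_apply_apply]
  split_ifs <;> simp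

theorem coeff_sqPoly (v : Pattern n → RSYT μ n → K) (S : RSYT μ n) (β : Fin (n + 1) →₀ ℕ) :
    coeff β (sqPoly v S) = ∑ E, if sqExp E = β then v E S else 0 := by
  classical
  simp only [sqPoly, sqMono_eq, coeff_sum, coeff_C_mul, coeff_monomial, mul_ite, mul_one, mul_zero]

theorem coeff_sqPoly_sqExp (v : Pattern n → RSYT μ n → K) (S : RSYT μ n) (E : Pattern n) :
    coeff (sqExp E) (sqPoly v S) = v E S := by
  rw [coeff_sqPoly, Finset.sum_eq_single E]
  · simp
  · intro F _ hF
    rw [if_neg fun h => hF (sqExp_injective h)]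
  · simp

theorem sqPoly_injective : Function.Injective (sqPoly (K := K) (μ := μ) (n := n)) := by
  intro v w h
  funext E S
  rw [← coeff_sqPoly_sqExp v, h, coeff_sqPoly_sqExp]

theorem exists_eq_sqPoly (f : VPoly K μ n)
    (hf : ∀ β S, coeff β (f S) ≠ 0 → ∀ j, β j ≤ 1) :
    ∃ v, f = sqPoly v := by
  refine ⟨fun E S => coeff (sqExp E) (f S), ?_⟩
  funext S
  ext β
  by_cases h : ∃ E, sqExp E = β
  · obtain ⟨E, rfl⟩ := h
    rw [coeff_sqPoly_sqExp]
  · have h1 : coeff β (f S) = 0 := by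
      by_contra hne
      have h2 := hf β S hne
      refine h ⟨fun j => decide (β j = 1), ?_⟩
      ext j
      have := h2 j
      simp only [sqExp, Finsupp.equivFunOnFinite_symm_apply_apply, decide_eq_true_eq]
      split_ifs <;> omega
    push Not at h
    rw [h1, coeff_sqPoly]
    exact (Finset.sum_eq_zero fun E _ => if_neg (h E)).symm

end Squarefree

/-! ### The operators `ξ_i` through words -/

section Words

variable {μ : YoungDiagram} {n : ℕ} {K : Type*} [Field K]

theorem finRange_filter_lt (i : Fin n) :
    (List.finRange n).filter (fun k => decide (k.castSucc < i.succ)) =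
      (List.finRange n).filter (fun k => decide (k.castSucc < i.castSucc)) ++ [i] := by
  refine List.Perm.eq_of_pairwise (le := (· < ·)) (fun a b _ _ h1 h2 => absurd h1 h2.asymm) ?_ ?_ ?_
  · exact (List.pairwise_lt_finRange n).filter _
  · rw [List.pairwise_append]
    refine ⟨(List.pairwise_lt_finRange n).filter _, List.pairwise_singleton _ _, ?_⟩
    intro a ha b hb
    simp only [List.mem_filter, List.mem_finRange, true_and, decide_eq_true_eq,
      List.mem_singleton] at ha hb
    subst hb
    simpa using ha
  · rw [List.perm_ext_iff_of_nodup]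
    · intro a
      simp only [List.mem_filter, List.mem_finRange, true_and, decide_eq_true_eq,
        List.mem_append, List.mem_singleton, Fin.castSucc_lt_succ_iff, Fin.castSucc_lt_castSucc_iff]
      exact le_iff_lt_or_eq
    · exact (List.nodup_finRange n).filter _
    · refine List.Nodup.append ((List.nodup_finRange n).filter _) (List.nodup_singleton _) ?_
      simp [List.disjoint_singleton]

theorem finRange_filter_le (i : Fin n) :
    (List.finRange n).filter (fun k => decide (i.castSucc ≤ k.castSucc)) =
      i :: (List.finRange n).filter (fun k => decide (i.succ ≤ k.castSucc)) := by
  refine List.Perm.eq_of_pairwise (le := (· < ·)) (fun a b _ _ h1 h2 => absurd h1 h2.asymm) ?_ ?_ ?_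
  · exact (List.pairwise_lt_finRange n).filter _
  · rw [List.pairwise_cons]
    refine ⟨?_, (List.pairwise_lt_finRange n).filter _⟩
    intro a ha
    simpa [Fin.succ_le_castSucc_iff] using ha
  · rw [List.perm_ext_iff_of_nodup]
    · intro a
      simp only [List.mem_filter, List.mem_finRange, true_and, decide_eq_true_eq,
        List.mem_cons, Fin.succ_le_castSucc_iff, Fin.castSucc_le_castSucc_iff]
      rw [le_iff_lt_or_eq, or_comm, eq_comm]
    · exact (List.nodup_finRange n).filter _
    · rw [List.nodup_cons]
      refine ⟨?_, (List.nodup_finRange n).filter _⟩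
      simp [Fin.succ_le_castSucc_iff]

theorem opXi_last (q t : K) (f : VPoly K μ n) :
    opXi q t (Fin.last n) f =
      opW q t ((List.finRange n).reverse.foldl (fun h k => opTinv t k h) f) := by
  have h1 : (List.finRange n).reverse.filter (fun k => decide (k.castSucc < Fin.last n)) =
      (List.finRange n).reverse := by
    rw [List.filter_eq_self]
    intro a _
    simp [Fin.castSucc_lt_last]
  have h2 : (List.finRange n).reverse.filter (fun k => decide (Fin.last n ≤ k.castSucc)) = [] := by
    rw [List.filter_eq_nil_iff]
    intro a _
    simp
  simp only [opXi]
  rw [h1, h2]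
  simp

theorem opT_smul (t : K) (i : Fin n) (c : K) (f : VPoly K μ n) :
    opT t i (c • f) = c • opT t i f := by
  have h1 : ∀ p : MvPolynomial (Fin (n + 1)) K,
      dividedDiff i (c • p) = c • dividedDiff i p := by
    intro p
    apply dividedDiff_eq
    have : swapVars i (c • p) = c • swapVars i p := by
      simp [swapVars, MvPolynomial.smul_eq_C_mul]
    rw [this, ← smul_sub, dividedDiff_spec, mul_smul_comm]
  have h2 : ∀ p : MvPolynomial (Fin (n + 1)) K, swapVars i (c • p) = c • swapVars i p := by
    intro p
    simp [swapVars, MvPolynomial.smul_eq_C_mul]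
  funext S
  simp only [opT, Pi.smul_apply, h1, h2, mul_smul_comm, smul_add, Finset.smul_sum]

/-- The word of $\boldsymbol\xi_{i+1}$ begins with one more inverse, which cancels against
$\boldsymbol T_i$. That cancellation is assumed only at `f`, since it is known for the image
polynomials (`opTinv_opT_imagePoly`). -/
theorem opXi_castSucc {q t : K} (ht : t ≠ 0) (i : Fin n) (f : VPoly K μ n)
    (hf : opTinv t i (opT t i f) = f) :
    opXi q t i.castSucc f = t⁻¹ • opT t i (opXi q t i.succ (opT t i f)) := by
  simp only [opXi, List.filter_reverse]
  rw [finRange_filter_lt, finRange_filter_le, List.reverse_append, List.reverse_cons]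
  simp only [List.foldl_append, List.reverse_singleton, List.foldl_cons, List.foldl_nil]
  rw [hf, opT_smul, smul_smul]
  congr 1
  rw [Fin.val_succ, Fin.val_castSucc, ← zpow_neg_one, ← zpow_add₀ ht]
  congr 1
  push_cast
  ring

end Words

/-! ### The images of the cut tableaux -/

section Image

variable {μ : YoungDiagram} {n : ℕ} {K ι : Type*} [Field K] [Fintype ι]
  {q t : K} {X : Fin n → Matrix ι ι K} {DX : Fin (n + 1) → Matrix ι ι K}
  {DY : Fin (n + 1) → Matrix (RSYT μ n) (RSYT μ n) K} {k : Fin n}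
  {e : Matrix ι (RSYT μ n) K}

/-- The polynomial that corresponds to the vector `u`. -/
def imagePoly (t : K) (X : Fin n → Matrix ι ι K) (m : ℕ) (e : Matrix ι (RSYT μ n) K)
    (u : ι → K) : VPoly K μ n :=
  sqPoly fun E => Matrix.vecMul u (coeffFam t X (heckeMatrix t) m e E)

theorem imagePoly_add (m : ℕ) (u w : ι → K) :
    imagePoly t X m e (u + w) = imagePoly t X m e u + imagePoly t X m e w := by
  rw [imagePoly, imagePoly, imagePoly, ← sqPoly_add]
  congr 1
  funext E
  rw [Matrix.add_vecMul]
  rfl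

theorem imagePoly_smul (m : ℕ) (c : K) (u : ι → K) :
    imagePoly t X m e (c • u) = c • imagePoly t X m e u := by
  rw [imagePoly, imagePoly, ← sqPoly_smul]
  congr 1
  funext E
  rw [Matrix.smul_vecMul]
  rfl

variable [DecidableEq ι] (d : Intertwiner q t X (heckeMatrix t) DX DY k e)
include d

/-- Compare coefficients at `E`. Equal entries at the two places are `coeffFam_eq`; a descent is the
recursion itself; an ascent is the recursion with the quadratic relation. -/
theorem opT_imagePoly (i : Fin n) (u : ι → K) :
    opT t i (imagePoly t X (k + 1) e u) = imagePoly t X (k + 1) e (Matrix.vecMul u (X i)) := by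
  rw [imagePoly, opT_sqPoly, imagePoly]
  congr 1
  funext E
  rw [coeffT, Matrix.vecMul_vecMul, Matrix.vecMul_vecMul]
  cases h1 : E i.castSucc <;> cases h2 : E i.succ
  · have hs : E.swap i = E := by
      funext j
      by_cases hj1 : j = i.castSucc
      · subst hj1; rw [Pattern.swap_castSucc, h1, h2]
      · by_cases hj2 : j = i.succ
        · subst hj2; rw [Pattern.swap_succ, h1, h2]
        · rw [Pattern.swap_of_ne hj1 hj2]
    rw [if_neg (by simp [Pattern.Ascent, h2]), add_zero, hs,
      d.coeffFam_eq E (h1.trans h2.symm)]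
  · have hasc : E.Ascent i := ⟨h1, h2⟩
    rw [if_pos hasc, ← Matrix.vecMul_sub, ← Matrix.vecMul_smul, ← Matrix.vecMul_add]
    congr 1
    have h3 := d.coeffFam_ascent (m := k + 1) E hasc
    set F := coeffFam t X (heckeMatrix t) (k + 1) e (E.swap i)
    have h4 : t • heckeInv t (heckeMatrix t) i =
        (heckeMatrix t i + (1 - t) • 1 : Matrix (RSYT μ n) (RSYT μ n) K) := by
      rw [heckeInv, smul_smul, mul_inv_cancel₀ d.heckeX.t_ne, one_smul]
    have h5 : X i * coeffFam t X (heckeMatrix t) (k + 1) e E =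
        (t - 1) • coeffFam t X (heckeMatrix t) (k + 1) e E +
          F * (t • heckeInv t (heckeMatrix t) i : Matrix (RSYT μ n) (RSYT μ n) K) := by
      rw [h3, ← Matrix.mul_assoc, ← Matrix.mul_assoc, d.heckeX.sq, Matrix.add_mul, Matrix.add_mul]
      simp only [Matrix.smul_mul, Matrix.one_mul, Matrix.mul_smul, Matrix.mul_assoc]
    rw [h5, h4, Matrix.mul_add, Matrix.mul_smul, Matrix.mul_one]
    module
  · have hasc : (E.swap i).Ascent i := ⟨by simp [h2], by simp [h1]⟩
    rw [if_neg (by simp [Pattern.Ascent, h2]), add_zero, d.coeffFam_ascent _ hasc,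
      Pattern.swap_swap, Matrix.mul_assoc, d.heckeY.inv_mul, Matrix.mul_one]
  · have hs : E.swap i = E := by
      funext j
      by_cases hj1 : j = i.castSucc
      · subst hj1; rw [Pattern.swap_castSucc, h1, h2]
      · by_cases hj2 : j = i.succ
        · subst hj2; rw [Pattern.swap_succ, h1, h2]
        · rw [Pattern.swap_of_ne hj1 hj2]
    rw [if_neg (by simp [Pattern.Ascent, h1]), add_zero, hs,
      d.coeffFam_eq E (h1.trans h2.symm)]

theorem opTinv_imagePoly (i : Fin n) (u : ι → K) :
    opTinv t i (imagePoly t X (k + 1) e u) =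
      imagePoly t X (k + 1) e (Matrix.vecMul u (heckeInv t X i)) := by
  rw [opTinv, opT_imagePoly d, heckeInv, Matrix.vecMul_smul, Matrix.vecMul_add,
    Matrix.vecMul_smul, Matrix.vecMul_one, imagePoly_smul, imagePoly_add, imagePoly_smul]

theorem opTinv_opT_imagePoly (i : Fin n) (u : ι → K) :
    opTinv t i (opT t i (imagePoly t X (k + 1) e u)) = imagePoly t X (k + 1) e u := by
  rw [opT_imagePoly d, opTinv_imagePoly d, Matrix.vecMul_vecMul, d.heckeX.mul_inv,
    Matrix.vecMul_one]

theorem opW_imagePoly (u : ι → K) :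
    opW q t (imagePoly t X (k + 1) e u) =
      imagePoly t X (k + 1) e (Matrix.vecMul u (tailProd X 0 * DX (Fin.last n))) := by
  rw [imagePoly, opW_sqPoly, imagePoly]
  congr 1
  funext E
  rw [coeffW, Matrix.vecMul_vecMul, Matrix.vecMul_vecMul, d.cyc_eq, Matrix.vecMul_smul]
  rfl

theorem foldl_opTinv_imagePoly (l : List (Fin n)) (u : ι → K) :
    ∃ u', l.reverse.foldl (fun h k => opTinv t k h) (imagePoly t X (k + 1) e u) =
      imagePoly t X (k + 1) e u' ∧ Matrix.vecMul u' (l.map X).prod = u := by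
  induction l with
  | nil => exact ⟨u, rfl, by simp⟩
  | cons a l ih =>
    obtain ⟨u', h1, h2⟩ := ih
    refine ⟨Matrix.vecMul u' (heckeInv t X a), ?_, ?_⟩
    · rw [List.reverse_cons, List.foldl_append, h1, List.foldl_cons, List.foldl_nil,
        opTinv_imagePoly d]
    · rw [List.map_cons, List.prod_cons, Matrix.vecMul_vecMul, ← mul_assoc, d.heckeX.inv_mul,
        one_mul, h2]

/-- For the last index, the inverses preceding $\boldsymbol w$ cancel the factor $X_1\cdots X_{N-1}$
of `opW_imagePoly` and leave $J_N$. The recursion $X_iJ_{i+1}X_i=tJ_i$ then matches that of the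
$\boldsymbol\xi_i$. -/
theorem opXi_imagePoly (i : Fin (n + 1)) (u : ι → K) :
    opXi q t i (imagePoly t X (k + 1) e u) =
      imagePoly t X (k + 1) e (Matrix.vecMul u (DX i)) := by
  induction i using Fin.reverseInduction generalizing u with
  | last =>
    obtain ⟨u', h1, h2⟩ := foldl_opTinv_imagePoly d (List.finRange n) u
    rw [← List.ofFn_eq_map, ← tailProd_zero] at h2
    rw [opXi_last, h1, opW_imagePoly d, ← Matrix.vecMul_vecMul, h2]
  | cast i ih =>
    rw [opXi_castSucc d.heckeX.t_ne i _ (opTinv_opT_imagePoly d i u),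
      opT_imagePoly d, ih, opT_imagePoly d, Matrix.vecMul_vecMul, Matrix.vecMul_vecMul,
      ← imagePoly_smul, ← Matrix.vecMul_smul, ← Matrix.mul_assoc, d.jmX, smul_smul,
      inv_mul_cancel₀ d.heckeX.t_ne, one_smul]

end Image

/-! ### Uniqueness -/

section Uniqueness

variable {μ : YoungDiagram} {n : ℕ} {K : Type*} [Field K]

section Entries

variable {F : Subfield K} {t : K}

theorem heckeMatrix_mem (ht : t ∈ F) (i : Fin n) (S S' : RSYT μ n) :
    heckeMatrix t i S S' ∈ F := by
  have h1 := F.one_mem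
  have h0 := F.zero_mem
  have hz : ∀ b : ℤ, t ^ b ∈ F := fun b => zpow_mem ht b
  unfold heckeMatrix
  simp only []
  split_ifs <;> first
    | exact h0
    | exact h1
    | exact ht
    | exact F.neg_mem h1
    | exact F.div_mem (F.sub_mem ht h1) (F.sub_mem h1 (hz _))
    | exact F.div_mem (F.mul_mem (hz _) (F.sub_mem ht h1)) (F.sub_mem (hz _) h1)
    | exact F.div_mem (F.mul_mem (F.mul_mem ht (F.sub_mem (hz _) h1)) (F.sub_mem (hz _) h1))
        (pow_mem (F.sub_mem (hz _) h1) 2)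

theorem omegaMatrix_mem (ht : t ∈ F) (S S' : RSYT μ n) : omegaMatrix t S S' ∈ F := by
  unfold omegaMatrix
  generalize hl : List.ofFn (fun i : Fin n => (heckeMatrix t i : Matrix (RSYT μ n) (RSYT μ n) K)) = l
  have h : ∀ A ∈ l, ∀ S S', A S S' ∈ F := by
    intro A hA
    rw [← hl, List.mem_ofFn] at hA
    obtain ⟨i, rfl⟩ := hA
    exact heckeMatrix_mem ht i
  clear hl
  induction l generalizing S S' with
  | nil =>
    rw [List.prod_nil, Matrix.one_apply]
    split_ifs
    exacts [F.one_mem, F.zero_mem]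
  | cons A l ih =>
    rw [List.prod_cons, Matrix.mul_apply]
    exact F.sum_mem fun S'' _ => F.mul_mem (h A List.mem_cons_self _ _)
      (ih _ _ fun B hB => h B (List.mem_cons_of_mem _ hB))

theorem vecMul_mem (U : Submodule F K) {A : Matrix (RSYT μ n) (RSYT μ n) K}
    (hA : ∀ S S', A S S' ∈ F) {w : RSYT μ n → K} (hw : ∀ S, w S ∈ U) (S : RSYT μ n) :
    Matrix.vecMul w A S ∈ U := by
  simp only [Matrix.vecMul, dotProduct]
  refine U.sum_mem fun S' _ => ?_
  rw [mul_comm]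
  exact U.smul_mem (⟨_, hA S' S⟩ : F) (hw S')

theorem mul_mem_of_mem (U : Submodule F K) {c x : K} (hc : c ∈ F) (hx : x ∈ U) : c * x ∈ U :=
  U.smul_mem (⟨c, hc⟩ : F) hx

end Entries

/-- The operator `𝐓_i⁻¹` on the coefficients of a squarefree polynomial. -/
def coeffTinv (t : K) (i : Fin n) (v : Pattern n → RSYT μ n → K) : Pattern n → RSYT μ n → K :=
  t⁻¹ • (coeffT t i v + (1 - t) • v)

theorem opTinv_sqPoly (t : K) (i : Fin n) (v : Pattern n → RSYT μ n → K) :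
    opTinv t i (sqPoly v) = sqPoly (coeffTinv t i v) := by
  rw [opTinv, coeffTinv, opT_sqPoly, sqPoly_smul, sqPoly_add, sqPoly_smul]

variable {F : Subfield K} {t : K} {U : Submodule F K} {j : Fin (n + 1)}

/-- The coefficients of the patterns `E ⊆ {0, …, j}` lie in `U`, and vanish unless `k ∈ E`. -/
def LowerIn (U : Submodule F K) (j k : Fin (n + 1)) (v : Pattern n → RSYT μ n → K) : Prop :=
  ∀ E : Pattern n, (∀ l, E l = true → l ≤ j) → (E k = false → v E = 0) ∧ ∀ S, v E S ∈ U

/-- The coefficients of the patterns `E ∪ {k}` with `E ⊆ {0, …, j - 1}` lie in `U`. -/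
def UpperIn (U : Submodule F K) (j k : Fin (n + 1)) (v : Pattern n → RSYT μ n → K) : Prop :=
  ∀ E : Pattern n, E k = true → (∀ l, l ≠ k → E l = true → l < j) → ∀ S, v E S ∈ U

theorem LowerIn.coeffTinv (ht : t ∈ F) {i : Fin n} (hij : i.succ ≤ j)
    {v : Pattern n → RSYT μ n → K} (hv : LowerIn U j i.succ v) :
    LowerIn U j i.castSucc (coeffTinv t i v) := by
  intro E hE
  have hE' : ∀ l, E.swap i l = true → l ≤ j := by
    intro l hl
    by_cases h1 : l = i.castSucc
    · exact h1 ▸ Fin.castSucc_lt_succ.le.trans hij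
    · by_cases h2 : l = i.succ
      · exact h2 ▸ hij
      · rw [Pattern.swap_of_ne h1 h2] at hl
        exact hE l hl
  constructor
  · intro h
    have h0 : v (E.swap i) = 0 := (hv _ hE').1 (by rw [Pattern.swap_succ, h])
    change t⁻¹ • (coeffT t i v E + (1 - t) • v E) = 0
    rw [coeffT, h0, Matrix.zero_vecMul, zero_add]
    split_ifs with hasc
    -- At an ascent the divided-difference term $-(1-t)v_E$ cancels the correction $(1-t)v_E$ of the
    -- inverse.
    · rw [zero_sub, smul_neg, neg_add_cancel, smul_zero]
    · have : v E = 0 := (hv E hE).1 (by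
        by_contra hne
        exact hasc ⟨h, by simpa using hne⟩)
      simp [this]
  · intro S
    change t⁻¹ * (coeffT t i v E S + (1 - t) * v E S) ∈ U
    have h1 : (1 - t) ∈ F := F.sub_mem F.one_mem ht
    refine mul_mem_of_mem U (F.inv_mem ht) (U.add_mem ?_ (mul_mem_of_mem U h1 ((hv E hE).2 S)))
    rw [coeffT]
    refine U.add_mem (vecMul_mem U (heckeMatrix_mem ht i) (hv _ hE').2 S) ?_
    split_ifs
    · exact mul_mem_of_mem U h1 (U.sub_mem ((hv _ hE').2 S) ((hv E hE).2 S))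
    · exact U.zero_mem

theorem UpperIn.coeffT (ht : t ∈ F) {i : Fin n} (hij : j ≤ i.castSucc)
    {v : Pattern n → RSYT μ n → K} (hv : UpperIn U j i.succ v) :
    UpperIn U j i.castSucc (coeffT t i v) := by
  intro E hk hE S
  have hlt : (i.castSucc : Fin (n + 1)) < i.succ := Fin.castSucc_lt_succ
  have hs : E i.succ = false := by
    by_contra hne
    exact absurd (hE i.succ hlt.ne' (by simpa using hne)) (not_lt.2 (hij.trans hlt.le))
  have h1 : ¬E.Ascent i := fun h => by rw [h.1] at hk; exact absurd hk (by decide)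
  rw [VVMac.coeffT, if_neg h1, add_zero]
  refine vecMul_mem U (heckeMatrix_mem ht i) (hv _ (by rw [Pattern.swap_succ, hk]) ?_) S
  intro l hl hEl
  by_cases h2 : l = i.castSucc
  · subst h2
    rw [Pattern.swap_castSucc, hs] at hEl
    exact absurd hEl (by decide)
  · rw [Pattern.swap_of_ne h2 hl] at hEl
    exact hE l h2 hEl

theorem LowerIn.foldl (ht : t ∈ F) (k : Fin (n + 1)) (hk : k ≤ j)
    {v : Pattern n → RSYT μ n → K} (hv : LowerIn U j k v) :
    ∃ v', ((List.finRange n).filter (fun i => decide (i.castSucc < k))).reverse.foldl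
        (fun h i => opTinv t i h) (sqPoly v) = sqPoly v' ∧ LowerIn U j 0 v' := by
  induction k using Fin.induction generalizing v with
  | zero => exact ⟨v, by simp, hv⟩
  | succ i ih =>
    rw [finRange_filter_lt, List.reverse_append, List.reverse_singleton, List.singleton_append,
      List.foldl_cons, opTinv_sqPoly]
    exact ih (Fin.castSucc_lt_succ.le.trans hk) (hv.coeffTinv ht hk)

theorem UpperIn.foldl (ht : t ∈ F) (k : Fin (n + 1)) (hk : j ≤ k)
    {v : Pattern n → RSYT μ n → K} (hv : UpperIn U j (Fin.last n) v) :
    ∃ v', ((List.finRange n).filter (fun i => decide (k ≤ i.castSucc))).reverse.foldl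
        (fun h i => opT t i h) (sqPoly v) = sqPoly v' ∧ UpperIn U j k v' := by
  induction k using Fin.reverseInduction with
  | last =>
    refine ⟨v, ?_, hv⟩
    have : (List.finRange n).filter (fun i => decide (Fin.last n ≤ i.castSucc)) = [] := by
      rw [List.filter_eq_nil_iff]
      intro a _
      simp
    rw [this]
    rfl
  | cast i ih =>
    obtain ⟨v', h1, h2⟩ := ih (hk.trans Fin.castSucc_lt_succ.le)
    rw [finRange_filter_le, List.reverse_cons, List.foldl_append, h1, List.foldl_cons,
      List.foldl_nil, opT_sqPoly]
    exact ⟨_, rfl, h2.coeffT ht hk⟩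

/-- The multiples by `q` of the elements of `U`. -/
def scaled (U : Submodule F K) (q : K) : Submodule F K := U.map (LinearMap.mulLeft F q)

theorem mul_mem_scaled {q x : K} (hx : x ∈ U) : q * x ∈ scaled U q := ⟨x, hx, rfl⟩

/-- The rotation carries the last place to place `0`, and a monomial containing the last variable
receives the factor $q$. -/
theorem LowerIn.coeffW (ht : t ∈ F) (q : K) {v : Pattern n → RSYT μ n → K}
    (hv : LowerIn U j 0 v) : UpperIn (scaled U q) j (Fin.last n) (coeffW q t v) := by
  intro E hlast hE S
  rw [VVMac.coeffW, if_pos hlast]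
  refine mul_mem_scaled (vecMul_mem U (omegaMatrix_mem ht) (hv E.cyc ?_).2 S)
  intro l
  refine Fin.cases (fun _ => Fin.zero_le _) (fun l hl => ?_) l
  have := hE l.castSucc (Fin.castSucc_lt_last l).ne (by simpa [Pattern.cyc] using hl)
  rw [Fin.le_def, Fin.val_succ]
  exact this

theorem opXi_lowerIn (ht : t ∈ F) (q : K) {v : Pattern n → RSYT μ n → K} (hv : LowerIn U j j v) :
    ∃ v', opXi q t j (sqPoly v) = t ^ ((j : ℤ) - (n : ℤ)) • sqPoly v' ∧
      UpperIn (scaled U q) j j v' := by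
  obtain ⟨v1, h1, h2⟩ := hv.foldl ht j le_rfl
  obtain ⟨v2, h3, h4⟩ := (h2.coeffW ht q).foldl ht j le_rfl
  refine ⟨v2, ?_, h4⟩
  simp only [opXi, List.filter_reverse]
  rw [h1, opW_sqPoly, h3]

/-- Let $U$ be the `F`-span of the coefficients of patterns in $\{0,\dots,j\}$. Only patterns
containing $j$ contribute, and on these $\boldsymbol\xi_j$ lands in $qU$. An eigenvalue in
$F^\times$ gives $U\subseteq qU$; if $U\ne0$, then $q^{-1}$ is integral over `F`, contrary to
transcendence. -/
theorem eq_zero_of_eigen {q : K} (hq : Transcendental F q) (ht : t ∈ F)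
    {c : K} (hc : c ∈ F) (hc0 : c ≠ 0) {v : Pattern n → RSYT μ n → K}
    (h0 : ∀ E : Pattern n, (∀ l, E l = true → l < j) → v E = 0)
    (heig : opXi q t j (sqPoly v) = c • sqPoly v) :
    ∀ E : Pattern n, (∀ l, E l = true → l ≤ j) → v E = 0 := by
  let s : Set K := Set.range fun x : {E : Pattern n // ∀ l, E l = true → l ≤ j} × RSYT μ n =>
    v x.1.1 x.2
  let U : Submodule F K := Submodule.span F s
  have hq0 : q ≠ 0 := fun h => hq (h ▸ isAlgebraic_zero)
  have hmem : ∀ E : Pattern n, (∀ l, E l = true → l ≤ j) → ∀ S, v E S ∈ U := fun E hE S =>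
    Submodule.subset_span ⟨(⟨E, hE⟩, S), rfl⟩
  have hj : ∀ E : Pattern n, (∀ l, E l = true → l ≤ j) → E j = false → v E = 0 := by
    intro E hE hEj
    refine h0 E fun l hl => lt_of_le_of_ne (hE l hl) ?_
    rintro rfl
    rw [hEj] at hl
    exact absurd hl (by decide)
  have hlow : LowerIn U j j v := fun E hE => ⟨hj E hE, hmem E hE⟩
  obtain ⟨v', h1, h2⟩ := opXi_lowerIn ht q hlow
  rw [heig, ← sqPoly_smul, ← sqPoly_smul] at h1
  have h3 := sqPoly_injective h1
  have hle : U ≤ scaled U q := by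
    refine Submodule.span_le.2 ?_
    rintro _ ⟨⟨⟨E, hE⟩, S⟩, rfl⟩
    change v E S ∈ scaled U q
    by_cases hEj : E j = true
    · have h4 : c * v E S = t ^ ((j : ℤ) - (n : ℤ)) * v' E S := congrFun (congrFun h3 E) S
      have h5 : v E S = c⁻¹ * t ^ ((j : ℤ) - (n : ℤ)) * v' E S := by
        rw [mul_assoc, ← h4, inv_mul_cancel_left₀ hc0]
      rw [h5]
      refine mul_mem_of_mem _ (F.mul_mem (F.inv_mem hc) (zpow_mem ht _)) ?_
      exact h2 E hEj (fun l hl hEl => lt_of_le_of_ne (hE l hEl) hl) S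
    · rw [hj E hE (by simpa using hEj)]
      exact Submodule.zero_mem _
  have hinv : ∀ x ∈ U, q⁻¹ • x ∈ U := by
    intro x hx
    obtain ⟨y, hy, rfl⟩ := hle hx
    simpa [hq0] using hy
  by_contra hne
  push Not at hne
  obtain ⟨E, hE, hv⟩ := hne
  obtain ⟨S, hS⟩ := Function.ne_iff.1 hv
  have hfg : U.FG := Submodule.fg_span (Set.finite_range _)
  have := isIntegral_of_smul_mem_submodule U
    (fun h => hS ((Submodule.eq_bot_iff U).1 h _ (hmem E hE S))) hfg q⁻¹ hinv
  exact hq (by simpa using this.isAlgebraic.inv)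

/-- Induction on the bound `k` for the places occurring in a pattern, with one eigenvalue equation
per step. At `k = m` the top pattern is the only one of weight `m`. -/
theorem sqPoly_eq_zero {q : K} (hq : Transcendental F q) (ht : t ∈ F) {m : ℕ} (hm : m ≤ n + 1)
    {v : Pattern n → RSYT μ n → K} (hw : ∀ E : Pattern n, E.weight ≠ m → v E = 0)
    (htop : v (Pattern.top n m) = 0)
    (heig : ∀ j : Fin (n + 1), m ≤ j → ∃ c ∈ F, c ≠ 0 ∧
      opXi q t j (sqPoly v) = c • sqPoly v) : sqPoly v = 0 := by
  have key : ∀ k : ℕ, m ≤ k → k ≤ n + 1 →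
      ∀ E : Pattern n, (∀ l, E l = true → (l : ℕ) < k) → v E = 0 := by
    intro k hk
    induction k, hk using Nat.le_induction with
    | base =>
      intro _ E hE
      by_cases hwt : E.weight = m
      · have h1 : (Finset.univ.filter fun l => E l = true) ⊆
            Finset.univ.filter fun l => Pattern.top n m l = true := by
          intro l hl
          simp only [Finset.mem_filter, Finset.mem_univ, true_and] at hl ⊢
          exact decide_eq_true (hE l hl)
        have h2 := Finset.eq_of_subset_of_card_le h1 (by
          have := Pattern.weight_top (n := n) hm
          unfold Pattern.weight at this hwt
          omega)
        have h3 : E = Pattern.top n m := by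
          funext l
          have := Finset.ext_iff.1 h2 l
          simp only [Finset.mem_filter, Finset.mem_univ, true_and] at this
          rwa [Bool.eq_iff_iff]
        rw [h3, htop]
      · exact hw E hwt
    | succ k hk ih =>
      intro hkn
      obtain ⟨c, hc, hc0, heq⟩ := heig ⟨k, hkn⟩ hk
      have := eq_zero_of_eigen hq ht hc hc0 (ih (by omega)) heq
      intro E hE
      exact this E fun l hl => Nat.lt_succ_iff.1 (hE l hl)
  have : v = 0 := by
    funext E
    exact key (n + 1) hm le_rfl E fun l _ => l.2
  rw [this]
  funext S
  simp [sqPoly]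

end Uniqueness

/-! ### Transcendence of $q$ over $\mathbb Q(t)$. -/

section Transcendence

/-- The field `ℚ(t)` inside `ℚ(q, t)`. -/
def tField : Subfield Qqt := (IntermediateField.adjoin ℚ {tGen}).toSubfield

theorem tGen_mem : tGen ∈ tField := IntermediateField.mem_adjoin_simple_self ℚ tGen

theorem transcendental_qGen : Transcendental tField qGen := by
  have h1 : AlgebraicIndependent ℚ (X : Fin 2 → MvPolynomial (Fin 2) ℚ) :=
    MvPolynomial.algebraicIndependent_X _ _
  have h2 := h1.map' (f := IsScalarTower.toAlgHom ℚ (MvPolynomial (Fin 2) ℚ) Qqt)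
    (IsFractionRing.injective _ _)
  have h3 := h2.transcendental_adjoin (s := {1}) (i := 0) (by simp)
  rw [Set.image_singleton] at h3
  exact IntermediateField.transcendental_adjoin_iff.2 h3

end Transcendence

/-! ### Specialization -/

namespace HasValueAt

variable {L : Type*} [Field L] [CharZero L] {q₀ t₀ : L} {c d : Qqt} {c₀ d₀ : L}

theorem algebraMap_ne_zero_of_aeval {b : MvPolynomial (Fin 2) ℚ} (h : aeval ![q₀, t₀] b ≠ 0) :
    algebraMap _ Qqt b ≠ 0 := by
  intro h'
  rw [map_eq_zero_iff _ (IsFractionRing.injective (MvPolynomial (Fin 2) ℚ) Qqt)] at h'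
  exact h (by rw [h', map_zero])

theorem of_poly (a : MvPolynomial (Fin 2) ℚ) :
    HasValueAt q₀ t₀ (algebraMap _ Qqt a) (aeval ![q₀, t₀] a) :=
  ⟨a, 1, by simp, by simp, by simp⟩

theorem qGen : HasValueAt q₀ t₀ qGen q₀ := by
  simpa [VVMac.qGen] using of_poly (q₀ := q₀) (t₀ := t₀) (X 0)

theorem tGen : HasValueAt q₀ t₀ tGen t₀ := by
  simpa [VVMac.tGen] using of_poly (q₀ := q₀) (t₀ := t₀) (X 1)

theorem zero : HasValueAt q₀ t₀ 0 0 := by simpa using of_poly (q₀ := q₀) (t₀ := t₀) 0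

theorem one : HasValueAt q₀ t₀ 1 1 := by simpa using of_poly (q₀ := q₀) (t₀ := t₀) 1

theorem add (hc : HasValueAt q₀ t₀ c c₀) (hd : HasValueAt q₀ t₀ d d₀) :
    HasValueAt q₀ t₀ (c + d) (c₀ + d₀) := by
  obtain ⟨a, b, hb, rfl, rfl⟩ := hc
  obtain ⟨a', b', hb', rfl, rfl⟩ := hd
  have h1 := algebraMap_ne_zero_of_aeval hb
  have h2 := algebraMap_ne_zero_of_aeval hb'
  refine ⟨a * b' + b * a', b * b', by simp [hb, hb'], ?_, ?_⟩
  · rw [div_add_div _ _ h1 h2, map_add, map_mul, map_mul, map_mul]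
  · rw [div_add_div _ _ hb hb', map_add, map_mul, map_mul, map_mul]

theorem mul (hc : HasValueAt q₀ t₀ c c₀) (hd : HasValueAt q₀ t₀ d d₀) :
    HasValueAt q₀ t₀ (c * d) (c₀ * d₀) := by
  obtain ⟨a, b, hb, rfl, rfl⟩ := hc
  obtain ⟨a', b', hb', rfl, rfl⟩ := hd
  refine ⟨a * a', b * b', by simp [hb, hb'], ?_, ?_⟩
  · rw [div_mul_div_comm, map_mul, map_mul]
  · rw [div_mul_div_comm, map_mul, map_mul]

theorem neg (hc : HasValueAt q₀ t₀ c c₀) : HasValueAt q₀ t₀ (-c) (-c₀) := by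
  obtain ⟨a, b, hb, rfl, rfl⟩ := hc
  exact ⟨-a, b, hb, by rw [map_neg, neg_div], by rw [map_neg, neg_div]⟩

theorem sub (hc : HasValueAt q₀ t₀ c c₀) (hd : HasValueAt q₀ t₀ d d₀) :
    HasValueAt q₀ t₀ (c - d) (c₀ - d₀) := by
  rw [sub_eq_add_neg, sub_eq_add_neg]
  exact hc.add hd.neg

theorem inv (hc : HasValueAt q₀ t₀ c c₀) (h : c₀ ≠ 0) : HasValueAt q₀ t₀ c⁻¹ c₀⁻¹ := by
  obtain ⟨a, b, hb, rfl, rfl⟩ := hc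
  exact ⟨b, a, (div_ne_zero_iff.1 h).1, inv_div _ _, inv_div _ _⟩

theorem div (hc : HasValueAt q₀ t₀ c c₀) (hd : HasValueAt q₀ t₀ d d₀) (h : d₀ ≠ 0) :
    HasValueAt q₀ t₀ (c / d) (c₀ / d₀) := by
  rw [div_eq_mul_inv, div_eq_mul_inv]
  exact hc.mul (hd.inv h)

theorem pow (hc : HasValueAt q₀ t₀ c c₀) (k : ℕ) : HasValueAt q₀ t₀ (c ^ k) (c₀ ^ k) := by
  induction k with
  | zero => simpa using one
  | succ k ih => rw [pow_succ, pow_succ]; exact ih.mul hc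

theorem zpow (hc : HasValueAt q₀ t₀ c c₀) (h : c₀ ≠ 0) (k : ℤ) :
    HasValueAt q₀ t₀ (c ^ k) (c₀ ^ k) := by
  cases k with
  | ofNat k => simpa using hc.pow k
  | negSucc k => rw [zpow_negSucc, zpow_negSucc]; exact (hc.pow _).inv (pow_ne_zero _ h)

theorem sum {ι : Type*} (s : Finset ι) {f : ι → Qqt} {f₀ : ι → L}
    (h : ∀ i, HasValueAt q₀ t₀ (f i) (f₀ i)) :
    HasValueAt q₀ t₀ (∑ i ∈ s, f i) (∑ i ∈ s, f₀ i) := by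
  classical
  induction s using Finset.induction_on with
  | empty => simpa using zero
  | insert a s ha ih => rw [Finset.sum_insert ha, Finset.sum_insert ha]; exact (h a).add ih

theorem ne_zero (hc : HasValueAt q₀ t₀ c c₀) (h : c₀ ≠ 0) : c ≠ 0 := by
  obtain ⟨a, b, hb, rfl, rfl⟩ := hc
  exact div_ne_zero (algebraMap_ne_zero_of_aeval (div_ne_zero_iff.1 h).1)
    (algebraMap_ne_zero_of_aeval hb)

theorem ne (hc : HasValueAt q₀ t₀ c c₀) (hd : HasValueAt q₀ t₀ d d₀) (h : c₀ ≠ d₀) : c ≠ d :=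
  sub_ne_zero.1 ((hc.sub hd).ne_zero (sub_ne_zero.2 h))

end HasValueAt

section Specialize

variable {L : Type*} [Field L] [CharZero L] {q₀ t₀ : L} {μ : YoungDiagram} {n : ℕ}

/-- Rational functions with different values at a point are different, so genericity lifts from a
specialization. -/
theorem Generic.of_hasValueAt {D : ℕ} (h : Generic μ D q₀ t₀) : Generic μ D qGen tGen := by
  have hq := HasValueAt.qGen (q₀ := q₀) (t₀ := t₀)
  have ht := HasValueAt.tGen (q₀ := q₀) (t₀ := t₀)
  exact ⟨hq.ne_zero h.q_ne, ht.ne_zero h.t_ne, fun k hk => (ht.pow k).ne .one (h.t_pow k hk),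
    fun x y hx hy => (hq.mul (ht.zpow h.t_ne _)).ne (ht.zpow h.t_ne _) (h.sep x y hx hy)⟩

/-- At $q=t^{-h_\tau}$ the exponents in the last column are at most $-\ell(\tau)$, whereas all other
contents are at least $1-\ell(\tau)$. -/
theorem generic_zpow_maxHook {K : Type*} [Field K] {t : K} (ht0 : t ≠ 0)
    (ht : ∀ k : ℕ, 0 < k → t ^ k ≠ 1) :
    Generic μ (μ.rowLen 0 - 1) (t ^ (-(maxHook μ : ℤ))) t where
  q_ne := zpow_ne_zero _ ht0
  t_ne := ht0
  t_pow := ht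
  sep x y hx hy h := by
    rw [← zpow_add₀ ht0] at h
    have h1 := zpow_inj_of_forall_ne ht0 ht h
    have h2 := x.col_lt
    have h3 := x.row_lt
    have h4 := y.row_lt
    unfold maxHook Cell.content at h1
    omega

/-- The entries of the matrix `A` have the values `A₀`. -/
def MatrixHasValueAt {ι κ : Type*} (q₀ t₀ : L) (A : Matrix ι κ Qqt) (A₀ : Matrix ι κ L) : Prop :=
  ∀ i j, HasValueAt q₀ t₀ (A i j) (A₀ i j)

theorem MatrixHasValueAt.mul {ι κ ν : Type*} [Fintype κ] {A : Matrix ι κ Qqt} {A₀ : Matrix ι κ L}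
    {B : Matrix κ ν Qqt} {B₀ : Matrix κ ν L} (hA : MatrixHasValueAt q₀ t₀ A A₀)
    (hB : MatrixHasValueAt q₀ t₀ B B₀) : MatrixHasValueAt q₀ t₀ (A * B) (A₀ * B₀) := fun i j => by
  rw [Matrix.mul_apply, Matrix.mul_apply]
  exact HasValueAt.sum _ fun l => (hA i l).mul (hB l j)

theorem MatrixHasValueAt.heckeInv {κ : Type*} [DecidableEq κ] (ht0 : t₀ ≠ 0)
    {Y : Fin n → Matrix κ κ Qqt} {Y₀ : Fin n → Matrix κ κ L}
    (hY : ∀ i, MatrixHasValueAt q₀ t₀ (Y i) (Y₀ i)) (i : Fin n) :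
    MatrixHasValueAt q₀ t₀ (heckeInv tGen Y i) (heckeInv t₀ Y₀ i) := fun a b => by
  have h1 : HasValueAt q₀ t₀ ((1 : Matrix κ κ Qqt) a b) ((1 : Matrix κ κ L) a b) := by
    rw [Matrix.one_apply, Matrix.one_apply]
    split_ifs
    exacts [.one, .zero]
  exact (HasValueAt.tGen.inv ht0).mul ((hY i a b).add ((HasValueAt.one.sub .tGen).mul h1))

theorem coeffFam_of_ascent {K ι κ : Type*} [Field K] [Fintype ι] [Fintype κ] [DecidableEq κ]
    (t : K) (X : Fin n → Matrix ι ι K) (Y : Fin n → Matrix κ κ K) (m : ℕ) (e : Matrix ι κ K)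
    {E : Pattern n} (h : ∃ i, E.Ascent i) :
    coeffFam t X Y m e E =
      X h.choose * coeffFam t X Y m e (E.swap h.choose) * heckeInv t Y h.choose := by
  rw [coeffFam, dif_pos h]

theorem MatrixHasValueAt.coeffFam {ι κ : Type*} [Fintype ι] [Fintype κ]
    [DecidableEq κ] (ht0 : t₀ ≠ 0)
    {X : Fin n → Matrix ι ι Qqt} {X₀ : Fin n → Matrix ι ι L}
    {Y : Fin n → Matrix κ κ Qqt} {Y₀ : Fin n → Matrix κ κ L}
    {e : Matrix ι κ Qqt} {e₀ : Matrix ι κ L}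
    (hX : ∀ i, MatrixHasValueAt q₀ t₀ (X i) (X₀ i))
    (hY : ∀ i, MatrixHasValueAt q₀ t₀ (Y i) (Y₀ i))
    (he : MatrixHasValueAt q₀ t₀ e e₀) (m : ℕ) (E : Pattern n) :
    MatrixHasValueAt q₀ t₀ (coeffFam tGen X Y m e E) (coeffFam t₀ X₀ Y₀ m e₀ E) := by
  induction hp : E.pos using Nat.strong_induction_on generalizing E with
  | _ p ih =>
    by_cases h : ∃ i, E.Ascent i
    -- The chosen ascent depends only on `E`, so it is the same over both fields.
    · rw [coeffFam_of_ascent _ _ _ _ _ h, coeffFam_of_ascent _ _ _ _ _ h]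
      exact ((hX _).mul (ih _ (hp ▸ Pattern.pos_swap_lt h.choose_spec) _ rfl)).mul
        (MatrixHasValueAt.heckeInv ht0 hY _)
    · rw [VVMac.coeffFam, VVMac.coeffFam, dif_neg h, dif_neg h]
      split_ifs
      · exact he
      · exact fun _ _ => .zero

variable {D : ℕ} {q t : Qqt} {q' t' : L}

theorem HasValueAt.diagCoeff {x y : Qqt} {x₀ y₀ : L} (ht : HasValueAt q₀ t₀ t t')
    (hx : HasValueAt q₀ t₀ x x₀) (hy : HasValueAt q₀ t₀ y y₀) (h : x₀ ≠ y₀) :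
    HasValueAt q₀ t₀ (diagCoeff t x y) (diagCoeff t' x₀ y₀) :=
  ((ht.sub .one).mul hx).div (hx.sub hy) (sub_ne_zero.2 h)

theorem HasValueAt.offProd {x y : Qqt} {x₀ y₀ : L} (ht : HasValueAt q₀ t₀ t t')
    (hx : HasValueAt q₀ t₀ x x₀) (hy : HasValueAt q₀ t₀ y y₀) (h : x₀ ≠ y₀) :
    HasValueAt q₀ t₀ (offProd t x y) (offProd t' x₀ y₀) :=
  (((ht.mul hx).sub hy).mul (hx.sub (ht.mul hy))).div ((hx.sub hy).pow 2)
    (pow_ne_zero 2 (sub_ne_zero.2 h))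

theorem HasValueAt.cutCont (hq : HasValueAt q₀ t₀ q q') (ht : HasValueAt q₀ t₀ t t')
    (ht0 : t' ≠ 0) (x : Cell μ) : HasValueAt q₀ t₀ (cutCont q t D x) (cutCont q' t' D x) := by
  unfold VVMac.cutCont
  refine HasValueAt.mul ?_ (ht.zpow ht0 _)
  split_ifs
  exacts [hq, .one]

theorem HasValueAt.cutCoef (hq : HasValueAt q₀ t₀ q q') (ht : HasValueAt q₀ t₀ t t')
    (ht0 : t' ≠ 0) {x y : Cell μ} (h : VVMac.cutCont q' t' D x ≠ VVMac.cutCont q' t' D y) :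
    HasValueAt q₀ t₀ (cutCoef q t D x y) (cutCoef q' t' D x y) := by
  have h1 := ht.offProd (hq.cutCont (D := D) ht ht0 x) (hq.cutCont (D := D) ht ht0 y) h
  unfold VVMac.cutCoef
  split_ifs
  exacts [.one, h1, .zero, h1, .one]

theorem MatrixHasValueAt.cutData_mat {ι : Type*} (hg : Generic μ D q t) (hg' : Generic μ D q' t')
    (hq : HasValueAt q₀ t₀ q q') (ht : HasValueAt q₀ t₀ t t')
    (fill : ι → (Cell μ ≃ Fin (n + 1))) (hinj : Function.Injective fill)
    (hfill : ∀ R, (∃ a, fill a = R) ↔ IsCut D R) (i : Fin n) :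
    MatrixHasValueAt q₀ t₀ ((cutData hg fill hinj hfill).mat i)
      ((cutData hg' fill hinj hfill).mat i) := by
  classical
  intro a b
  have hne := (cutData hg' fill hinj hfill).cont_ne_succ a i
  unfold SeminormalData.mat
  by_cases h1 : b = a
  · rw [if_pos h1, if_pos h1]
    exact ht.diagCoeff (hq.cutCont ht hg'.t_ne _) (hq.cutCont ht hg'.t_ne _) hne
  · rw [if_neg h1, if_neg h1]
    by_cases h2 : (cutData hg fill hinj hfill).fill b = exch i ((cutData hg fill hinj hfill).fill a)
    · have h3 : (cutData hg' fill hinj hfill).fill b =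
        exch i ((cutData hg' fill hinj hfill).fill a) := h2
      rw [if_pos h2, if_pos h3]
      exact hq.cutCoef ht hg'.t_ne hne
    · have h3 : (cutData hg' fill hinj hfill).fill b ≠
        exch i ((cutData hg' fill hinj hfill).fill a) := h2
      rw [if_neg h2, if_neg h3]
      exact .zero

theorem MatrixHasValueAt.heckeMatrix (ht0 : t₀ ≠ 0) (ht : ∀ k : ℕ, 0 < k → t₀ ^ k ≠ 1)
    (i : Fin n) :
    MatrixHasValueAt q₀ t₀ (heckeMatrix tGen i : Matrix (RSYT μ n) (RSYT μ n) Qqt)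
      (heckeMatrix t₀ i) := by
  have hv := HasValueAt.tGen (q₀ := q₀) (t₀ := t₀)
  have ht0' := hv.ne_zero ht0
  have ht' : ∀ k : ℕ, 0 < k → VVMac.tGen ^ k ≠ 1 := fun k hk => (hv.pow k).ne .one (ht k hk)
  rw [heckeMatrix_eq ht0 ht, heckeMatrix_eq ht0' ht']
  exact MatrixHasValueAt.cutData_mat _ _ .one hv _ _ _ i

/-- The only denominators are differences of contents and powers of $t$, all nonzero at a generic
point. -/
theorem specializesTo_imagePoly (h : Generic μ (μ.rowLen 0 - 1) q₀ t₀) (m : ℕ)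
    {u : CutTableau μ n → Qqt} {u₀ : CutTableau μ n → L}
    (hu : ∀ R, HasValueAt q₀ t₀ (u R) (u₀ R)) :
    SpecializesTo q₀ t₀
      (imagePoly tGen (colData h.of_hasValueAt).mat m (leadMatrix Qqt μ n) u)
      (imagePoly t₀ (colData h).mat m (leadMatrix L μ n) u₀) := by
  intro S β
  unfold imagePoly
  rw [coeff_sqPoly, coeff_sqPoly]
  refine HasValueAt.sum _ fun E => ?_
  split_ifs
  · refine HasValueAt.sum _ fun R => (hu R).mul ?_
    refine MatrixHasValueAt.coeffFam h.t_ne (fun i => ?_)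
      (MatrixHasValueAt.heckeMatrix h.t_ne h.t_pow) ?_ m E R S
    · exact MatrixHasValueAt.cutData_mat _ _ .qGen .tGen _ _ _ i
    · intro R S
      unfold leadMatrix
      split_ifs
      exacts [.one, .zero]
  · exact .zero

end Specialize

/-! ### Compositions with parts `0` and `1` -/

section Compositions

variable {n : ℕ}

theorem decr_antitone (α : Fin (n + 1) → ℕ) : Antitone (decr α) := fun _ _ h =>
  Tuple.monotone_sort α (Fin.rev_le_rev.2 h)

theorem decr_eq_comp (α : Fin (n + 1) → ℕ) :
    decr α = α ∘ (Fin.revPerm.trans (Tuple.sort α) : Equiv.Perm (Fin (n + 1))) := rfl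

theorem decr_of_antitone {α : Fin (n + 1) → ℕ} (h : Antitone α) : decr α = α := by
  rw [decr_eq_comp]
  exact Tuple.unique_antitone (τ := Equiv.refl _) (decr_antitone α) h

theorem inv_of_antitone {α : Fin (n + 1) → ℕ} (h : Antitone α) : inv α = 0 := by
  rw [inv, Finset.card_eq_zero, Finset.filter_eq_empty_iff]
  rintro p - ⟨h1, h2⟩
  exact absurd (h h1.le) (not_le.2 h2)

theorem rank_of_antitone {α : Fin (n + 1) → ℕ} (h : Antitone α) (i : Fin (n + 1)) :
    rank α i = i := by
  have hd : Disjoint (Finset.univ.filter fun j => α i < α j)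
      (Finset.univ.filter fun j => j < i ∧ α j = α i) := by
    rw [Finset.disjoint_filter]
    rintro j - h1 ⟨-, h2⟩
    omega
  ext
  change _ + _ = _
  rw [← Finset.card_union_of_disjoint hd, ← Fin.card_Iio i]
  congr 1
  ext j
  simp only [Finset.mem_union, Finset.mem_filter, Finset.mem_univ, true_and, Finset.mem_Iio]
  constructor
  · rintro (h1 | h1)
    · by_contra h2
      exact absurd (h (not_lt.1 h2)) (not_le.2 h1)
    · exact h1.1
  · intro h1
    rcases (h h1.le).lt_or_eq with h2 | h2
    exacts [Or.inl h2, Or.inr ⟨h1, h2.symm⟩]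

theorem Above.apply_le {α β : Fin (n + 1) → ℕ} (h : Above α β) (j : Fin (n + 1)) :
    β j ≤ decr α 0 := by
  have h1 : decr β 0 ≤ decr α 0 := by
    rcases h.2 with h2 | h2
    · have h3 : Finset.Iic (0 : Fin (n + 1)) = {0} := Finset.Iic_bot
      simpa [h3] using h2.2 0
    · rw [h2.1]
  refine le_trans ?_ h1
  have h2 := decr_antitone β (Fin.zero_le
    ((Fin.revPerm.trans (Tuple.sort β) : Equiv.Perm (Fin (n + 1))).symm j))
  have h3 : decr β ((Fin.revPerm.trans (Tuple.sort β) : Equiv.Perm (Fin (n + 1))).symm j) = β j := by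
    rw [decr_eq_comp, Function.comp_apply, Equiv.apply_symm_apply]
  rwa [h3] at h2

theorem onesZeros_antitone (m : ℕ) : Antitone (onesZeros n m) := by
  intro a b hab
  rw [Fin.le_def] at hab
  unfold onesZeros
  split_ifs <;> omega

theorem coe_sqExp (E : Pattern n) : ⇑(sqExp E) = fun j => if E j then 1 else 0 := rfl

theorem sqExp_top (m : ℕ) :
    sqExp (Pattern.top n m) = Finsupp.equivFunOnFinite.symm (onesZeros n m) := by
  ext j
  simp [sqExp, Pattern.top, onesZeros]

theorem coe_sqExp_top (m : ℕ) : ⇑(sqExp (Pattern.top n m)) = onesZeros n m := by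
  rw [sqExp_top]
  rfl

theorem wt_sqExp (E : Pattern n) : wt (sqExp E) = E.weight := by
  rw [wt, Pattern.weight, Finset.card_filter]
  rfl

theorem wt_onesZeros {m : ℕ} (hm : m ≤ n + 1) : wt (onesZeros n m) = m := by
  rw [← coe_sqExp_top, wt_sqExp, Pattern.weight_top hm]

theorem decr_sqExp (E : Pattern n) : decr (sqExp E) = onesZeros n E.weight := by
  set σ : Equiv.Perm (Fin (n + 1)) := Fin.revPerm.trans (Tuple.sort (sqExp E))
  have h1 : decr (sqExp E) = ⇑(sqExp (E ∘ σ)) := rfl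
  have h2 : Antitone (E ∘ σ : Pattern n) := by
    intro a b hab
    have h3 := decr_antitone (sqExp E) hab
    rw [h1, coe_sqExp] at h3
    cases ha : (E ∘ σ) a <;> cases hb : (E ∘ σ) b <;> simp_all
  have h3 : Pattern.weight (E ∘ σ : Pattern n) = E.weight :=
    Finset.card_bijective σ σ.bijective fun j => by simp
  rw [h1, Pattern.eq_top_of_antitone h2, h3, coe_sqExp_top]

theorem eq_or_above_sqExp {m : ℕ} (hm : m ≤ n + 1) {E : Pattern n} (hE : E.weight = m) :
    ⇑(sqExp E) = onesZeros n m ∨ Above (onesZeros n m) (sqExp E) := by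
  by_cases h : ⇑(sqExp E) = onesZeros n m
  · exact Or.inl h
  refine Or.inr ⟨by rw [wt_onesZeros hm, wt_sqExp, hE], Or.inr ⟨?_, fun h' => h h'.symm, ?_⟩⟩
  · rw [decr_sqExp, hE, decr_of_antitone (onesZeros_antitone m)]
  · intro j
    by_cases hj : (j : ℕ) < m
    · refine Finset.sum_le_sum fun i hi => ?_
      have h1 : (i : ℕ) < m := lt_of_le_of_lt (Fin.le_def.1 (Finset.mem_Iic.1 hi)) hj
      rw [coe_sqExp, onesZeros, if_pos h1]
      dsimp only
      split_ifs <;> omega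
    · have h1 : ∑ i ∈ Finset.Iic j, onesZeros n m i = wt (onesZeros n m) := by
        refine Finset.sum_subset (Finset.subset_univ _) fun i _ hi => ?_
        rw [Finset.mem_Iic, not_le, Fin.lt_def] at hi
        rw [onesZeros, if_neg (by omega)]
      rw [h1, wt_onesZeros hm, ← hE, ← wt_sqExp, wt]
      exact Finset.sum_le_sum_of_subset (Finset.subset_univ _)

/-- Confines every Macdonald polynomial for this $\alpha$ to squarefree monomials, the setting of
the uniqueness argument. -/
theorem Above.le_one {m : ℕ} {β : Fin (n + 1) → ℕ} (h : Above (onesZeros n m) β)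
    (j : Fin (n + 1)) : β j ≤ 1 := by
  refine (h.apply_le j).trans ?_
  rw [decr_of_antitone (onesZeros_antitone m), onesZeros]
  split_ifs <;> omega

end Compositions

/-! ### The tableau `S₀` -/

section ColumnFilled

variable {μ : YoungDiagram} {n : ℕ}

theorem lastColLen_pos (hcol : 2 ≤ μ.rowLen 0) : 0 < lastColLen μ := by
  rw [lastColLen, ← YoungDiagram.mem_iff_lt_colLen, YoungDiagram.mem_iff_lt_rowLen]
  omega

theorem lastColLen_lt (hcard : μ.card = n + 1) (hcol : 2 ≤ μ.rowLen 0) :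
    lastColLen μ < n + 1 := by
  rw [← hcard, lastColLen, YoungDiagram.colLen_eq_card]
  refine Finset.card_lt_card ⟨Finset.filter_subset _ _, fun h => ?_⟩
  have h1 : ((0, 0) : ℕ × ℕ) ∈ μ := YoungDiagram.mem_iff_lt_rowLen.2 (by omega)
  have h2 := (YoungDiagram.mem_col_iff.1 (h h1)).2
  simp only at h2
  omega

theorem exists_succ_eq_lastColLen (hcard : μ.card = n + 1) (hcol : 2 ≤ μ.rowLen 0) :
    ∃ k : Fin n, (k : ℕ) + 1 = lastColLen μ := by
  have h1 := lastColLen_pos hcol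
  have h2 := lastColLen_lt hcard hcol
  exact ⟨⟨lastColLen μ - 1, by omega⟩, by simp only; omega⟩

theorem columnFilled_entry_lt (hcard : μ.card = n + 1) {c c' : Cell μ} (h : c.1.2 < c'.1.2) :
    (columnFilled hcard).entry c' < (columnFilled hcard).entry c := by
  have := colEquiv_lt hcard c c' (Prod.Lex.toLex_lt_toLex.2 (Or.inl h))
  simpa [columnFilled] using this

/-- The entries of the last column form a lower set, since every earlier column has larger entries,
and a lower set is determined by its size. -/
theorem lastColFirst_columnFilled (hcard : μ.card = n + 1) :
    LastColFirst (columnFilled hcard).entry := by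
  intro c
  set R := (columnFilled hcard).entry
  let s : Finset (Fin (n + 1)) := Finset.univ.filter fun j => μ.rowLen 0 - 1 ≤ (R.symm j).1.2
  have h1 := mem_iff_lt_card_of_lower s (fun a b hab hb => by
    simp only [s, Finset.mem_filter, Finset.mem_univ, true_and] at hb ⊢
    by_contra ha
    have := columnFilled_entry_lt hcard ((not_le.1 ha).trans_le hb)
    change R _ < R _ at this
    rw [Equiv.apply_symm_apply, Equiv.apply_symm_apply] at this
    exact absurd this hab.asymm) (R c)
  have h2 : s.card = lastColLen μ := by
    rw [lastColLen, YoungDiagram.colLen_eq_card]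
    refine Finset.card_bij (fun j _ => (R.symm j).1) ?_ ?_ ?_
    · intro j hj
      simp only [s, Finset.mem_filter, Finset.mem_univ, true_and] at hj
      have := Cell.col_lt (R.symm j)
      exact YoungDiagram.mem_col_iff.2 ⟨(R.symm j).2, by omega⟩
    · intro a _ b _ h
      exact R.symm.injective (Subtype.ext h)
    · intro x hx
      obtain ⟨h3, h4⟩ := YoungDiagram.mem_col_iff.1 hx
      refine ⟨R ⟨x, h3⟩, ?_, by simp⟩
      simp only [s, Finset.mem_filter, Finset.mem_univ, true_and, Equiv.symm_apply_apply]
      exact h4.ge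
  rw [h2] at h1
  rw [← h1]
  simp [s]

/-- The tableau `S₀` as a filling of the cut diagram. -/
def cutColumnFilled (hcard : μ.card = n + 1) : CutTableau μ n :=
  ⟨(columnFilled hcard).entry, isCut_of_rsyt _ _⟩

theorem cutCont_columnFilled {K : Type*} [Field K] (q t : K) (hcard : μ.card = n + 1)
    (i : Fin (n + 1)) :
    cutCont q t (μ.rowLen 0 - 1) ((columnFilled hcard).entry.symm i) =
      zeta q t (onesZeros n (lastColLen μ)) (columnFilled hcard) i := by
  rw [zeta, rank_of_antitone (onesZeros_antitone _), cutCont, onesZeros]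
  have h := lastColFirst_columnFilled hcard ((columnFilled hcard).entry.symm i)
  rw [Equiv.apply_symm_apply] at h
  rw [← if_congr h rfl rfl]
  congr 1
  split_ifs <;> simp

theorem single_vecMul_leadMatrix (K : Type*) [Field K] (hcard : μ.card = n + 1) :
    Matrix.vecMul (Pi.single (cutColumnFilled hcard) 1) (leadMatrix K μ n) =
      Pi.single (columnFilled hcard) 1 := by
  classical
  rw [Matrix.single_one_vecMul]
  funext S
  have h1 : S.entry = (cutColumnFilled hcard).1 ↔ S = columnFilled hcard :=
    ⟨fun h => RSYT.ext h, fun h => by rw [h]; rfl⟩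
  have h2 : LastColFirst (cutColumnFilled hcard).1 := lastColFirst_columnFilled hcard
  simp only [Matrix.row, leadMatrix, h1, h2, and_true, Pi.single_apply]

end ColumnFilled

/-! ### Linearity of the operators -/

section Linear

variable {μ : YoungDiagram} {n : ℕ} {K : Type*} [Field K]

theorem dividedDiff_add (i : Fin n) (p r : MvPolynomial (Fin (n + 1)) K) :
    dividedDiff i (p + r) = dividedDiff i p + dividedDiff i r := by
  apply dividedDiff_eq
  rw [mul_add, ← dividedDiff_spec, ← dividedDiff_spec]
  simp only [swapVars, map_add]
  ring

theorem opT_add (t : K) (i : Fin n) (f g : VPoly K μ n) :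
    opT t i (f + g) = opT t i f + opT t i g := by
  funext S
  simp only [opT, Pi.add_apply, dividedDiff_add, swapVars, map_add, mul_add,
    Finset.sum_add_distrib]
  ring

theorem opT_zero (t : K) (i : Fin n) : opT t i (0 : VPoly K μ n) = 0 := by
  simpa using opT_smul t i 0 (0 : VPoly K μ n)

theorem opTinv_add_smul (t : K) (i : Fin n) (c : K) (f g : VPoly K μ n) :
    opTinv t i (f + c • g) = opTinv t i f + c • opTinv t i g := by
  rw [opTinv, opTinv, opTinv, opT_add, opT_smul]
  module

theorem opT_add_smul (t : K) (i : Fin n) (c : K) (f g : VPoly K μ n) :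
    opT t i (f + c • g) = opT t i f + c • opT t i g := by
  rw [opT_add, opT_smul]

theorem opW_add_smul (q t : K) (c : K) (f g : VPoly K μ n) :
    opW q t (f + c • g) = opW q t f + c • opW q t g := by
  funext S
  simp only [opW, Pi.add_apply, Pi.smul_apply, map_add, map_smul, mul_add, mul_smul_comm,
    Finset.sum_add_distrib, Finset.smul_sum]

theorem foldl_add_smul {ι : Type*} {op : ι → VPoly K μ n → VPoly K μ n} {c : K}
    (h : ∀ i f g, op i (f + c • g) = op i f + c • op i g) (l : List ι) (f g : VPoly K μ n) :
    l.foldl (fun h k => op k h) (f + c • g) =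
      l.foldl (fun h k => op k h) f + c • l.foldl (fun h k => op k h) g := by
  induction l generalizing f g with
  | nil => rfl
  | cons a l ih => rw [List.foldl_cons, h, ih, List.foldl_cons, List.foldl_cons]

theorem opXi_add_smul (q t : K) (i : Fin (n + 1)) (c : K) (f g : VPoly K μ n) :
    opXi q t i (f + c • g) = opXi q t i f + c • opXi q t i g := by
  simp only [opXi]
  rw [foldl_add_smul (fun i f g => opTinv_add_smul t i c f g), opW_add_smul,
    foldl_add_smul (fun i f g => opT_add_smul t i c f g), smul_add, smul_comm]

end Linear

/-! ### The Macdonald polynomial -/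

section Macdonald

variable {μ : YoungDiagram} {n : ℕ} {K : Type*} [Field K] {q t : K}

/-- $\alpha$ is a partition, so it has no inversions and the word is empty. -/
theorem isLeadingVector_onesZeros {m : ℕ} {S : RSYT μ n} {v : RSYT μ n → K} :
    IsLeadingVector t (onesZeros n m) S v ↔ v = Pi.single S 1 := by
  unfold IsLeadingVector
  rw [inv_of_antitone (onesZeros_antitone m), decr_of_antitone (onesZeros_antitone m)]
  constructor
  · rintro ⟨l, h1, -, h3⟩
    rw [List.length_eq_zero_iff] at h1
    subst h1
    exact h3
  · rintro rfl
    exact ⟨[], rfl, rfl, rfl⟩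

/-- The image of the tableau `S₀`. -/
def columnPoly (hg : Generic μ (μ.rowLen 0 - 1) q t) (hcard : μ.card = n + 1) : VPoly K μ n :=
  imagePoly t (colData hg).mat (lastColLen μ) (leadMatrix K μ n)
    (Pi.single (cutColumnFilled hcard) 1)

theorem coeff_top_columnPoly (hg : Generic μ (μ.rowLen 0 - 1) q t) (hcard : μ.card = n + 1)
    (S : RSYT μ n) :
    coeff (sqExp (Pattern.top n (lastColLen μ))) (columnPoly hg hcard S) =
      (Pi.single (columnFilled hcard) 1 : RSYT μ n → K) S := by
  rw [columnPoly, imagePoly, coeff_sqPoly_sqExp, Intertwiner.coeffFam_top,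
    single_vecMul_leadMatrix]

theorem vecMul_coeffFam_eq_zero (hg : Generic μ (μ.rowLen 0 - 1) q t) (hcard : μ.card = n + 1)
    (hcol : 2 ≤ μ.rowLen 0) (u : CutTableau μ n → K) {E : Pattern n}
    (hE : E.weight ≠ lastColLen μ) :
    Matrix.vecMul u (coeffFam t (colData hg).mat (heckeMatrix t) (lastColLen μ)
      (leadMatrix K μ n) E) = 0 := by
  rw [Intertwiner.coeffFam_eq_zero (lastColLen_lt hcard hcol).le E hE, Matrix.vecMul_zero]

/-- The $J_i$ are diagonal, so the basis vector $S_0$ is an eigenvector. Its contents are the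
spectral vector because the last column of $S_0$ holds exactly the places where $\alpha_i=1$. -/
theorem isMacdonald_columnPoly (hg : Generic μ (μ.rowLen 0 - 1) q t) (hcard : μ.card = n + 1)
    (hcol : 2 ≤ μ.rowLen 0) :
    IsMacdonald q t (onesZeros n (lastColLen μ)) (columnFilled hcard) (columnPoly hg hcard) where
  eigen i := by
    obtain ⟨k, hk⟩ := exists_succ_eq_lastColLen hcard hcol
    have h1 := opXi_imagePoly (intertwiner hg hk) i (Pi.single (cutColumnFilled hcard) 1)
    rw [hk] at h1
    rw [columnPoly, h1, ← imagePoly_smul]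
    congr 1
    rw [SeminormalData.jm]
    funext R
    rw [Matrix.vecMul_diagonal, Pi.smul_apply, smul_eq_mul]
    by_cases hR : R = cutColumnFilled hcard
    · subst hR
      rw [mul_comm, ← cutCont_columnFilled]
      rfl
    · rw [Pi.single_eq_of_ne hR, zero_mul, mul_zero]
  leading := ⟨0, 0, _, isLeadingVector_onesZeros.2 rfl, fun S => by
    rw [← sqExp_top, coeff_top_columnPoly, pow_zero, pow_zero, one_mul, one_mul]⟩
  lower β S h := by
    rw [columnPoly, imagePoly, coeff_sqPoly] at h
    obtain ⟨E, -, hE⟩ := Finset.exists_ne_zero_of_sum_ne_zero h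
    rw [ne_eq, ite_eq_right_iff, not_forall] at hE
    obtain ⟨rfl, hE⟩ := hE
    refine eq_or_above_sqExp (lastColLen_lt hcard hcol).le ?_
    by_contra hw
    rw [vecMul_coeffFam_eq_zero hg hcard hcol _ hw] at hE
    exact hE rfl

/-- The difference with the matching multiple of `columnPoly` has the same eigenvalues but no
leading term, so `sqPoly_eq_zero` applies. -/
theorem IsMacdonald.eq_smul (hg : Generic μ (μ.rowLen 0 - 1) qGen tGen) (hcard : μ.card = n + 1)
    (hcol : 2 ≤ μ.rowLen 0) {M : VPoly Qqt μ n}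
    (hM : IsMacdonald qGen tGen (onesZeros n (lastColLen μ)) (columnFilled hcard) M) :
    ∃ a b : ℕ, M = (qGen ^ a * tGen ^ b) • columnPoly hg hcard := by
  have hm := (lastColLen_lt hcard hcol).le
  obtain ⟨a, b, v₁, hv₁, hlead⟩ := hM.leading
  rw [isLeadingVector_onesZeros] at hv₁
  subst hv₁
  refine ⟨a, b, ?_⟩
  set c : Qqt := qGen ^ a * tGen ^ b
  have hwt : ∀ (β : Fin (n + 1) →₀ ℕ) S, coeff β (M S) ≠ 0 → wt β = lastColLen μ := by
    intro β S h
    rw [← wt_onesZeros hm]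
    rcases hM.lower β S h with h1 | h1
    · rw [h1]
    · exact h1.1.symm
  obtain ⟨v, hv⟩ := exists_eq_sqPoly M fun β S h j => by
    rcases hM.lower β S h with h1 | h1
    · rw [h1, onesZeros]
      split_ifs <;> omega
    · exact h1.le_one j
  obtain ⟨w, hw⟩ : ∃ w, columnPoly hg hcard = sqPoly w := ⟨_, rfl⟩
  have hw0 : ∀ E : Pattern n, E.weight ≠ lastColLen μ → w E = 0 := by
    intro E hE
    funext S
    rw [← coeff_sqPoly_sqExp w, ← hw, columnPoly, imagePoly, coeff_sqPoly_sqExp,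
      vecMul_coeffFam_eq_zero hg hcard hcol _ hE]
  have hdiff : M + (-c) • columnPoly hg hcard = sqPoly (v + (-c) • w) := by
    rw [sqPoly_add, sqPoly_smul, hv, hw]
  have hzero : sqPoly (v + (-c) • w) = 0 := by
    refine sqPoly_eq_zero transcendental_qGen tGen_mem hm ?_ ?_ ?_
    · intro E hE
      rw [Pi.add_apply, Pi.smul_apply, hw0 E hE, smul_zero, add_zero]
      funext S
      by_contra h
      rw [← coeff_sqPoly_sqExp v, ← hv] at h
      exact hE ((wt_sqExp E).symm.trans (hwt _ S h))
    · funext S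
      have h1 := hlead S
      rw [← sqExp_top, hv, coeff_sqPoly_sqExp] at h1
      have h2 := coeff_top_columnPoly hg hcard S
      rw [hw, coeff_sqPoly_sqExp] at h2
      change v _ S + -c * w _ S = 0
      rw [h1, h2]
      ring
    · intro j hj
      refine ⟨zeta qGen tGen (onesZeros n (lastColLen μ)) (columnFilled hcard) j, ?_, ?_, ?_⟩
      -- Here $\alpha_j=0$, so the eigenvalue is a power of $t$ alone.
      · rw [zeta, onesZeros, if_neg (not_lt.2 hj), pow_zero, one_mul]
        exact zpow_mem tGen_mem _
      · exact mul_ne_zero (pow_ne_zero _ hg.q_ne) (zpow_ne_zero _ hg.t_ne)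
      · rw [← hdiff, opXi_add_smul, hM.eigen, (isMacdonald_columnPoly hg hcard hcol).eigen,
          smul_add, smul_comm]
  rw [← hdiff] at hzero
  rw [← sub_eq_zero, ← hzero, neg_smul, sub_eq_add_neg]

end Macdonald

/-! ### Singularity -/

section Singular

variable {μ : YoungDiagram} {n : ℕ} {K : Type*} [Field K] {t : K}

/-- The entry on top of the last column is less than the entry at the bottom of the first one. -/
def CornersIncreasing (R : Cell μ ≃ Fin (n + 1)) : Prop :=
  ∀ x y : Cell μ, x.1 = (0, μ.rowLen 0 - 1) → y.1 = (μ.colLen 0 - 1, 0) → R x < R y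

/-- The contents are $t^{-\ell(\tau)}$ and $t^{1-\ell(\tau)}$, so the factor $tx-y$ of `offProd`
vanishes. This is where the value $h_\tau$ comes from. -/
theorem cutCoef_corners (hcol : 2 ≤ μ.rowLen 0) (ht0 : t ≠ 0) {x y : Cell μ}
    (hx : x.1 = (0, μ.rowLen 0 - 1)) (hy : y.1 = (μ.colLen 0 - 1, 0)) :
    cutCoef (t ^ (-(maxHook μ : ℤ))) t (μ.rowLen 0 - 1) x y = 0 := by
  have h1 : μ.rowLen 0 - 1 ≤ x.1.2 := by rw [hx]
  have h2 : ¬μ.rowLen 0 - 1 ≤ y.1.2 := by rw [hy]; simp only; omega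
  have h3 := y.row_lt
  have h4 : t * cutCont (t ^ (-(maxHook μ : ℤ))) t (μ.rowLen 0 - 1) x =
      cutCont (t ^ (-(maxHook μ : ℤ))) t (μ.rowLen 0 - 1) y := by
    rw [cutCont, cutCont, if_pos h1, if_neg h2, one_mul, ← zpow_add₀ ht0, ← zpow_one_add₀ ht0]
    congr 1
    rw [hy] at h3
    simp only at h3
    unfold maxHook Cell.content
    rw [hx, hy]
    simp only
    omega
  rw [cutCoef, if_neg (by tauto), if_pos h1, offProd, h4, sub_self, zero_mul, zero_div]

theorem cornersIncreasing_exch {R : Cell μ ≃ Fin (n + 1)} (hR : CornersIncreasing R) {i : Fin n}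
    (h : ¬CornersIncreasing (exch i R)) :
    (R.symm i.castSucc).1 = (0, μ.rowLen 0 - 1) ∧ (R.symm i.succ).1 = (μ.colLen 0 - 1, 0) := by
  unfold CornersIncreasing at h
  push Not at h
  obtain ⟨x, y, hx, hy, hlt⟩ := h
  have h1 := hR x y hx hy
  have h2 : R x = i.castSucc ∧ R y = i.succ := by
    simp only [exch, Equiv.trans_apply, Equiv.swap_apply_def] at hlt
    rw [Fin.lt_def] at h1
    rw [Fin.ext_iff, Fin.ext_iff]
    split_ifs at hlt with e1 e2 e3 e4 e5 e6 <;> rw [Fin.le_def] at hlt <;>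
      simp only [Fin.ext_iff, Fin.val_succ, Fin.val_castSucc] at * <;> omega
  rw [← h2.1, ← h2.2, Equiv.symm_apply_apply, Equiv.symm_apply_apply]
  exact ⟨hx, hy⟩

theorem cornersIncreasing_columnFilled (hcard : μ.card = n + 1) (hcol : 2 ≤ μ.rowLen 0) :
    CornersIncreasing (columnFilled hcard).entry := by
  intro x y hx hy
  refine columnFilled_entry_lt hcard ?_
  rw [hx, hy]
  simp only
  omega

/-- If the largest entry lay in the last column, it would lie on its top, exceeding the bottom entry
of the first column. So it lies in the corner box, of content $1$. -/
theorem CornersIncreasing.cutCont_last {R : Cell μ ≃ Fin (n + 1)} (hc : CornersIncreasing R)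
    (hR : IsCut (μ.rowLen 0 - 1) R) (q t : K) :
    cutCont q t (μ.rowLen 0 - 1) (R.symm (Fin.last n)) = 1 := by
  refine hR.cutCont_last ?_ q t
  by_contra h
  set z := R.symm (Fin.last n) with hz
  have hRz : R z = Fin.last n := by rw [hz, Equiv.apply_symm_apply]
  have h1 : z.1.2 = μ.rowLen 0 - 1 := by have := z.col_lt; omega
  have h2 : z.1.1 = 0 := by
    by_contra hne
    have := hR.2 ⟨(0, z.1.2), z.mem_of_le (Nat.zero_le _) le_rfl⟩ z rfl (Nat.pos_of_ne_zero hne)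
    rw [hRz] at this
    exact absurd this (not_lt.2 (Fin.le_last _))
  have h3 : (μ.colLen 0 - 1, 0) ∈ μ.cells := by
    have := z.row_lt
    exact YoungDiagram.mem_iff_lt_colLen.2 (by omega)
  have := hc z ⟨_, h3⟩ (Prod.ext h2 h1) rfl
  rw [hRz] at this
  exact absurd this (not_lt.2 (Fin.le_last _))

variable (hg : Generic μ (μ.rowLen 0 - 1) (t ^ (-(maxHook μ : ℤ))) t)

/-- Stability of the span of the `CornersIncreasing` fillings: the only exchange leaving it swaps
consecutive entries of the two corner boxes, and its coefficient is zero by `cutCoef_corners`. -/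
theorem vecMul_mat_eq_zero (hcol : 2 ≤ μ.rowLen 0) {u : CutTableau μ n → K}
    (hu : ∀ R, ¬CornersIncreasing R.1 → u R = 0) (i : Fin n) (R : CutTableau μ n)
    (hR : ¬CornersIncreasing R.1) : Matrix.vecMul u ((colData hg).mat i) R = 0 := by
  refine Finset.sum_eq_zero fun R' _ => ?_
  by_cases hR' : CornersIncreasing R'.1
  · have h : (colData hg).mat i R' R = 0 := by
      rw [SeminormalData.mat]
      split_ifs with h1 h2
      · exact absurd (h1 ▸ hR') hR
      · have h3 : R.1 = exch i R'.1 := h2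
        rw [h3] at hR
        obtain ⟨h4, h5⟩ := cornersIncreasing_exch hR' hR
        exact cutCoef_corners hcol hg.t_ne h4 h5
      · rfl
    exact mul_eq_zero_of_right _ h
  · exact mul_eq_zero_of_left (hu R' hR') _

/-- Stated for all vectors of the submodule, not only $S_0$, because the descent from $\mathcal
D_{i+1}$ to $\mathcal D_i$ replaces `u` by its image under $X_i$. -/
theorem isSingular_imagePoly (hcard : μ.card = n + 1) (hcol : 2 ≤ μ.rowLen 0)
    {u : CutTableau μ n → K} (hu : ∀ R, ¬CornersIncreasing R.1 → u R = 0) :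
    IsSingular (t ^ (-(maxHook μ : ℤ))) t
      (imagePoly t (colData hg).mat (lastColLen μ) (leadMatrix K μ n) u) := by
  obtain ⟨k, hk⟩ := exists_succ_eq_lastColLen hcard hcol
  intro i
  rw [← hk]
  unfold opD
  induction i using Fin.reverseInduction generalizing u with
  | last =>
    rw [Fin.reverseInduction_last]
    have h : Matrix.vecMul u ((colData hg).jm (Fin.last n)) = u := by
      funext R
      rw [SeminormalData.jm, Matrix.vecMul_diagonal]
      by_cases hR : CornersIncreasing R.1
      · exact (congrArg (u R * ·) (hR.cutCont_last R.2 _ _)).trans (mul_one _)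
      · rw [hu R hR, zero_mul]
    funext S
    rw [opDlast, opXi_imagePoly (intertwiner hg hk), h, sub_self, zero_divMonomial]
    rfl
  | cast i ih =>
    rw [Fin.reverseInduction_castSucc, opT_imagePoly (intertwiner hg hk),
      ih (vecMul_mat_eq_zero hg hcol hu i), opT_zero, smul_zero]

end Singular

/-- The Macdonald polynomial specializes to a nonzero singular polynomial. -/
theorem IsMacdonald.exists_singular {μ : YoungDiagram} {n : ℕ} (hcard : μ.card = n + 1)
    (hcol : 2 ≤ μ.rowLen 0) {M : VPoly Qqt μ n}
    (hM : IsMacdonald qGen tGen (onesZeros n (lastColLen μ)) (columnFilled hcard) M)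
    {L : Type*} [Field L] [CharZero L] {t₀ : L} (ht0 : t₀ ≠ 0)
    (ht : ∀ k : ℕ, 0 < k → t₀ ^ k ≠ 1) :
    ∃ M₀ : VPoly L μ n, SpecializesTo (t₀ ^ (-(maxHook μ : ℤ))) t₀ M M₀ ∧ M₀ ≠ 0 ∧
      IsSingular (t₀ ^ (-(maxHook μ : ℤ))) t₀ M₀ := by
  have hg := generic_zpow_maxHook (μ := μ) ht0 ht
  obtain ⟨a, b, rfl⟩ := hM.eq_smul hg.of_hasValueAt hcard hcol
  set q₀ := t₀ ^ (-(maxHook μ : ℤ))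
  refine ⟨(q₀ ^ a * t₀ ^ b) • columnPoly hg hcard, ?_, ?_, ?_⟩
  · rw [columnPoly, columnPoly, ← imagePoly_smul, ← imagePoly_smul]
    refine specializesTo_imagePoly hg _ fun R => ?_
    refine ((HasValueAt.qGen.pow a).mul (HasValueAt.tGen.pow b)).mul ?_
    rw [Pi.single_apply, Pi.single_apply]
    split_ifs
    exacts [.one, .zero]
  · intro h
    have h1 := coeff_top_columnPoly hg hcard (columnFilled hcard)
    rw [(smul_eq_zero_iff_right (mul_ne_zero (pow_ne_zero a hg.q_ne)
      (pow_ne_zero b hg.t_ne))).1 h] at h1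
    simp at h1
  · rw [columnPoly, ← imagePoly_smul]
    refine isSingular_imagePoly hg hcard hcol fun R hR => ?_
    have : R ≠ cutColumnFilled hcard := by
      rintro rfl
      exact hR (cornersIncreasing_columnFilled hcard hcol)
    rw [Pi.smul_apply, Pi.single_eq_of_ne this, smul_zero]

/-- Lifted from the rational point $t=2$, $q=2^{-h_\tau}$; any $t$ that is not a root of unity would
serve. -/
theorem generic_qGen_tGen (μ : YoungDiagram) : Generic μ (μ.rowLen 0 - 1) qGen tGen :=
  (generic_zpow_maxHook (K := ℚ) (t := 2) two_ne_zero fun _ hk =>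
    (one_lt_pow₀ one_lt_two hk.ne').ne').of_hasValueAt

end VVMac

end

theorem mainTheorem8 (n : ℕ) (μ : YoungDiagram) (hcard : μ.card = n + 1)
    (hcol : 2 ≤ μ.rowLen 0) :
    (∃ M : VVMac.VPoly VVMac.Qqt μ n,
      VVMac.IsMacdonald VVMac.qGen VVMac.tGen (VVMac.onesZeros n (VVMac.lastColLen μ))
        (VVMac.columnFilled hcard) M) ∧
    ∀ M : VVMac.VPoly VVMac.Qqt μ n,
      VVMac.IsMacdonald VVMac.qGen VVMac.tGen (VVMac.onesZeros n (VVMac.lastColLen μ))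
        (VVMac.columnFilled hcard) M →
      ∀ (L : Type*) [Field L] [CharZero L] (q₀ t₀ : L), t₀ ≠ 0 →
        (∀ k : ℕ, 0 < k → t₀ ^ k ≠ 1) →
        q₀ = t₀ ^ (-(VVMac.maxHook μ : ℤ)) →
        ∃ M₀ : VVMac.VPoly L μ n,
          VVMac.SpecializesTo q₀ t₀ M M₀ ∧ M₀ ≠ 0 ∧ VVMac.IsSingular q₀ t₀ M₀ := by
  refine ⟨⟨_, VVMac.isMacdonald_columnPoly (VVMac.generic_qGen_tGen μ) hcard hcol⟩, ?_⟩
  intro M hM L _ _ q₀ t₀ ht0 ht hq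
  subst hq
  exact hM.exists_singular hcard hcol ht0 ht
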